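/- A multigraph is a loopless graph with countably many vertices in which each pair of distinct vertices may be joined by finitely many parallel edges. Random rooted multigraphs are considered up to root-preserving isomorphism: the law of such a random multigraph is its distribution on isomorphism classes, i.e. on the isomorphism-invariant events. Let $\lambda\ge 0$. The splitting operation $(\star)$ with parameter $\lambda$ turns a random rooted connected multigraph $(G,o)$ into another one as follows. Every vertex $v$ of $G$ (including $o$) is replaced by two vertices $v_1,v_2$, which are joined by a random number of edges with distribution $\mathrm{Po}(\lambda/2)$. Every edge $uv$ of $G$ is replaced by one of the four edges $u_iv_j$, $i,j\in\{1,2\}$, chosen uniformly at random. The new root is $o_1$ or $o_2$, with probability $\frac12$ each. All these random choices are independent of each other and of $(G,o)$. Finally, all components that do not contain the new root are discarded. Then for every $\lambda\ge 0$ there is exactly one law of a random rooted connected multigraph $(G(\lambda),o)$ with finite expected root degree that is invariant under $(\star)$. Moreover, this law is that of the component of the origin $0$, rooted at $0$, in the following long-range percolation on $\Gamma=\bigoplus_{i\ge 1}\mathbb Z/2\mathbb Z$ (the Poisson edge model): independently for every pair of distinct elements $x,y\in\Gamma$, the number of edges joining $x$ and $y$ is Poisson with mean $2\lambda 4^{-h(x,y)}$,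 where $h(x,y)=\max\{i\ge 1: x_i\ne y_i\}$. -/

import Mathlib

open MeasureTheory ProbabilityTheory
open scoped NNReal ENNReal

noncomputable section

/-- A rooted (loopless) multigraph whose vertices are labelled by elements of `V`: a set of
vertices, one of which is the root, and for every pair of vertices the (finite) number of parallel
edges joining them. Neither finiteness nor local finiteness is assumed. -/
structure RootedMultigraph (V : Type*) where
  /-- the vertex set -/
  verts : Set V
  /-- the root -/
  root : V
  /-- the number of edges joining two vertices -/
  mult : V → V → ℕ
  root_mem : root ∈ verts
  mult_comm : ∀ u v, mult u v = mult v u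
  mult_self : ∀ v, mult v v = 0
  mem_of_mult_ne_zero : ∀ u v, mult u v ≠ 0 → u ∈ verts

namespace RootedMultigraph

/-- The sigma-algebra generated by the root, the indicators `v ∈ verts`, and the edge
multiplicities. -/
instance instMeasurableSpace {V : Type*} : MeasurableSpace (RootedMultigraph V) :=
  (⊤ : MeasurableSpace V).comap root
    ⊔ (inferInstance : MeasurableSpace (Set V)).comap verts
    ⊔ (inferInstance : MeasurableSpace (V → V → ℕ)).comap mult

variable {V W : Type*}

/-- `G.Reachable v`: there is a path from the root to `v`. -/
def Reachable (G : RootedMultigraph V) (v : V) : Prop :=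
  Relation.ReflTransGen (fun x y => G.mult x y ≠ 0) G.root v

/-- Every vertex can be reached from the root. -/
def Connected (G : RootedMultigraph V) : Prop :=
  ∀ v ∈ G.verts, G.Reachable v

/-- The number of edges at the root. -/
def rootDegree (G : RootedMultigraph V) : ℝ≥0∞ :=
  ∑' v, (G.mult G.root v : ℝ≥0∞)

open Classical in
/-- The component (cluster) of the root. -/
def cluster (G : RootedMultigraph V) : RootedMultigraph V where
  verts := {v | G.Reachable v}
  root := G.root
  mult u v := if G.Reachable u ∧ G.Reachable v then G.mult u v else 0
  root_mem := Relation.ReflTransGen.refl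
  mult_comm u v := by simp only [and_comm, G.mult_comm u v]
  mult_self v := by simp [G.mult_self v]
  mem_of_mult_ne_zero u v h := by
    by_contra hu
    exact h (if_neg fun h' => hu h'.1)

/-- Isomorphism of rooted multigraphs: a bijection between the vertex sets that preserves the root
and all edge multiplicities. -/
def Iso (G : RootedMultigraph V) (H : RootedMultigraph W) : Prop :=
  ∃ e : G.verts ≃ H.verts,
    e ⟨G.root, G.root_mem⟩ = ⟨H.root, H.root_mem⟩ ∧
      ∀ u v : G.verts, H.mult (e u) (e v) = G.mult u v

/-- Isomorphism is an equivalence relation. -/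
instance isoSetoid (V : Type*) : Setoid (RootedMultigraph V) where
  r := Iso
  iseqv :=
    { refl := fun _ => ⟨Equiv.refl _, rfl, fun _ _ => rfl⟩
      symm := by
        rintro G H ⟨e, he, h⟩
        refine ⟨e.symm, by rw [← he, e.symm_apply_apply], fun u v => ?_⟩
        rw [← h, e.apply_symm_apply, e.apply_symm_apply]
      trans := by
        rintro G H K ⟨e, he, h⟩ ⟨f, hf, k⟩
        refine ⟨e.trans f, by rw [Equiv.trans_apply, he, hf], fun u v => ?_⟩
        rw [Equiv.trans_apply, Equiv.trans_apply, k, h] }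

/-- Rename the vertices of a multigraph along an injection. -/
def relabel (f : V ↪ W) (G : RootedMultigraph V) : RootedMultigraph W where
  verts := f '' G.verts
  root := f G.root
  mult a b := Function.extend (Prod.map f f) (fun p => G.mult p.1 p.2) 0 (a, b)
  root_mem := ⟨G.root, G.root_mem, rfl⟩
  mult_comm a b := by
    have hf : Function.Injective (Prod.map f f) := f.injective.prodMap f.injective
    by_cases h : ∃ u v, f u = a ∧ f v = b
    · obtain ⟨u, v, rfl, rfl⟩ := h
      have h1 := hf.extend_apply (fun p => G.mult p.1 p.2) 0 (u, v)
      have h2 := hf.extend_apply (fun p => G.mult p.1 p.2) 0 (v, u)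
      simp only [Prod.map_apply] at h1 h2
      rw [h1, h2, G.mult_comm]
    · rw [Function.extend_apply', Function.extend_apply']
      · rfl
      · rintro ⟨⟨u, v⟩, huv⟩
        rw [Prod.map_apply, Prod.mk.injEq] at huv
        exact h ⟨v, u, huv.2, huv.1⟩
      · rintro ⟨⟨u, v⟩, huv⟩
        rw [Prod.map_apply, Prod.mk.injEq] at huv
        exact h ⟨u, v, huv.1, huv.2⟩
  mult_self a := by
    have hf : Function.Injective (Prod.map f f) := f.injective.prodMap f.injective
    by_cases h : ∃ u, f u = a
    · obtain ⟨u, rfl⟩ := h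
      have h1 := hf.extend_apply (fun p => G.mult p.1 p.2) 0 (u, u)
      simp only [Prod.map_apply] at h1
      rw [h1, G.mult_self]
    · rw [Function.extend_apply']
      · rfl
      · rintro ⟨⟨u, v⟩, huv⟩
        rw [Prod.map_apply, Prod.mk.injEq] at huv
        exact h ⟨u, huv.1⟩
  mem_of_mult_ne_zero a b hab := by
    have hf : Function.Injective (Prod.map f f) := f.injective.prodMap f.injective
    by_cases h : ∃ u v, f u = a ∧ f v = b
    · obtain ⟨u, v, rfl, rfl⟩ := h
      have h1 := hf.extend_apply (fun p => G.mult p.1 p.2) 0 (u, v)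
      simp only [Prod.map_apply] at h1
      rw [h1] at hab
      exact ⟨u, G.mem_of_mult_ne_zero u v hab, rfl⟩
    · refine absurd (Function.extend_apply' _ _ _ ?_) hab
      rintro ⟨⟨u, v⟩, huv⟩
      rw [Prod.map_apply, Prod.mk.injEq] at huv
      exact h ⟨u, v, huv.1, huv.2⟩

/-- The space of isomorphism classes of countable rooted multigraphs. -/
def IsoClass : Type := Quotient (isoSetoid ℕ)

/-- Events of `IsoClass` are the isomorphism-invariant events of labelled multigraphs. -/
instance instMeasurableSpaceIsoClass : MeasurableSpace IsoClass :=
  MeasurableSpace.map (Quotient.mk (isoSetoid ℕ)) inferInstance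

/-- The isomorphism class of a multigraph with countably many vertices; it does not depend on
the injection of the set of labels into `ℕ` that is chosen here. -/
def isoClass [Countable V] (G : RootedMultigraph V) : IsoClass :=
  Quotient.mk (isoSetoid ℕ)
    (G.relabel ⟨(exists_injective_nat V).choose, (exists_injective_nat V).choose_spec⟩)

/-- The law, up to isomorphism, of a random rooted multigraph with labelled distribution `μ`. -/
def isoLaw [Countable V] (μ : Measure (RootedMultigraph V)) : Measure IsoClass :=
  μ.map isoClass

/-! ### The splitting operation -/

/-- A fair coin. -/
def fairCoin : Measure Bool := (PMF.uniformOfFintype Bool).toMeasure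

/-- A fair coin is a probability measure. -/
instance instIsProbabilityMeasureFairCoin : IsProbabilityMeasure fairCoin := by
  unfold fairCoin; infer_instance

/-- The outcomes of the random experiments in one splitting step. -/
structure SplitChoices (V : Type*) where
  /-- `side u v k` is the copy of `u` that the `k`-th edge between `u` and `v` is attached to
  (`side v u k` is the copy of `v` at its other end) -/
  side : V × V × ℕ → Bool
  /-- the number of new edges between the two copies of a vertex -/
  newEdges : V → ℕ
  /-- which of the two copies of the root becomes the new root -/
  rootCopy : Bool

open Classical in
/-- The result of the splitting step with given outcomes of the random experiments, all components
being retained. The two copies of `v` are `(v, false)` and `(v, true)`. -/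
def split (G : RootedMultigraph V) (c : SplitChoices V) : RootedMultigraph (V × Bool) where
  verts := {x | x.1 ∈ G.verts}
  root := (G.root, c.rootCopy)
  mult x y :=
    if x.1 = y.1 then
      if x.1 ∈ G.verts ∧ x.2 ≠ y.2 then c.newEdges x.1 else 0
    else
      ((Finset.range (G.mult x.1 y.1)).filter
        fun k => c.side (x.1, y.1, k) = x.2 ∧ c.side (y.1, x.1, k) = y.2).card
  root_mem := G.root_mem
  mult_comm x y := by
    by_cases h : x.1 = y.1
    · simp only [h, if_true, ne_comm]
    · rw [if_neg h, if_neg (Ne.symm h), G.mult_comm y.1 x.1]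
      simp only [and_comm]
  mult_self x := by simp
  mem_of_mult_ne_zero x y hxy := by
    by_contra hx
    have hx' : x.1 ∉ G.verts := hx
    by_cases h : x.1 = y.1
    · simp [h ▸ hx', h] at hxy
    · have h0 : G.mult x.1 y.1 = 0 := by
        by_contra h0
        exact hx' (G.mem_of_mult_ne_zero _ _ h0)
      simp [h, h0] at hxy

/-- The law of all the independent random experiments: a fair coin for every end of every edge,
a Poisson number of new edges with mean `lam / 2` for every vertex, and a fair coin for the root. -/
def splitChoicesLaw (lam : ℝ≥0) (V : Type*) :
    Measure ((V × V × ℕ → Bool) × (V → ℕ) × Bool) :=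
  (Measure.infinitePi fun _ : V × V × ℕ => fairCoin).prod
    ((Measure.infinitePi fun _ : V => poissonMeasure (lam / 2)).prod fairCoin)

/-- The distribution of the random rooted connected multigraph that is obtained from one with
distribution `μ` by the splitting operation: split, independently of the multigraph, and keep
only the component of the new root. -/
def splitLaw (lam : ℝ≥0) (μ : Measure (RootedMultigraph V)) :
    Measure (RootedMultigraph (V × Bool)) :=
  (μ.prod (splitChoicesLaw lam V)).map
    fun p => (p.1.split ⟨p.2.1, p.2.2.1, p.2.2.2⟩).cluster

/-- `L` is the law of a random rooted connected multigraph with finite expected root degree, and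
the splitting operation with parameter `lam` does not change this law. -/
def IsInvariantLaw (lam : ℝ≥0) (L : Measure IsoClass) : Prop :=
  ∃ μ : Measure (RootedMultigraph ℕ),
    IsProbabilityMeasure μ ∧
    (∀ᵐ G ∂μ, G.Connected) ∧
    ∫⁻ G, G.rootDegree ∂μ < ∞ ∧
    isoLaw μ = L ∧
    isoLaw (splitLaw lam μ) = L

/-! ### Long-range percolation on the direct sum of infinitely many copies of `ℤ/2` -/

/-- The direct sum of countably many copies of the group with two elements. -/
abbrev Gam : Type := ℕ →₀ ZMod 2

/-- The last coordinate in which `x` and `y` differ, where coordinates are counted from `1`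
(and `0` if `x = y`). -/
def lastDiff (x y : Gam) : ℕ := (x - y).support.sup fun i => i + 1

/-- `lastDiff` is symmetric. -/
theorem lastDiff_comm (x y : Gam) : lastDiff x y = lastDiff y x := by
  unfold lastDiff
  rw [← neg_sub, Finsupp.support_neg]

/-- The mean number `2 * lam * 4 ^ (- h(x, y))` of edges between `x` and `y`. -/
def edgeMean (lam : ℝ≥0) (e : Sym2 Gam) : ℝ≥0 :=
  2 * lam / 4 ^ (Sym2.lift ⟨lastDiff, lastDiff_comm⟩ e)

/-- The multigraph on the whole group, rooted at the origin, with prescribed edge numbers. -/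
def percolationGraph (N : Sym2 Gam → ℕ) : RootedMultigraph Gam where
  verts := Set.univ
  root := 0
  mult x y := if x = y then 0 else N s(x, y)
  root_mem := Set.mem_univ _
  mult_comm x y := by simp only [eq_comm, Sym2.eq_swap]
  mult_self x := if_pos rfl
  mem_of_mult_ne_zero _ _ _ := Set.mem_univ _

/-- The law of the cluster of the origin, when the edge numbers of all pairs are independent
Poisson random variables with means `edgeMean lam`. -/
def percolationClusterLaw (lam : ℝ≥0) : Measure IsoClass :=
  isoLaw ((Measure.infinitePi fun e : Sym2 Gam => poissonMeasure (edgeMean lam e)).map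
    fun N => (percolationGraph N).cluster)

end RootedMultigraph

end

/-! Uniqueness is a coupling argument. Split a multigraph `G` and a spanning subgraph `H`
repeatedly, with the same random choices for both. In each step an edge of `G` outside `H` attaches
to either copy of its end `x` with probability 1/2, and this coin is not used for splitting `H`.
After `n` steps the expected number of such edge ends inside the `r`-ball of the split `H` is
therefore at most `damage`: the sum over `x` of the excess degree at `x` times the expected number
of descendants of `x` in that ball, times `(1/2) ^ n` (`lintegral_damage_split_le`). If no excess
edge touches the ball, the two balls coincide (`splitOp_iterate_indicator_le`).

Let `H` consist of the root of `G` and no edges. Its splittings are multigraphs with independent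
Poisson edge numbers, and all expected degrees stay at most `lam`, because one step turns an
expected degree `d` into `lam / 2 + d / 2` (`lintegral_split_poisson`, `rowSum_splitMean`). Hence
the expected ball sizes are bounded uniformly in `n` (`lintegral_tsum_ballWeight_le`), and the
damage is at most `(1/2) ^ n` times a constant times the root degree of `G`. As the expected root
degree is finite, every invariant law gives a local event `A` the probability `lim splitProb lam A
n`, which does not depend on the law (`IsInvariantLaw.exists_bound`,
`IsInvariantLaw.eq_of_isLocal`).

Local events suffice, although the sigma-algebra consists of all isomorphism-invariant events.
Almost surely all balls are finite, and then the countably many ball patterns determine the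
isomorphism class by compactness (`iso_of_forall_ball`). A measurable image of a standard Borel
space in a countably separated space carries no further events with measurable preimage, so on these
classes every invariant event is generated by ball patterns (`exists_localClass_eq`).

Existence is Poisson thinning. Splitting the percolation gives independent Poisson edge numbers with
means `edgeMean / 4` between copies of distinct vertices and `lam / 2` between twins. Prepending a
bit to the elements of the group raises `lastDiff` by one for distinct pairs, so these are again the
means `edgeMean`; translation invariance takes care of the new root
(`lintegral_splitOp_percolation`). -/

namespace RootedMultigraph

variable {V W X : Type*}

/-! ### Paths from the root, and clusters -/

@[ext]
theorem ext {G H : RootedMultigraph V} (hv : G.verts = H.verts) (hr : G.root = H.root)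
    (hm : ∀ u v, G.mult u v = H.mult u v) : G = H := by
  cases G; cases H
  obtain rfl : _ = _ := hv
  obtain rfl : _ = _ := hr
  obtain rfl : _ = _ := funext fun u => funext fun v => hm u v
  rfl

theorem mem_of_mult_ne_zero_right (G : RootedMultigraph V) {u v : V} (h : G.mult u v ≠ 0) :
    v ∈ G.verts :=
  G.mem_of_mult_ne_zero v u (by rwa [G.mult_comm])

/-- There is a path of length at most `k` from the root to the given vertex. -/
def Within (G : RootedMultigraph V) : ℕ → V → Prop
  | 0, v => v = G.root
  | k + 1, v => G.Within k v ∨ ∃ u, G.Within k u ∧ G.mult u v ≠ 0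

theorem Within.mono {G : RootedMultigraph V} {k l : ℕ} (h : k ≤ l) {v : V} (hv : G.Within k v) :
    G.Within l v := by
  induction h with
  | refl => exact hv
  | step _ ih => exact Or.inl ih

theorem reachable_iff_exists_within {G : RootedMultigraph V} {v : V} :
    G.Reachable v ↔ ∃ k, G.Within k v := by
  constructor
  · intro h
    induction h with
    | refl => exact ⟨0, rfl⟩
    | tail _ hbc ih =>
      obtain ⟨k, hk⟩ := ih
      exact ⟨k + 1, Or.inr ⟨_, hk, hbc⟩⟩
  · rintro ⟨k, hk⟩
    induction k generalizing v with
    | zero => obtain rfl : v = G.root := hk; exact Relation.ReflTransGen.refl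
    | succ k ih =>
      rcases hk with hk | ⟨u, hu, huv⟩
      · exact ih hk
      · exact (ih hu).tail huv

theorem Within.reachable {G : RootedMultigraph V} {k : ℕ} {v : V} (h : G.Within k v) :
    G.Reachable v :=
  reachable_iff_exists_within.2 ⟨k, h⟩

theorem Within.mem_verts {G : RootedMultigraph V} {k : ℕ} {v : V} (h : G.Within k v) :
    v ∈ G.verts := by
  induction k with
  | zero => obtain rfl : v = G.root := h; exact G.root_mem
  | succ k ih =>
    rcases h with h | ⟨u, _, huv⟩
    · exact ih h
    · exact G.mem_of_mult_ne_zero_right huv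

theorem Reachable.mem_verts {G : RootedMultigraph V} {v : V} (h : G.Reachable v) :
    v ∈ G.verts :=
  (reachable_iff_exists_within.1 h).choose_spec.mem_verts

theorem cluster_within (G : RootedMultigraph V) (k : ℕ) (v : V) :
    G.cluster.Within k v ↔ G.Within k v := by
  induction k generalizing v with
  | zero => rfl
  | succ k ih =>
    simp only [Within, ih]
    refine or_congr Iff.rfl (exists_congr fun u => and_congr_right fun hu => ?_)
    have hur := hu.reachable
    constructor
    · intro h h0
      apply h
      simp [cluster, h0]
    · intro h
      have hv : G.Reachable v := hur.tail h
      simpa [cluster, hur, hv] using h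

theorem cluster_reachable (G : RootedMultigraph V) (v : V) :
    G.cluster.Reachable v ↔ G.Reachable v := by
  simp only [reachable_iff_exists_within, cluster_within]

theorem cluster_connected (G : RootedMultigraph V) : G.cluster.Connected :=
  fun v hv => (cluster_reachable G v).2 hv

theorem Connected.cluster_eq {G : RootedMultigraph V} (h : G.Connected) : G.cluster = G := by
  refine ext (Set.ext fun v => ⟨fun hv => Reachable.mem_verts hv, fun hv => h v hv⟩) rfl fun u v => ?_
  by_cases h0 : G.mult u v = 0
  · simp [cluster, h0]
  · exact if_pos ⟨h u (G.mem_of_mult_ne_zero u v h0), h v (G.mem_of_mult_ne_zero_right h0)⟩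

/-! ### Isomorphisms -/

theorem Iso.symm {G : RootedMultigraph V} {H : RootedMultigraph W} (h : Iso G H) : Iso H G := by
  obtain ⟨e, he, h⟩ := h
  refine ⟨e.symm, by rw [← he, e.symm_apply_apply], fun u v => ?_⟩
  rw [← h, e.apply_symm_apply, e.apply_symm_apply]

theorem Iso.trans {G : RootedMultigraph V} {H : RootedMultigraph W} {K : RootedMultigraph X}
    (h : Iso G H) (k : Iso H K) : Iso G K := by
  obtain ⟨e, he, h⟩ := h
  obtain ⟨f, hf, k⟩ := k
  refine ⟨e.trans f, by rw [Equiv.trans_apply, he, hf], fun u v => ?_⟩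
  rw [Equiv.trans_apply, Equiv.trans_apply, k, h]

/-- `φ` restricts to an isomorphism from `G` to `H`. -/
def IsIsoMap (G : RootedMultigraph V) (H : RootedMultigraph W) (φ : V → W) : Prop :=
  Set.BijOn φ G.verts H.verts ∧ φ G.root = H.root ∧
    ∀ u ∈ G.verts, ∀ v ∈ G.verts, H.mult (φ u) (φ v) = G.mult u v

theorem IsIsoMap.iso {G : RootedMultigraph V} {H : RootedMultigraph W} {φ : V → W}
    (h : IsIsoMap G H φ) : Iso G H := by
  obtain ⟨hb, hr, hm⟩ := h
  exact ⟨hb.equiv, Subtype.ext hr, fun u v => hm u u.2 v v.2⟩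

theorem Iso.exists_isIsoMap {G : RootedMultigraph V} {H : RootedMultigraph W} (h : Iso G H) :
    ∃ φ, IsIsoMap G H φ := by
  classical
  obtain ⟨e, he, hm⟩ := h
  have hφ : ∀ v (hv : v ∈ G.verts),
      (fun v => if hv : v ∈ G.verts then ((e ⟨v, hv⟩ : H.verts) : W) else H.root) v
        = e ⟨v, hv⟩ := fun v hv => dif_pos hv
  refine ⟨fun v => if hv : v ∈ G.verts then (e ⟨v, hv⟩ : W) else H.root, ⟨?_, ?_, ?_⟩, ?_, ?_⟩
  · intro v hv
    rw [hφ v hv]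
    exact (e ⟨v, hv⟩).2
  · intro u hu v hv huv
    rw [hφ u hu, hφ v hv] at huv
    simpa using e.injective (Subtype.ext huv)
  · intro w hw
    refine ⟨e.symm ⟨w, hw⟩, (e.symm ⟨w, hw⟩).2, ?_⟩
    rw [hφ _ (e.symm ⟨w, hw⟩).2]
    simp
  · rw [hφ _ G.root_mem, he]
  · intro u hu v hv
    rw [hφ u hu, hφ v hv]
    exact hm ⟨u, hu⟩ ⟨v, hv⟩

theorem IsIsoMap.within {G : RootedMultigraph V} {H : RootedMultigraph W} {φ : V → W}
    (h : IsIsoMap G H φ) {k : ℕ} {v : V} (hv : G.Within k v) : H.Within k (φ v) := by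
  induction k generalizing v with
  | zero => obtain rfl : v = G.root := hv; exact h.2.1
  | succ k ih =>
    rcases hv with hv | ⟨u, hu, huv⟩
    · exact Or.inl (ih hv)
    · refine Or.inr ⟨φ u, ih hu, ?_⟩
      rwa [h.2.2 u hu.mem_verts v (G.mem_of_mult_ne_zero_right huv)]

theorem IsIsoMap.exists_within {G : RootedMultigraph V} {H : RootedMultigraph W} {φ : V → W}
    (h : IsIsoMap G H φ) {k : ℕ} {w : W} (hw : H.Within k w) : ∃ v, G.Within k v ∧ φ v = w := by
  induction k generalizing w with
  | zero => obtain rfl : w = H.root := hw; exact ⟨G.root, rfl, h.2.1⟩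
  | succ k ih =>
    rcases hw with hw | ⟨u, hu, huw⟩
    · obtain ⟨v, hv, rfl⟩ := ih hw
      exact ⟨v, Or.inl hv, rfl⟩
    · obtain ⟨x, hx, rfl⟩ := ih hu
      obtain ⟨v, hv, rfl⟩ := h.1.surjOn (H.mem_of_mult_ne_zero_right huw)
      rw [h.2.2 x hx.mem_verts v hv] at huw
      exact ⟨v, Or.inr ⟨x, hx, huw⟩, rfl⟩

theorem IsIsoMap.within_iff {G : RootedMultigraph V} {H : RootedMultigraph W} {φ : V → W}
    (h : IsIsoMap G H φ) {k : ℕ} {v : V} (hv : v ∈ G.verts) :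
    H.Within k (φ v) ↔ G.Within k v := by
  refine ⟨fun hw => ?_, h.within⟩
  obtain ⟨v', hv', he⟩ := h.exists_within hw
  rwa [← h.1.injOn hv'.mem_verts hv he]

theorem IsIsoMap.cluster {G : RootedMultigraph V} {H : RootedMultigraph W} {φ : V → W}
    (h : IsIsoMap G H φ) : IsIsoMap G.cluster H.cluster φ := by
  have hr : ∀ v ∈ G.verts, (H.Reachable (φ v) ↔ G.Reachable v) := fun v hv => by
    simp only [reachable_iff_exists_within, h.within_iff hv]
  refine ⟨⟨fun v hv => ?_, fun u hu v hv => ?_, fun w hw => ?_⟩, h.2.1, fun u hu v hv => ?_⟩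
  · exact (hr v (Reachable.mem_verts hv)).2 hv
  · exact h.1.injOn (Reachable.mem_verts hu) (Reachable.mem_verts hv)
  · obtain ⟨k, hk⟩ := reachable_iff_exists_within.1 (show H.Reachable w from hw)
    obtain ⟨v, hv, rfl⟩ := h.exists_within hk
    exact ⟨v, hv.reachable, rfl⟩
  · have hu' : G.Reachable u := hu
    have hv' : G.Reachable v := hv
    simp [RootedMultigraph.cluster, hu', hv', (hr u hu'.mem_verts).2 hu', (hr v hv'.mem_verts).2 hv',
      h.2.2 u hu'.mem_verts v hv'.mem_verts]

theorem Iso.cluster {G : RootedMultigraph V} {H : RootedMultigraph W} (h : Iso G H) :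
    Iso G.cluster H.cluster :=
  h.exists_isIsoMap.choose_spec.cluster.iso

theorem relabel_mult_apply (f : V ↪ W) (G : RootedMultigraph V) (u v : V) :
    (G.relabel f).mult (f u) (f v) = G.mult u v :=
  (f.injective.prodMap f.injective).extend_apply (fun p => G.mult p.1 p.2) 0 (u, v)

theorem relabel_mult_eq_zero (f : V ↪ W) (G : RootedMultigraph V) {a b : W}
    (h : ¬ ∃ u v, f u = a ∧ f v = b) : (G.relabel f).mult a b = 0 := by
  refine (Function.extend_apply' (fun p : V × V => G.mult p.1 p.2) (0 : W × W → ℕ) (a, b) ?_).trans rfl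
  rintro ⟨⟨u, v⟩, huv⟩
  rw [Prod.map_apply, Prod.mk.injEq] at huv
  exact h ⟨u, v, huv.1, huv.2⟩

theorem isIsoMap_relabel (f : V ↪ W) (G : RootedMultigraph V) : IsIsoMap G (G.relabel f) f :=
  ⟨f.injective.injOn.bijOn_image, rfl, fun u _ v _ => relabel_mult_apply f G u v⟩

theorem iso_relabel (f : V ↪ W) (G : RootedMultigraph V) : Iso G (G.relabel f) :=
  (isIsoMap_relabel f G).iso

theorem isoClass_eq_iff [Countable V] [Countable W] {G : RootedMultigraph V}
    {H : RootedMultigraph W} : isoClass G = isoClass H ↔ Iso G H := by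
  refine Iff.trans (Quotient.eq (r := isoSetoid ℕ)) ?_
  exact ⟨fun h => ((iso_relabel _ G).trans h).trans (iso_relabel _ H).symm,
    fun h => ((iso_relabel _ G).symm.trans h).trans (iso_relabel _ H)⟩

theorem isoClass_relabel [Countable V] [Countable W] (f : V ↪ W) (G : RootedMultigraph V) :
    isoClass (G.relabel f) = isoClass G :=
  isoClass_eq_iff.2 (iso_relabel f G).symm

theorem isoClass_nat (G : RootedMultigraph ℕ) : isoClass G = Quotient.mk (isoSetoid ℕ) G :=
  Quotient.sound (iso_relabel _ G).symm

/-! ### Measurability -/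

section Measurability

variable {α : Type*} [MeasurableSpace α]

theorem measurableSet_root_eq (v : V) : MeasurableSet {G : RootedMultigraph V | G.root = v} := by
  have h : MeasurableSet[(⊤ : MeasurableSpace V).comap (root : RootedMultigraph V → V)]
      {G : RootedMultigraph V | G.root = v} := ⟨{v}, trivial, rfl⟩
  exact (le_sup_left.trans le_sup_left : _ ≤ instMeasurableSpace (V := V)) _ h

theorem measurable_verts : Measurable (verts : RootedMultigraph V → Set V) :=
  Measurable.mono (comap_measurable _)
    (le_sup_right.trans le_sup_left : _ ≤ instMeasurableSpace (V := V)) le_rfl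

theorem measurableSet_mem_verts (v : V) : MeasurableSet {G : RootedMultigraph V | v ∈ G.verts} :=
  measurableSet_setOfPred.2 (measurable_set_iff.1 measurable_verts v)

theorem measurable_mult' : Measurable (mult : RootedMultigraph V → V → V → ℕ) :=
  Measurable.mono (comap_measurable _) (le_sup_right : _ ≤ instMeasurableSpace (V := V)) le_rfl

@[fun_prop]
theorem measurable_mult (u v : V) : Measurable fun G : RootedMultigraph V => G.mult u v :=
  (measurable_pi_apply v).comp ((measurable_pi_apply u).comp measurable_mult')

/-- Countability of `V` is needed for the root: its value is measurable with respect to all subsets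
of `V`, whose preimages are countable unions of the given sets. -/
theorem measurable_of_coordinates [Countable V] {f : α → RootedMultigraph V}
    (hr : ∀ v, MeasurableSet {a | (f a).root = v}) (hv : ∀ v, MeasurableSet {a | v ∈ (f a).verts})
    (hm : ∀ u v, Measurable fun a => (f a).mult u v) : Measurable f := by
  rw [measurable_iff_comap_le, instMeasurableSpace, MeasurableSpace.comap_sup,
    MeasurableSpace.comap_sup]
  refine sup_le (sup_le ?_ ?_) ?_
  · rw [MeasurableSpace.comap_comp]
    rintro _ ⟨s, -, rfl⟩
    have : (root ∘ f) ⁻¹' s = ⋃ v ∈ s, {a | (f a).root = v} := by ext; simp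
    rw [this]
    exact MeasurableSet.biUnion s.to_countable fun v _ => hr v
  · rw [MeasurableSpace.comap_comp, ← measurable_iff_comap_le, measurable_set_iff]
    exact fun v => measurableSet_setOfPred.1 (hv v)
  · rw [MeasurableSpace.comap_comp, ← measurable_iff_comap_le]
    exact measurable_pi_lambda _ fun u => measurable_pi_lambda _ fun v => hm u v

theorem measurable_card_filter_side (u v : V) (a b : Bool) (m : ℕ) :
    Measurable fun s : V × V × ℕ → Bool =>
      ((Finset.range m).filter fun k => s (u, v, k) = a ∧ s (v, u, k) = b).card := by
  simp only [Finset.card_filter]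
  refine Finset.measurable_sum _ fun k _ => Measurable.ite ?_ measurable_const measurable_const
  have h (i : V × V × ℕ) (a : Bool) : MeasurableSet {s : V × V × ℕ → Bool | s i = a} :=
    measurableSet_eq_fun (measurable_pi_apply i) measurable_const
  exact (h (u, v, k) a).inter (h (v, u, k) b)

@[fun_prop]
theorem measurable_relabel [Countable W] (f : V ↪ W) : Measurable (relabel f) := by
  refine measurable_of_coordinates (fun w => ?_) (fun w => ?_) fun a b => ?_
  · by_cases h : ∃ v, f v = w
    · obtain ⟨v, rfl⟩ := h
      simpa [relabel] using measurableSet_root_eq v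
    · convert! MeasurableSet.empty
      exact Set.eq_empty_of_forall_notMem fun G hG => h ⟨_, hG⟩
  · by_cases h : ∃ v, f v = w
    · obtain ⟨v, rfl⟩ := h
      simpa [relabel] using measurableSet_mem_verts v
    · convert! MeasurableSet.empty
      exact Set.eq_empty_of_forall_notMem fun G hG => h ⟨_, hG.choose_spec.2⟩
  · by_cases h : ∃ u v, f u = a ∧ f v = b
    · obtain ⟨u, v, rfl, rfl⟩ := h
      simpa only [relabel_mult_apply] using measurable_mult u v
    · simp only [relabel_mult_eq_zero f _ h]
      exact measurable_const

variable [Countable V]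

theorem measurableSet_within (k : ℕ) (v : V) :
    MeasurableSet {G : RootedMultigraph V | G.Within k v} := by
  induction k generalizing v with
  | zero => simpa only [Within, eq_comm] using measurableSet_root_eq v
  | succ k ih =>
    have : {G : RootedMultigraph V | G.Within (k + 1) v} = {G | G.Within k v} ∪
        ⋃ u, ({G | G.Within k u} ∩ {G | G.mult u v ≠ 0}) := by
      ext G; simp [Within]
    rw [this]
    exact (ih v).union (MeasurableSet.iUnion fun u => (ih u).inter
      ((measurable_mult u v) (MeasurableSet.of_discrete (s := {0}ᶜ))))

theorem measurableSet_reachable (v : V) :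
    MeasurableSet {G : RootedMultigraph V | G.Reachable v} := by
  simp only [reachable_iff_exists_within, Set.ofPred_exists]
  exact MeasurableSet.iUnion fun k => measurableSet_within k v

@[fun_prop]
theorem measurable_cluster : Measurable (cluster : RootedMultigraph V → RootedMultigraph V) :=
  measurable_of_coordinates measurableSet_root_eq measurableSet_reachable fun u v =>
    Measurable.ite ((measurableSet_reachable u).inter (measurableSet_reachable v))
      (measurable_mult u v) measurable_const

theorem measurable_mk : Measurable (Quotient.mk (isoSetoid ℕ) : RootedMultigraph ℕ → IsoClass) :=
  fun _ hs => hs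

@[fun_prop]
theorem measurable_isoClass : Measurable (isoClass : RootedMultigraph V → IsoClass) :=
  measurable_mk.comp (measurable_relabel _)

/-- Splitting with the outcomes of the random experiments given as a tuple. -/
noncomputable abbrev splitTuple (G : RootedMultigraph V) (c : (V × V × ℕ → Bool) × (V → ℕ) × Bool) :
    RootedMultigraph (V × Bool) :=
  G.split ⟨c.1, c.2.1, c.2.2⟩

theorem measurable_splitTuple : Measurable fun p : RootedMultigraph V ×
    (V × V × ℕ → Bool) × (V → ℕ) × Bool => p.1.splitTuple p.2 := by
  refine measurable_of_coordinates (fun v => ?_) (fun v => ?_) fun x y => ?_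
  · have : {p : RootedMultigraph V × (V × V × ℕ → Bool) × (V → ℕ) × Bool |
        (p.1.splitTuple p.2).root = v} =
        (Prod.fst ⁻¹' {G | G.root = v.1}) ∩ ((fun p => p.2.2.2) ⁻¹' {v.2}) := by
      ext p
      simp [split, Prod.ext_iff]
    rw [this]
    exact (measurable_fst (measurableSet_root_eq _)).inter
      ((by fun_prop : Measurable fun p : RootedMultigraph V × (V × V × ℕ → Bool) × (V → ℕ) × Bool =>
        p.2.2.2) (measurableSet_singleton _))
  · exact measurable_fst (measurableSet_mem_verts v.1)
  · unfold splitTuple split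
    by_cases h : x.1 = y.1
    · simp only [h, if_true]
      exact Measurable.ite ((measurable_fst (measurableSet_mem_verts x.1)).inter
        (MeasurableSet.const (x.2 ≠ y.2))) (by fun_prop) measurable_const
    · simp only [h, if_false]
      have h1 : Measurable fun q : ℕ × (V × V × ℕ → Bool) =>
          ((Finset.range q.1).filter fun k =>
            q.2 (x.1, y.1, k) = x.2 ∧ q.2 (y.1, x.1, k) = y.2).card :=
        measurable_from_prod_countable_right fun m => measurable_card_filter_side _ _ _ _ m
      exact h1.comp (g := fun q : ℕ × (V × V × ℕ → Bool) =>
          ((Finset.range q.1).filter fun k =>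
            q.2 (x.1, y.1, k) = x.2 ∧ q.2 (y.1, x.1, k) = y.2).card)
        (f := fun p : RootedMultigraph V × (V × V × ℕ → Bool) × (V → ℕ) × Bool =>
          (p.1.mult x.1 y.1, p.2.1))
        (((measurable_mult x.1 y.1).comp measurable_fst).prodMk (by fun_prop))

end Measurability

end RootedMultigraph

namespace RootedMultigraph

variable {V W X : Type*}

/-! ### Splitting and clusters -/

theorem cluster_mult_of_reachable {G : RootedMultigraph V} {u : V} (hu : G.Reachable u) (v : V) :
    G.cluster.mult u v = G.mult u v := by
  by_cases h : G.mult u v = 0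
  · simp [cluster, h]
  · exact if_pos ⟨hu, hu.tail h⟩

theorem cluster_mult_of_not_reachable {G : RootedMultigraph V} {u : V} (hu : ¬ G.Reachable u)
    (v : V) : G.cluster.mult u v = 0 :=
  if_neg fun h => hu h.1

theorem split_mult_of_ne {G : RootedMultigraph V} (c : SplitChoices V) {x y : V × Bool}
    (h : x.1 ≠ y.1) : (G.split c).mult x y = ((Finset.range (G.mult x.1 y.1)).filter
      fun k => c.side (x.1, y.1, k) = x.2 ∧ c.side (y.1, x.1, k) = y.2).card :=
  if_neg h

theorem mult_ne_zero_of_split {G : RootedMultigraph V} {c : SplitChoices V} {x y : V × Bool}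
    (h : (G.split c).mult x y ≠ 0) (hxy : x.1 ≠ y.1) : G.mult x.1 y.1 ≠ 0 := by
  rw [split_mult_of_ne c hxy] at h
  rintro h0
  simp [h0] at h

theorem reachable_of_split {G : RootedMultigraph V} {c : SplitChoices V} {x : V × Bool}
    (h : (G.split c).Reachable x) : G.Reachable x.1 := by
  induction h with
  | refl => exact Relation.ReflTransGen.refl
  | @tail y z _ hyz ih =>
    by_cases h : y.1 = z.1
    · rwa [← h]
    · exact ih.tail (mult_ne_zero_of_split hyz h)

theorem split_cluster_mult {G : RootedMultigraph V} (c : SplitChoices V) {x : V × Bool}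
    (hx : G.Reachable x.1) (y : V × Bool) :
    (G.cluster.split c).mult x y = (G.split c).mult x y := by
  have hv : x.1 ∈ G.cluster.verts := hx
  simp only [split, cluster_mult_of_reachable hx, hv, hx.mem_verts]

theorem split_cluster_within (G : RootedMultigraph V) (c : SplitChoices V) (k : ℕ)
    (x : V × Bool) : (G.cluster.split c).Within k x ↔ (G.split c).Within k x := by
  induction k generalizing x with
  | zero => rfl
  | succ k ih =>
    simp only [Within, ih]
    refine or_congr Iff.rfl (exists_congr fun u => and_congr_right fun hu => ?_)
    rw [split_cluster_mult c (reachable_of_split hu.reachable)]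

/-- An edge of the split graph projects to an edge or to a single vertex, so the cluster of the new
root lies above the old cluster. Hence discarding components can be postponed to the end of an
iteration, and whole graphs can be split. -/
theorem cluster_split_cluster (G : RootedMultigraph V) (c : SplitChoices V) :
    (G.cluster.split c).cluster = (G.split c).cluster := by
  have hr : ∀ x, (G.cluster.split c).Reachable x ↔ (G.split c).Reachable x := fun x => by
    simp only [reachable_iff_exists_within, split_cluster_within]
  refine ext (Set.ext hr) rfl fun x y => ?_
  by_cases h : (G.split c).Reachable x
  · rw [cluster_mult_of_reachable h, cluster_mult_of_reachable ((hr x).2 h),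
      split_cluster_mult c (reachable_of_split h)]
  · rw [cluster_mult_of_not_reachable h, cluster_mult_of_not_reachable (mt (hr x).1 h)]

/-! ### Splitting and isomorphisms -/

theorem isIsoMap_split_relabel (f : W ↪ V) (K : RootedMultigraph W)
    (c : (V × V × ℕ → Bool) × (V → ℕ) × Bool) :
    IsIsoMap (K.splitTuple (fun p => c.1 (f p.1, f p.2.1, p.2.2), fun w => c.2.1 (f w), c.2.2))
      ((K.relabel f).splitTuple c) (Prod.map f id) := by
  have hinj : Function.Injective (Prod.map f (id : Bool → Bool)) :=
    f.injective.prodMap Function.injective_id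
  refine ⟨⟨?_, hinj.injOn, ?_⟩, rfl, ?_⟩
  · intro x hx
    exact ⟨x.1, hx, rfl⟩
  · rintro ⟨v, b⟩ ⟨w, hw, hwv⟩
    exact ⟨(w, b), hw, Prod.ext hwv rfl⟩
  · rintro ⟨u, a⟩ hu ⟨v, b⟩ hv
    have hu' : f u ∈ (K.relabel f).verts := ⟨u, hu, rfl⟩
    have hu'' : u ∈ K.verts := hu
    by_cases h : u = v
    · subst h
      simp [split, hu', hu'']
    · have h' : f u ≠ f v := f.injective.ne h
      simp [split, h, h', relabel_mult_apply]

/-- The multigraph `G` with its own vertices as labels. -/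
def onVerts (G : RootedMultigraph V) : RootedMultigraph G.verts where
  verts := Set.univ
  root := ⟨G.root, G.root_mem⟩
  mult u v := G.mult u v
  root_mem := trivial
  mult_comm u v := G.mult_comm u v
  mult_self v := G.mult_self v
  mem_of_mult_ne_zero _ _ _ := trivial

/-- An isomorphism need not extend to an injection between the label types. Isomorphic graphs are
therefore compared through a common third graph, labelled by the vertices of `G` themselves. -/
theorem Iso.exists_eq_relabel {G : RootedMultigraph V} {H : RootedMultigraph W} (h : Iso G H) :
    ∃ f : G.verts ↪ W, H = G.onVerts.relabel f := by
  obtain ⟨e, he, hm⟩ := h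
  refine ⟨e.toEmbedding.trans (Function.Embedding.subtype _), ext ?_ ?_ fun a b => ?_⟩
  · ext w
    constructor
    · intro hw
      exact ⟨e.symm ⟨w, hw⟩, trivial, by simp⟩
    · rintro ⟨v, -, rfl⟩
      exact (e v).2
  · change H.root = (e ⟨G.root, G.root_mem⟩ : W)
    rw [he]
  · by_cases hab : H.mult a b = 0
    · rw [hab]
      by_cases hex : ∃ u v, (e.toEmbedding.trans (Function.Embedding.subtype _)) u = a ∧
          (e.toEmbedding.trans (Function.Embedding.subtype _)) v = b
      · obtain ⟨u, v, rfl, rfl⟩ := hex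
        rw [relabel_mult_apply]
        exact hab.symm.trans (hm u v)
      · rw [relabel_mult_eq_zero _ _ hex]
    · have ha := H.mem_of_mult_ne_zero a b hab
      have hb := H.mem_of_mult_ne_zero_right hab
      have h1 : e.toEmbedding.trans (Function.Embedding.subtype _) (e.symm ⟨a, ha⟩) = a := by simp
      have h2 : e.toEmbedding.trans (Function.Embedding.subtype _) (e.symm ⟨b, hb⟩) = b := by simp
      conv_rhs => rw [← h1, ← h2, relabel_mult_apply]
      have : H.mult a b = G.mult (e.symm ⟨a, ha⟩) (e.symm ⟨b, hb⟩) := by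
        simpa using hm (e.symm ⟨a, ha⟩) (e.symm ⟨b, hb⟩)
      exact this

theorem Iso.refl (G : RootedMultigraph V) : Iso G G :=
  ⟨Equiv.refl _, rfl, fun _ _ => rfl⟩

/-! ### The splitting operation on functions of isomorphism classes -/

instance instIsProbabilityMeasureSplitChoicesLaw (lam : ℝ≥0) :
    IsProbabilityMeasure (splitChoicesLaw lam V) := by
  unfold splitChoicesLaw
  infer_instance

/-- Restricting an i.i.d. family along an injection of the index sets gives an i.i.d. family. -/
theorem splitChoicesLaw_map_embedding (lam : ℝ≥0) (f : W ↪ V) :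
    (splitChoicesLaw lam V).map (fun c =>
      ((fun p => c.1 (f p.1, f p.2.1, p.2.2), fun w => c.2.1 (f w), c.2.2) :
        (W × W × ℕ → Bool) × (W → ℕ) × Bool)) = splitChoicesLaw lam W := by
  have h1 := Measure.map_infinitePi_infinitePi_of_inj (P := fun _ : V × V × ℕ => fairCoin)
    (f := fun p : W × W × ℕ => (f p.1, f p.2.1, p.2.2)) (by
      rintro ⟨a, b, k⟩ ⟨a', b', k'⟩ h
      simpa using h)
  have h2 := Measure.map_infinitePi_infinitePi_of_inj
    (P := fun _ : V => poissonMeasure (lam / 2)) f.injective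
  have h3 : ((Measure.infinitePi fun _ : V => poissonMeasure (lam / 2)).prod fairCoin).map
      (Prod.map (fun ω i => ω (f i)) id) =
        (Measure.infinitePi fun _ : W => poissonMeasure (lam / 2)).prod fairCoin := by
    rw [← Measure.map_prod_map _ _ (by fun_prop) (by fun_prop), h2, Measure.map_id]
  have h4 := Measure.map_prod_map (Measure.infinitePi fun _ : V × V × ℕ => fairCoin)
    ((Measure.infinitePi fun _ : V => poissonMeasure (lam / 2)).prod fairCoin)
    (f := fun ω (i : W × W × ℕ) => ω (f i.1, f i.2.1, i.2.2))
    (g := Prod.map (fun ω i => ω (f i)) id) (by fun_prop) (by fun_prop)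
  rw [h1, h3] at h4
  exact h4.symm

section

variable [Countable V] [Countable W]

@[fun_prop]
theorem measurable_splitTuple_right (G : RootedMultigraph V) : Measurable G.splitTuple :=
  measurable_splitTuple.comp measurable_prodMk_left

theorem lintegral_split_relabel (lam : ℝ≥0) {F : IsoClass → ℝ≥0∞} (hF : Measurable F) (f : W ↪ V)
    (K : RootedMultigraph W) :
    ∫⁻ c, F (isoClass ((K.relabel f).splitTuple c).cluster) ∂splitChoicesLaw lam V =
      ∫⁻ c, F (isoClass (K.splitTuple c).cluster) ∂splitChoicesLaw lam W := by
  rw [← splitChoicesLaw_map_embedding lam f, lintegral_map (by fun_prop) (by fun_prop)]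
  refine lintegral_congr fun c => ?_
  rw [isoClass_eq_iff.2 (isIsoMap_split_relabel f K c).cluster.iso]

theorem Iso.lintegral_split {G : RootedMultigraph V} {H : RootedMultigraph W} (h : Iso G H)
    (lam : ℝ≥0) {F : IsoClass → ℝ≥0∞} (hF : Measurable F) :
    ∫⁻ c, F (isoClass (G.splitTuple c).cluster) ∂splitChoicesLaw lam V =
      ∫⁻ c, F (isoClass (H.splitTuple c).cluster) ∂splitChoicesLaw lam W := by
  obtain ⟨f, hf⟩ := (Iso.refl G).exists_eq_relabel
  obtain ⟨g, hg⟩ := h.exists_eq_relabel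
  conv_lhs => rw [hf, lintegral_split_relabel lam hF]
  conv_rhs => rw [hg, lintegral_split_relabel lam hF]

/-- The expectation of `F` at the class obtained from a given class by the splitting operation. -/
noncomputable def splitOp (lam : ℝ≥0) (F : IsoClass → ℝ≥0∞) (q : IsoClass) : ℝ≥0∞ :=
  ∫⁻ c, F (isoClass ((Quotient.out (s := isoSetoid ℕ) q).splitTuple c).cluster)
    ∂splitChoicesLaw lam ℕ

/-- The representative chosen in `splitOp` can be replaced by any isomorphic multigraph, with labels
of any countable type. -/
theorem splitOp_isoClass (lam : ℝ≥0) {F : IsoClass → ℝ≥0∞} (hF : Measurable F)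
    (G : RootedMultigraph V) : splitOp lam F (isoClass G) =
      ∫⁻ c, F (isoClass (G.splitTuple c).cluster) ∂splitChoicesLaw lam V := by
  refine Iso.lintegral_split ?_ lam hF
  rw [← isoClass_eq_iff, isoClass_nat]
  exact Quotient.out_eq (s := isoSetoid ℕ) _

theorem splitOp_isoClass_cluster (lam : ℝ≥0) {F : IsoClass → ℝ≥0∞} (hF : Measurable F)
    (G : RootedMultigraph V) : splitOp lam F (isoClass G.cluster) =
      ∫⁻ c, F (isoClass (G.splitTuple c).cluster) ∂splitChoicesLaw lam V := by
  simp only [splitOp_isoClass lam hF, splitTuple, cluster_split_cluster]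

theorem measurable_splitOp (lam : ℝ≥0) {F : IsoClass → ℝ≥0∞} (hF : Measurable F) :
    Measurable (splitOp lam F) := by
  have h : Measurable fun G : RootedMultigraph ℕ =>
      ∫⁻ c, F (isoClass (G.splitTuple c).cluster) ∂splitChoicesLaw lam ℕ :=
    Measurable.lintegral_prod_right' (f := fun p : RootedMultigraph ℕ × _ =>
      F (isoClass (p.1.splitTuple p.2).cluster))
      (hF.comp (measurable_isoClass.comp (measurable_cluster.comp measurable_splitTuple)))
  intro s hs
  -- Events are tested on labelled multigraphs, where the non-measurable choice of a representative
  -- disappears.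
  change MeasurableSet (Quotient.mk (isoSetoid ℕ) ⁻¹' (splitOp lam F ⁻¹' s))
  convert! h hs using 1
  ext G
  change splitOp lam F (Quotient.mk (isoSetoid ℕ) G) ∈ s ↔ _ ∈ s
  rw [← isoClass_nat, splitOp_isoClass lam hF]

theorem lintegral_isoLaw {F : IsoClass → ℝ≥0∞} (hF : Measurable F)
    (μ : Measure (RootedMultigraph V)) : ∫⁻ q, F q ∂isoLaw μ = ∫⁻ G, F (isoClass G) ∂μ :=
  lintegral_map hF measurable_isoClass

/-- Duality: applying the splitting operation to a law amounts to applying `splitOp` to test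
functions. -/
theorem lintegral_isoLaw_splitLaw (lam : ℝ≥0) {F : IsoClass → ℝ≥0∞} (hF : Measurable F)
    (μ : Measure (RootedMultigraph V)) [SFinite μ] :
    ∫⁻ q, F q ∂isoLaw (splitLaw lam μ) = ∫⁻ q, splitOp lam F q ∂isoLaw μ := by
  have hm : Measurable fun p : RootedMultigraph V × (V × V × ℕ → Bool) × (V → ℕ) × Bool =>
      (p.1.splitTuple p.2).cluster := measurable_cluster.comp measurable_splitTuple
  rw [lintegral_isoLaw hF, lintegral_isoLaw (measurable_splitOp lam hF), splitLaw]
  change ∫⁻ G, (F ∘ isoClass) G ∂Measure.map (fun p : RootedMultigraph V × _ =>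
    (p.1.splitTuple p.2).cluster) _ = _
  rw [lintegral_map (hF.comp measurable_isoClass) hm,
    lintegral_prod (fun p : RootedMultigraph V × _ => (F ∘ isoClass) (p.1.splitTuple p.2).cluster)
      ((hF.comp measurable_isoClass).comp hm).aemeasurable]
  exact lintegral_congr fun G => (splitOp_isoClass lam hF G).symm

end

end RootedMultigraph

/-! ### Resampling one coordinate of a product measure -/

section Resampling

theorem measurable_update_uncurry {ι : Type*} [DecidableEq ι] {Ω : ι → Type*} [∀ i, MeasurableSpace (Ω i)] (i : ι) :
    Measurable fun p : (∀ i, Ω i) × Ω i => Function.update p.1 i p.2 := by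
  refine measurable_pi_lambda _ fun j => ?_
  by_cases h : j = i
  · subst h
    simpa using measurable_snd
  · simp only [Function.update_of_ne h]
    fun_prop

variable {ι : Type*} {Ω : ι → Type*} [∀ i, MeasurableSpace (Ω i)] (P : ∀ i, Measure (Ω i))
  [∀ i, IsProbabilityMeasure (P i)]

/-- It suffices to check finite boxes. There the constraint on coordinate `i`, if any, is moved to
the fresh variable. -/
theorem infinitePi_prod_map_update [DecidableEq ι] (i : ι) :
    ((Measure.infinitePi P).prod (P i)).map (fun p => Function.update p.1 i p.2) =
      Measure.infinitePi P := by
  have hm := measurable_update_uncurry (Ω := Ω) i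
  refine Measure.eq_infinitePi P fun s t ht => ?_
  rw [Measure.map_apply hm (MeasurableSet.pi s.countable_toSet fun j _ => ht j)]
  have hset : (fun p : (∀ i, Ω i) × Ω i => Function.update p.1 i p.2) ⁻¹' (Set.pi s t) =
      (Set.pi ((s.erase i : Finset ι) : Set ι) t) ×ˢ (if i ∈ s then t i else Set.univ) := by
    ext ⟨x, a⟩
    simp only [Set.mem_preimage, Set.mem_pi, Set.mem_prod, Finset.mem_coe, Finset.mem_erase]
    constructor
    · intro h
      refine ⟨fun j hj => by simpa [Function.update_of_ne hj.1] using h j hj.2, ?_⟩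
      split_ifs with hi
      · simpa using h i hi
      · trivial
    · rintro ⟨h1, h2⟩ j hj
      by_cases hji : j = i
      · subst hji
        simpa [hj] using h2
      · rw [Function.update_of_ne hji]
        exact h1 j ⟨hji, hj⟩
  rw [hset, Measure.prod_prod, Measure.infinitePi_pi P fun j _ => ht j]
  by_cases hi : i ∈ s
  · rw [if_pos hi, Finset.prod_erase_mul _ _ hi]
  · rw [if_neg hi, measure_univ, mul_one, Finset.erase_eq_of_notMem hi]

/-- Independence of coordinate `i` from a function that does not look at it: replace this coordinate
by a fresh one, then integrate separately. -/
theorem lintegral_infinitePi_mul_of_update_eq [DecidableEq ι] (i : ι) {g : Ω i → ℝ≥0∞} (hg : Measurable g)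
    {f : (∀ i, Ω i) → ℝ≥0∞} (hf : Measurable f) (h : ∀ x a, f (Function.update x i a) = f x) :
    ∫⁻ x, g (x i) * f x ∂Measure.infinitePi P =
      (∫⁻ a, g a ∂P i) * ∫⁻ x, f x ∂Measure.infinitePi P := by
  have hm := measurable_update_uncurry (Ω := Ω) i
  conv_lhs => rw [← infinitePi_prod_map_update P i]
  rw [lintegral_map (by fun_prop) hm]
  simp only [Function.update_self, h]
  rw [lintegral_prod_symm' _ (by fun_prop)]
  simp_rw [lintegral_const_mul _ hf]
  rw [lintegral_mul_const _ hg]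

end Resampling

theorem fairCoin_singleton (b : Bool) : RootedMultigraph.fairCoin {b} = 1 / 2 := by
  rw [RootedMultigraph.fairCoin, PMF.toMeasure_apply_singleton _ _ (measurableSet_singleton b)]
  simp

namespace RootedMultigraph

variable {V : Type*}

/-! ### Subgraphs and excess degrees -/

/-- `H` is a spanning subgraph of `G` with the same root. -/
structure IsSub (H G : RootedMultigraph V) : Prop where
  verts_eq : H.verts = G.verts
  root_eq : H.root = G.root
  mult_le : ∀ u v, H.mult u v ≤ G.mult u v

/-- The number of edges of `G` at `x` that do not belong to the subgraph `H`. -/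
noncomputable def excess (G H : RootedMultigraph V) (x : V) : ℝ≥0∞ :=
  ∑' y, ((G.mult x y - H.mult x y : ℕ) : ℝ≥0∞)

theorem split_mult_congr {G H : RootedMultigraph V} (h : H.verts = G.verts) (c : SplitChoices V)
    {x y : V × Bool} (hxy : x.1 = y.1) : (H.split c).mult x y = (G.split c).mult x y := by
  simp only [split, if_pos hxy]
  by_cases hp : x.1 ∈ G.verts ∧ x.2 ≠ y.2
  · rw [if_pos hp, if_pos (by rwa [h])]
  · rw [if_neg hp, if_neg (by rwa [h])]

theorem IsSub.split {G H : RootedMultigraph V} (h : IsSub H G) (c : SplitChoices V) :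
    IsSub (H.split c) (G.split c) where
  verts_eq := by simp only [RootedMultigraph.split, h.verts_eq]
  root_eq := by simp only [RootedMultigraph.split, h.root_eq]
  mult_le x y := by
    by_cases hxy : x.1 = y.1
    · exact (split_mult_congr h.verts_eq c hxy).le
    · rw [split_mult_of_ne c hxy, split_mult_of_ne c hxy]
      exact Finset.card_le_card (Finset.filter_subset_filter _
        (Finset.range_subset_range.2 (h.mult_le _ _)))

theorem measurable_excess [Countable V] {α : Type*} [MeasurableSpace α]
    {f g : α → RootedMultigraph V} (hf : Measurable f) (hg : Measurable g) (x : V) :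
    Measurable fun a => excess (f a) (g a) x := by
  refine Measurable.tsum fun y => ?_
  have h1 := (measurable_mult x y).comp hf
  have h2 := (measurable_mult x y).comp hg
  exact (measurable_of_countable (fun n : ℕ => (n : ℝ≥0∞))).comp (h1.sub h2)

/-- The edges of `H` between two vertices are those of `G` with the smallest indices, and their ends
use the same coins. So the excess edges are those with indices in the `Ico`, and the new edges
between twins cancel. -/
theorem excess_split_le {G H : RootedMultigraph V} (h : IsSub H G) (c : SplitChoices V) (x : V)
    (b : Bool) : excess (G.split c) (H.split c) (x, b) ≤
      ∑' y, ∑ k ∈ Finset.Ico (H.mult x y) (G.mult x y), if c.side (x, y, k) = b then 1 else 0 := by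
  unfold excess
  rw [ENNReal.tsum_prod']
  refine ENNReal.tsum_le_tsum fun y => ?_
  rw [tsum_fintype]
  by_cases hxy : x = y
  · simp [split_mult_congr h.verts_eq c (x := (x, b)) (y := (y, _)) hxy]
  · simp only [Fintype.univ_bool, split_mult_of_ne c (x := (x, b)) (y := (y, _)) hxy]
    have key : ∀ b', ((Finset.range (G.mult x y)).filter fun k =>
          c.side (x, y, k) = b ∧ c.side (y, x, k) = b').card -
        ((Finset.range (H.mult x y)).filter fun k =>
          c.side (x, y, k) = b ∧ c.side (y, x, k) = b').card =
        ((Finset.Ico (H.mult x y) (G.mult x y)).filter fun k =>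
          c.side (x, y, k) = b ∧ c.side (y, x, k) = b').card := by
      intro b'
      rw [Finset.range_eq_Ico, Finset.range_eq_Ico,
        ← Finset.Ico_union_Ico_eq_Ico (Nat.zero_le _) (h.mult_le x y), Finset.filter_union,
        Finset.card_union_of_disjoint, Nat.add_sub_cancel_left]
      exact Finset.disjoint_filter_filter (Finset.Ico_disjoint_Ico_consecutive _ _ _)
    simp only [key]
    rw [Finset.sum_pair (by simp), ← Nat.cast_add, Finset.sum_ite, Finset.sum_const_zero, add_zero,
      Finset.sum_const, nsmul_eq_mul, mul_one, Nat.cast_le,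
      ← Finset.card_union_of_disjoint]
    · refine Finset.card_le_card fun k hk => ?_
      simp only [Finset.mem_union, Finset.mem_filter] at hk ⊢
      tauto
    · refine Finset.disjoint_filter.2 fun k _ h1 h2 => ?_
      rw [h1.2] at h2
      simp at h2

/-- Coins with an index beyond the multiplicity in `H` are never read when `H` is split. -/
theorem split_update_side [DecidableEq (V × V × ℕ)] {H : RootedMultigraph V} (s : V × V × ℕ → Bool) (N : V → ℕ) (a : Bool)
    {x y : V} {k : ℕ} (hk : H.mult x y ≤ k) (a' : Bool) :
    H.splitTuple (Function.update s (x, y, k) a', N, a) = H.splitTuple (s, N, a) := by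
  refine ext rfl rfl fun u v => ?_
  simp only [splitTuple, split]
  split_ifs with h1 h2
  · rfl
  · rfl
  · congr 1
    refine Finset.filter_congr fun j hj => ?_
    have hj' := Finset.mem_range.1 hj
    have h3 : (u.1, v.1, j) ≠ (x, y, k) := by
      rintro h
      simp only [Prod.mk.injEq] at h
      rw [h.1, h.2.1, h.2.2] at hj'
      omega
    have h4 : (v.1, u.1, j) ≠ (x, y, k) := by
      rintro h
      simp only [Prod.mk.injEq] at h
      rw [H.mult_comm, h.1, h.2.1, h.2.2] at hj'
      omega
    rw [Function.update_of_ne h3, Function.update_of_ne h4]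

variable [Countable V]

/-- The coin of an excess edge is independent of the split `H`, by `split_update_side`. -/
theorem lintegral_side_mul (lam : ℝ≥0) {H : RootedMultigraph V}
    {f : RootedMultigraph (V × Bool) → ℝ≥0∞} (hf : Measurable f) {x y : V} {k : ℕ}
    (hk : H.mult x y ≤ k) (b : Bool) :
    ∫⁻ c, (if c.1 (x, y, k) = b then 1 else 0) * f (H.splitTuple c) ∂splitChoicesLaw lam V =
      1 / 2 * ∫⁻ c, f (H.splitTuple c) ∂splitChoicesLaw lam V := by
  have hg : Measurable fun a : Bool => if a = b then (1 : ℝ≥0∞) else 0 := measurable_of_countable _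
  have hfs : Measurable fun c => f (H.splitTuple c) := hf.comp (measurable_splitTuple_right H)
  have hgs : Measurable fun c : (V × V × ℕ → Bool) × (V → ℕ) × Bool =>
      (if c.1 (x, y, k) = b then (1 : ℝ≥0∞) else 0) :=
    hg.comp ((measurable_pi_apply (x, y, k)).comp measurable_fst)
  have hi : ∫⁻ a, (if a = b then (1 : ℝ≥0∞) else 0) ∂fairCoin = 1 / 2 := by
    rw [← fairCoin_singleton b, ← lintegral_indicator_one (measurableSet_singleton b)]
    refine lintegral_congr fun a => ?_
    simp [Set.indicator_apply]
  classical
  unfold splitChoicesLaw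
  have hgfs : Measurable fun c : (V × V × ℕ → Bool) × (V → ℕ) × Bool =>
      (if c.1 (x, y, k) = b then (1 : ℝ≥0∞) else 0) * f (H.splitTuple c) := hgs.mul hfs
  rw [lintegral_prod_symm' _ hgfs, lintegral_prod_symm' _ hfs,
    ← lintegral_const_mul _ (Measurable.lintegral_prod_left' hfs)]
  refine lintegral_congr fun d => ?_
  have := lintegral_infinitePi_mul_of_update_eq (fun _ : V × V × ℕ => fairCoin) (x, y, k) hg
    (f := fun s => f (H.splitTuple (s, d))) (hfs.comp measurable_prodMk_right)
    fun s a => congrArg f (split_update_side s d.1 d.2 hk a)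
  rw [hi] at this
  exact this

/-- Each excess edge at `x` contributes to copy `b` with probability 1/2, independently of the
weight `f`. -/
theorem lintegral_excess_split_le (lam : ℝ≥0) {G H : RootedMultigraph V} (h : IsSub H G)
    {f : RootedMultigraph (V × Bool) → ℝ≥0∞} (hf : Measurable f) (x : V) (b : Bool) :
    ∫⁻ c, f (H.splitTuple c) * excess (G.splitTuple c) (H.splitTuple c) (x, b)
        ∂splitChoicesLaw lam V ≤
      1 / 2 * ((∫⁻ c, f (H.splitTuple c) ∂splitChoicesLaw lam V) * excess G H x) := by
  have hfs : Measurable fun c => f (H.splitTuple c) := hf.comp (measurable_splitTuple_right H)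
  have hgs (y : V) (k : ℕ) : Measurable fun c : (V × V × ℕ → Bool) × (V → ℕ) × Bool =>
      (if c.1 (x, y, k) = b then (1 : ℝ≥0∞) else 0) :=
    (measurable_of_countable fun a : Bool => if a = b then (1 : ℝ≥0∞) else 0).comp
      ((measurable_pi_apply (x, y, k)).comp measurable_fst)
  have hgfs (y : V) (k : ℕ) : Measurable fun c : (V × V × ℕ → Bool) × (V → ℕ) × Bool =>
      (if c.1 (x, y, k) = b then (1 : ℝ≥0∞) else 0) * f (H.splitTuple c) := (hgs y k).mul hfs
  calc _ ≤ ∫⁻ c, ∑' y, ∑ k ∈ Finset.Ico (H.mult x y) (G.mult x y),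
        (if c.1 (x, y, k) = b then 1 else 0) * f (H.splitTuple c) ∂splitChoicesLaw lam V := by
        refine lintegral_mono fun c => ?_
        simp_rw [← Finset.sum_mul]
        rw [ENNReal.tsum_mul_right, mul_comm]
        exact mul_le_mul_left (excess_split_le h _ x b) _
    _ = ∑' y, ∑ k ∈ Finset.Ico (H.mult x y) (G.mult x y),
        1 / 2 * ∫⁻ c, f (H.splitTuple c) ∂splitChoicesLaw lam V := by
        rw [lintegral_tsum fun y => (Finset.measurable_sum _ fun k _ =>
          hgfs y k).aemeasurable]
        refine tsum_congr fun y => ?_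
        rw [lintegral_finsetSum _ fun k _ => hgfs y k]
        exact Finset.sum_congr rfl fun k hk =>
          lintegral_side_mul lam hf (Finset.mem_Ico.1 hk).1 b
    _ = _ := by
        simp only [Finset.sum_const, Nat.card_Ico, nsmul_eq_mul]
        rw [ENNReal.tsum_mul_right, excess]
        ring

/-! ### Comparison of the iterated splittings of a multigraph and of a subgraph -/

open Classical in
/-- The expected number of those descendants of the vertex `x` after `n` splitting steps whose
distance from the root is at most `r`. -/
noncomputable def ballWeight (lam : ℝ≥0) (r : ℕ) :
    ℕ → ∀ V : Type, RootedMultigraph V → V → ℝ≥0∞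
  | 0, _, H, x => if H.Within r x then 1 else 0
  | n + 1, V, H, x => ∑ b : Bool, ∫⁻ c, ballWeight lam r n (V × Bool) (H.splitTuple c) (x, b)
      ∂splitChoicesLaw lam V

theorem measurable_ballWeight (lam : ℝ≥0) (r n : ℕ) (V : Type) [Countable V] (x : V) :
    Measurable fun H : RootedMultigraph V => ballWeight lam r n V H x := by
  induction n generalizing V with
  | zero => exact Measurable.ite (measurableSet_within r x) measurable_const measurable_const
  | succ n ih =>
    refine Finset.measurable_sum _ fun b _ => ?_
    exact Measurable.lintegral_prod_right' (f := fun p : RootedMultigraph V × _ =>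
      ballWeight lam r n (V × Bool) (p.1.splitTuple p.2) (x, b))
      ((ih (V × Bool) (x, b)).comp measurable_splitTuple)

theorem ballWeight_eq_zero (lam : ℝ≥0) (r n : ℕ) {V : Type} (H : RootedMultigraph V) {x : V}
    (hx : ¬ H.Reachable x) : ballWeight lam r n V H x = 0 := by
  induction n generalizing V with
  | zero => exact if_neg fun h => hx h.reachable
  | succ n ih =>
    refine Finset.sum_eq_zero fun b _ => ?_
    rw [lintegral_congr fun c => ih (H.splitTuple c) fun h => hx (reachable_of_split h),
      lintegral_zero]

/-- An upper bound for the probability that after `n` splitting steps some edge descending from an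
edge outside of the subgraph touches the ball of radius `r` in the subgraph. -/
noncomputable def damage (lam : ℝ≥0) (r n : ℕ) {V : Type} (G H : RootedMultigraph V) : ℝ≥0∞ :=
  (1 / 2) ^ n * ∑' x, ballWeight lam r n V H x * excess G H x

/-- The factor 1/2 for each copy becomes one more factor in `(1 / 2) ^ n`, while the sum over the
two copies is absorbed by the recursion for `ballWeight`. -/
theorem lintegral_damage_split_le (lam : ℝ≥0) (r n : ℕ) {V : Type} [Countable V]
    {G H : RootedMultigraph V} (h : IsSub H G) :
    ∫⁻ c, damage lam r n (G.splitTuple c) (H.splitTuple c) ∂splitChoicesLaw lam V ≤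
      damage lam r (n + 1) G H := by
  have hm (x : V × Bool) : Measurable fun c => ballWeight lam r n (V × Bool) (H.splitTuple c) x *
      excess (G.splitTuple c) (H.splitTuple c) x :=
    ((measurable_ballWeight lam r n _ x).comp (measurable_splitTuple_right H)).mul
      (measurable_excess (measurable_splitTuple_right G) (measurable_splitTuple_right H) x)
  unfold damage
  rw [lintegral_const_mul _ (Measurable.tsum hm), pow_succ, mul_assoc]
  gcongr
  rw [lintegral_tsum fun x => (hm x).aemeasurable, ENNReal.tsum_prod', ← ENNReal.tsum_mul_left]
  refine ENNReal.tsum_le_tsum fun x => ?_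
  rw [tsum_fintype, ballWeight, Finset.sum_mul, Finset.mul_sum]
  exact Finset.sum_le_sum fun b _ =>
    lintegral_excess_split_le lam h (measurable_ballWeight lam r n (V × Bool) (x, b)) x b

/-- Whether the class of a cluster belongs to `A` depends only on the ball of radius `r`. -/
def IsLocal (r : ℕ) (A : Set IsoClass) : Prop :=
  ∀ (V : Type) [Countable V] (G H : RootedMultigraph V), IsSub H G →
    (∀ x, H.Within r x → excess G H x = 0) →
      (isoClass G.cluster ∈ A ↔ isoClass H.cluster ∈ A)

/-- The excess is a sum of natural numbers, so it is at least 1 as soon as it is nonzero. -/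
theorem one_le_damage_zero (lam : ℝ≥0) (r : ℕ) {V : Type} {G H : RootedMultigraph V}
    {x : V} (hx : H.Within r x) (hne : excess G H x ≠ 0) : 1 ≤ damage lam r 0 G H := by
  have h1 : 1 ≤ excess G H x := by
    have h0 : ∃ y, ((G.mult x y - H.mult x y : ℕ) : ℝ≥0∞) ≠ 0 := by
      by_contra! hcon
      exact hne (ENNReal.tsum_eq_zero.2 hcon)
    obtain ⟨y, hy⟩ := h0
    refine le_trans ?_ (ENNReal.le_tsum y)
    rw [Ne, Nat.cast_eq_zero] at hy
    exact_mod_cast Nat.one_le_iff_ne_zero.2 hy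
  rw [damage, pow_zero, one_mul]
  refine le_trans ?_ (ENNReal.le_tsum x)
  simpa [ballWeight, hx] using h1

theorem measurable_splitOp_iterate (lam : ℝ≥0) {F : IsoClass → ℝ≥0∞} (hF : Measurable F) (n : ℕ) :
    Measurable ((splitOp lam)^[n] F) := by
  induction n with
  | zero => exact hF
  | succ n ih =>
    rw [Function.iterate_succ_apply']
    exact measurable_splitOp lam ih

theorem splitOp_iterate_succ (lam : ℝ≥0) {F : IsoClass → ℝ≥0∞} (hF : Measurable F) (n : ℕ)
    (G : RootedMultigraph V) : (splitOp lam)^[n + 1] F (isoClass G.cluster) =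
      ∫⁻ c, (splitOp lam)^[n] F (isoClass (G.splitTuple c).cluster) ∂splitChoicesLaw lam V := by
  rw [Function.iterate_succ_apply',
    splitOp_isoClass_cluster lam (measurable_splitOp_iterate lam hF n)]

/-- The coupling: both graphs are split with the same choices `c`. Two one-sided bounds replace a
bound on the absolute difference, as the values are in `ℝ≥0∞`. -/
theorem splitOp_iterate_indicator_le (lam : ℝ≥0) {r : ℕ} {A : Set IsoClass}
    (hA : MeasurableSet A) (hloc : IsLocal r A) (n : ℕ) {V : Type} [Countable V]
    {G H : RootedMultigraph V} (h : IsSub H G) :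
    (splitOp lam)^[n] (A.indicator 1) (isoClass G.cluster) ≤
        (splitOp lam)^[n] (A.indicator 1) (isoClass H.cluster) + damage lam r n G H ∧
      (splitOp lam)^[n] (A.indicator 1) (isoClass H.cluster) ≤
        (splitOp lam)^[n] (A.indicator 1) (isoClass G.cluster) + damage lam r n G H := by
  have hF : Measurable (A.indicator (1 : IsoClass → ℝ≥0∞)) := measurable_one.indicator hA
  induction n generalizing V with
  | zero =>
    simp only [Function.iterate_zero, id_eq]
    by_cases hx : ∀ x, H.Within r x → excess G H x = 0
    · have : A.indicator (1 : IsoClass → ℝ≥0∞) (isoClass G.cluster) =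
          A.indicator 1 (isoClass H.cluster) := by
        by_cases hG : isoClass G.cluster ∈ A
        · rw [Set.indicator_of_mem hG, Set.indicator_of_mem ((hloc V G H h hx).1 hG)]
          rfl
        · rw [Set.indicator_of_notMem hG, Set.indicator_of_notMem (mt (hloc V G H h hx).2 hG)]
      rw [this]
      exact ⟨le_self_add, le_self_add⟩
    -- Some excess edge touches the ball: the damage is at least 1, and this exceeds any difference
    -- of indicators.
    · push Not at hx
      obtain ⟨x, hx, hne⟩ := hx
      have hle (q : IsoClass) : A.indicator (1 : IsoClass → ℝ≥0∞) q ≤ 1 :=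
        Set.indicator_le_self' (fun _ _ => zero_le) q
      have h1 := one_le_damage_zero lam r hx hne
      exact ⟨(hle _).trans (h1.trans le_add_self), (hle _).trans (h1.trans le_add_self)⟩
  | succ n ih =>
    have hm (K : RootedMultigraph V) : Measurable fun c =>
        (splitOp lam)^[n] (A.indicator 1) (isoClass (K.splitTuple c).cluster) :=
      (measurable_splitOp_iterate lam hF n).comp
        (measurable_isoClass.comp (measurable_cluster.comp (measurable_splitTuple_right K)))
    have hd := lintegral_damage_split_le lam r n h
    simp only [splitOp_iterate_succ lam hF n]
    constructor
    · refine (lintegral_mono fun c => (ih (h.split _)).1).trans ?_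
      rw [lintegral_add_left (hm H)]
      gcongr
    · refine (lintegral_mono fun c => (ih (h.split _)).2).trans ?_
      rw [lintegral_add_left (hm G)]
      gcongr

end RootedMultigraph

/-! ### Infinite products of measures -/

/-- The sets `t i` need not be rectangles. Fixing the first family turns the measure of a box into a
product of functions of single coordinates, which are independent. -/
theorem infinitePi_prod_map_zip {ι X Y : Type*} [MeasurableSpace X] [MeasurableSpace Y]
    (P : ι → Measure X) (Q : ι → Measure Y) [∀ i, IsProbabilityMeasure (P i)]
    [∀ i, IsProbabilityMeasure (Q i)] :
    ((Measure.infinitePi P).prod (Measure.infinitePi Q)).map (fun p i => (p.1 i, p.2 i)) =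
      Measure.infinitePi fun i => (P i).prod (Q i) := by
  refine Measure.eq_infinitePi _ fun s t ht => ?_
  have hms : MeasurableSet (Set.pi (s : Set ι) t) :=
    MeasurableSet.pi s.countable_toSet fun i _ => ht i
  have hm : Measurable fun (p : (ι → X) × (ι → Y)) i => (p.1 i, p.2 i) := by fun_prop
  rw [Measure.map_apply hm hms, Measure.prod_apply (hm hms)]
  have h1 (x : ι → X) : Measure.infinitePi Q (Prod.mk x ⁻¹'
      ((fun (p : (ι → X) × (ι → Y)) i => (p.1 i, p.2 i)) ⁻¹' Set.pi s t)) =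
        ∏ i ∈ s, Q i (Prod.mk (x i) ⁻¹' t i) := by
    rw [← Measure.infinitePi_pi Q fun i _ => measurable_prodMk_left (ht i)]
    rfl
  simp_rw [h1]
  have h2 := lintegral_prod_eq_prod_lintegral_of_indepFun s
    (fun i (x : ι → X) => Q i (Prod.mk (x i) ⁻¹' t i))
    (iIndepFun_infinitePi (P := P) (X := fun i x => Q i (Prod.mk x ⁻¹' t i))
      fun i => measurable_measure_prodMk_left (ht i))
    fun i => (measurable_measure_prodMk_left (ht i)).comp (measurable_pi_apply i)
  rw [h2]
  refine Finset.prod_congr rfl fun i _ => ?_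
  rw [Measure.prod_apply (ht i)]
  conv_rhs => rw [← Measure.infinitePi_map_eval P i,
    lintegral_map (measurable_measure_prodMk_left (ht i)) (measurable_pi_apply i)]

theorem infinitePi_prod_map_sumElim {ι κ X : Type*} [MeasurableSpace X]
    (P : ι → Measure X) (Q : κ → Measure X) [∀ i, IsProbabilityMeasure (P i)]
    [∀ i, IsProbabilityMeasure (Q i)] (R : ι ⊕ κ → Measure X) [∀ i, IsProbabilityMeasure (R i)]
    (hP : ∀ i, R (Sum.inl i) = P i) (hQ : ∀ i, R (Sum.inr i) = Q i) :
    ((Measure.infinitePi P).prod (Measure.infinitePi Q)).map (fun p => Sum.elim p.1 p.2) =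
      Measure.infinitePi R := by
  have hm : Measurable fun p : (ι → X) × (κ → X) => Sum.elim p.1 p.2 := by
    refine measurable_pi_lambda _ fun j => ?_
    cases j
    · exact (measurable_pi_apply _).comp measurable_fst
    · exact (measurable_pi_apply _).comp measurable_snd
  refine Measure.eq_infinitePi _ fun s t ht => ?_
  rw [Measure.map_apply hm (MeasurableSet.pi s.countable_toSet fun i _ => ht i)]
  have hset : (fun p : (ι → X) × (κ → X) => Sum.elim p.1 p.2) ⁻¹' Set.pi s t =
      Set.pi (s.toLeft : Set ι) (fun i => t (Sum.inl i)) ×ˢ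
        Set.pi (s.toRight : Set κ) (fun i => t (Sum.inr i)) := by
    ext p
    simp [Set.mem_pi]
  rw [hset, Measure.prod_prod, Measure.infinitePi_pi P fun i _ => ht _,
    Measure.infinitePi_pi Q fun i _ => ht _]
  conv_rhs => rw [← Finset.toLeft_disjSum_toRight (u := s), Finset.prod_disjSum]
  simp only [hP, hQ]

/-! ### Thinning of a Poisson variable -/

namespace RootedMultigraph

/-- Point masses with the factorials cleared, so that later computations in `ℝ≥0∞` avoid division.
-/
theorem poissonMeasure_mul_factorial (r : ℝ≥0) (n : ℕ) :
    poissonMeasure r {n} * (n.factorial : ℝ≥0∞) =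
      ENNReal.ofReal (Real.exp (-r)) * (r : ℝ≥0∞) ^ n := by
  rw [poissonMeasure_singleton, ← ENNReal.ofReal_coe_nnreal (p := r),
    ← ENNReal.ofReal_pow (NNReal.coe_nonneg r), ← ENNReal.ofReal_natCast, ← ENNReal.ofReal_mul (by positivity),
    ← ENNReal.ofReal_mul (by positivity)]
  congr 1
  have : (n.factorial : ℝ) ≠ 0 := by positivity
  field_simp

/-- The numbers of the first `n` pairs of coins with given outcomes. -/
def counts (n : ℕ) (Z : ℕ × Bool → Bool) (t : Bool × Bool) : ℕ :=
  ((Finset.range n).filter fun k => Z (k, false) = t.1 ∧ Z (k, true) = t.2).card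

/-- Fair coins. -/
noncomputable abbrev coins : Measure (ℕ × Bool → Bool) :=
  Measure.infinitePi fun _ => fairCoin

theorem counts_succ (n : ℕ) (Z : ℕ × Bool → Bool) :
    counts (n + 1) Z = counts n Z + Pi.single (Z (n, false), Z (n, true)) 1 := by
  funext t
  simp only [counts, Pi.add_apply, Finset.range_add_one, Finset.filter_insert]
  by_cases h : Z (n, false) = t.1 ∧ Z (n, true) = t.2
  · have ht : t = (Z (n, false), Z (n, true)) := Prod.ext h.1.symm h.2.symm
    rw [if_pos h, Finset.card_insert_of_notMem (by simp), ht, Pi.single_eq_same]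
  · have ht : t ≠ (Z (n, false), Z (n, true)) := fun ht => h (by rw [ht]; exact ⟨rfl, rfl⟩)
    rw [if_neg h, Pi.single_eq_of_ne ht, add_zero]

theorem counts_congr {n : ℕ} {Z Z' : ℕ × Bool → Bool} (h : ∀ k < n, ∀ b, Z (k, b) = Z' (k, b)) :
    counts n Z = counts n Z' := by
  funext t
  unfold counts
  congr 1
  refine Finset.filter_congr fun k hk => ?_
  rw [h k (Finset.mem_range.1 hk), h k (Finset.mem_range.1 hk)]

theorem counts_update_of_le {n k : ℕ} (hk : n ≤ k) (Z : ℕ × Bool → Bool) (b a : Bool) :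
    counts n (Function.update Z (k, b) a) = counts n Z :=
  counts_congr fun j hj b' => Function.update_of_ne (by
    intro h
    simp only [Prod.mk.injEq] at h
    omega) _ _

@[fun_prop]
theorem measurable_counts (n : ℕ) : Measurable (counts n) := by
  refine measurable_pi_lambda _ fun t => ?_
  unfold counts
  simp only [Finset.card_filter]
  refine Finset.measurable_sum _ fun k _ => Measurable.ite ?_ measurable_const measurable_const
  exact (measurableSet_eq_fun (measurable_pi_apply (k, false)) measurable_const).inter
    (measurableSet_eq_fun (measurable_pi_apply (k, true)) measurable_const)

theorem measurable_indicator_eq (b : Bool) :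
    Measurable fun a : Bool => if a = b then (1 : ℝ≥0∞) else 0 := measurable_of_countable _

theorem lintegral_coin_eq (b : Bool) :
    ∫⁻ a, (if a = b then (1 : ℝ≥0∞) else 0) ∂fairCoin = 1 / 2 := by
  rw [← fairCoin_singleton b, ← lintegral_indicator_one (measurableSet_singleton b)]
  refine lintegral_congr fun a => ?_
  simp [Set.indicator_apply]

theorem lintegral_pair_mul (n : ℕ) (t : Bool × Bool) {f : (Bool × Bool → ℕ) → ℝ≥0∞}
    (hf : Measurable f) :
    ∫⁻ Z, (if Z (n, false) = t.1 then 1 else 0) * ((if Z (n, true) = t.2 then 1 else 0) *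
      f (counts n Z)) ∂coins = 1 / 4 * ∫⁻ Z, f (counts n Z) ∂coins := by
  have h2 := lintegral_infinitePi_mul_of_update_eq
    (fun _ : ℕ × Bool => fairCoin) (n, true) (measurable_indicator_eq t.2)
    (f := fun Z => f (counts n Z)) (by fun_prop)
    fun Z a => by rw [counts_update_of_le le_rfl]
  have hm : Measurable fun Z : ℕ × Bool → Bool => if Z (n, true) = t.2 then (1 : ℝ≥0∞) else 0 :=
    (measurable_indicator_eq t.2).comp (measurable_pi_apply (n, true))
  have h1 := lintegral_infinitePi_mul_of_update_eq
    (fun _ : ℕ × Bool => fairCoin) (n, false) (measurable_indicator_eq t.1)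
    (f := fun Z => (if Z (n, true) = t.2 then 1 else 0) * f (counts n Z)) (by fun_prop)
    fun Z a => by rw [counts_update_of_le le_rfl, Function.update_of_ne (by simp)]
  rw [h1, h2, lintegral_coin_eq, lintegral_coin_eq, ← mul_assoc]
  congr 1
  rw [← ENNReal.toReal_eq_toReal_iff' (by finiteness) (by finiteness)]
  norm_num

/-- Condition on the class of the last pair of coins, each class having probability 1/4
independently of the earlier pairs. -/
theorem coins_counts_succ (n : ℕ) (f : Bool × Bool → ℕ) :
    coins {Z | counts (n + 1) Z = f} =
      ∑ t, 1 / 4 * coins {Z | counts n Z + Pi.single t 1 = f} := by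
  have hms (t : Bool × Bool) : MeasurableSet {Z | counts n Z + Pi.single t 1 = f} :=
    measurableSet_eq_fun (by fun_prop) measurable_const
  have hm (t : Bool × Bool) : Measurable fun g : Bool × Bool → ℕ =>
      if g + Pi.single t 1 = f then (1 : ℝ≥0∞) else 0 :=
    Measurable.ite (measurableSet_eq_fun (by fun_prop) measurable_const)
      measurable_const measurable_const
  have key (t : Bool × Bool) : 1 / 4 * coins {Z | counts n Z + Pi.single t 1 = f} =
      ∫⁻ Z, (if Z (n, false) = t.1 then 1 else 0) * ((if Z (n, true) = t.2 then 1 else 0) *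
        if counts n Z + Pi.single t 1 = f then 1 else 0) ∂coins := by
    rw [lintegral_pair_mul n t (hm t), ← lintegral_indicator_one (hms t)]
    refine congrArg _ (lintegral_congr fun Z => ?_)
    simp [Set.indicator_apply]
  have hmeas (t : Bool × Bool) : Measurable fun Z : ℕ × Bool → Bool =>
      (if Z (n, false) = t.1 then (1 : ℝ≥0∞) else 0) * ((if Z (n, true) = t.2 then 1 else 0) *
        if counts n Z + Pi.single t 1 = f then 1 else 0) :=
    ((measurable_indicator_eq t.1).comp (measurable_pi_apply (n, false))).mul
      (((measurable_indicator_eq t.2).comp (measurable_pi_apply (n, true))).mul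
        ((hm t).comp (measurable_counts n)))
  simp_rw [key]
  rw [← lintegral_finsetSum _ fun t _ => hmeas t, ← lintegral_indicator_one
    (measurableSet_eq_fun (measurable_counts (n + 1)) measurable_const)]
  refine lintegral_congr fun Z => ?_
  rw [Finset.sum_eq_single (Z (n, false), Z (n, true))]
  · simp only [if_true, one_mul, ← counts_succ]
    simp [Set.indicator_apply]
  · intro t _ ht
    by_cases h1 : Z (n, false) = t.1
    · have h2 : Z (n, true) ≠ t.2 := fun h2 => ht (Prod.ext h1.symm h2.symm)
      rw [if_neg h2, zero_mul, mul_zero]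
    · rw [if_neg h1, zero_mul]
  · simp

/-- The multinomial distribution with denominators cleared. In the inductive step, a last pair of
class `t` contributes `f t * n !`, and the `f t` add up to `n + 1`. -/
theorem coins_counts_mul (n : ℕ) (f : Bool × Bool → ℕ) :
    coins {Z | counts n Z = f} * ((∏ t, (f t).factorial : ℕ) : ℝ≥0∞) * 4 ^ n =
      if ∑ t, f t = n then (n.factorial : ℝ≥0∞) else 0 := by
  induction n generalizing f with
  | zero =>
    have h0 (Z : ℕ × Bool → Bool) : counts 0 Z = 0 := by funext t; simp [counts]
    by_cases hf : f = 0
    · subst hf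
      simp [h0]
    · have h1 : ¬ ∑ t, f t = 0 := fun h => hf (funext fun t =>
        Finset.sum_eq_zero_iff.1 h t (Finset.mem_univ t))
      simp [h0, h1, Ne.symm hf]
  | succ n ih =>
    have hterm (t : Bool × Bool) : coins {Z | counts n Z + Pi.single t 1 = f} *
        ((∏ t, (f t).factorial : ℕ) : ℝ≥0∞) * 4 ^ n =
          if ∑ t, f t = n + 1 then (f t : ℝ≥0∞) * n.factorial else 0 := by
      by_cases ht : f t = 0
      · have : {Z | counts n Z + Pi.single t 1 = f} = ∅ := by
          refine Set.eq_empty_of_forall_notMem fun Z hZ => ?_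
          have := congrFun (show counts n Z + Pi.single t 1 = f from hZ) t
          simp [ht] at this
        simp [this, ht]
      -- The counts before the last pair must be `g`, which is `f` with its value at `t` lowered by
      -- one.
      · obtain ⟨j, hj⟩ := Nat.exists_eq_succ_of_ne_zero ht
        have hfg : f = Function.update f t j + Pi.single t 1 := by
          funext u
          by_cases hu : u = t
          · subst hu; simp [hj]
          · simp [hu]
        set g := Function.update f t j with hg
        have hset : {Z | counts n Z + Pi.single t 1 = f} = {Z | counts n Z = g} := by
          ext Z
          simp only [Set.mem_ofPred_eq]
          rw [hfg, add_left_inj]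
        have hprod : ∏ u, (f u).factorial = f t * ∏ u, (g u).factorial := by
          rw [← Finset.mul_prod_erase _ _ (Finset.mem_univ t),
            ← Finset.mul_prod_erase Finset.univ (fun u => (g u).factorial) (Finset.mem_univ t),
            ← mul_assoc]
          congr 1
          · rw [hg, Function.update_self, hj, Nat.factorial_succ]
          · refine Finset.prod_congr rfl fun u hu => ?_
            rw [hg, Function.update_of_ne (Finset.ne_of_mem_erase hu)]
        have hsum : ∑ u, f u = ∑ u, g u + 1 := by
          conv_lhs => rw [hfg]
          simp [Finset.sum_add_distrib]
        rw [hset, hprod, hsum]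
        have := ih g
        simp only [Nat.add_right_cancel_iff]
        calc _ = (f t : ℝ≥0∞) * (coins {Z | counts n Z = g} *
              ((∏ t, (g t).factorial : ℕ) : ℝ≥0∞) * 4 ^ n) := by push_cast; ring
          _ = _ := by rw [this]; split_ifs <;> simp
    rw [coins_counts_succ, Finset.sum_mul, Finset.sum_mul]
    have h4 : (1 / 4 : ℝ≥0∞) * 4 = 1 := by
      rw [one_div]; exact ENNReal.inv_mul_cancel (by norm_num) (by norm_num)
    calc _ = ∑ t, (1 / 4 * 4) * (coins {Z | counts n Z + Pi.single t 1 = f} *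
          ((∏ t, (f t).factorial : ℕ) : ℝ≥0∞) * 4 ^ n) := by
          refine Finset.sum_congr rfl fun t _ => ?_
          rw [pow_succ]; ring
      _ = _ := by
          simp only [h4, one_mul, hterm]
          split_ifs with h
          · rw [← Finset.sum_mul, ← Nat.cast_sum, h, Nat.factorial_succ, Nat.cast_mul]
          · simp

/-- Distributing a Poisson number of objects independently and uniformly over four classes yields
four independent Poisson variables. -/
theorem poisson_prod_coins_map_counts (m : ℝ≥0) :
    ((poissonMeasure m).prod coins).map (fun p => counts p.1 p.2) =
      Measure.infinitePi fun _ : Bool × Bool => poissonMeasure (m / 4) := by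
  have hm : Measurable fun p : ℕ × (ℕ × Bool → Bool) => counts p.1 p.2 :=
    measurable_from_prod_countable_right fun n => measurable_counts n
  refine Measure.ext_of_singleton fun f => ?_
  rw [Measure.map_apply hm (measurableSet_singleton f), Measure.infinitePi_singleton_of_fintype,
    Measure.prod_apply (hm (measurableSet_singleton f)), lintegral_countable']
  set p : ℝ≥0∞ := ((∏ t, (f t).factorial : ℕ) : ℝ≥0∞) with hp
  have hp0 : p ≠ 0 := by
    rw [hp, Nat.cast_ne_zero]
    exact Finset.prod_ne_zero_iff.2 fun t _ => (f t).factorial_ne_zero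
  have hpt : p ≠ ∞ := ENNReal.natCast_ne_top _
  have h4 (n : ℕ) : (4 : ℝ≥0∞) ^ n ≠ 0 := by positivity
  have h4t (n : ℕ) : (4 : ℝ≥0∞) ^ n ≠ ∞ := by finiteness
  set n := ∑ t, f t with hn
  have hset (k : ℕ) : Prod.mk k ⁻¹' ((fun p : ℕ × (ℕ × Bool → Bool) => counts p.1 p.2) ⁻¹' {f}) =
      {Z | counts k Z = f} := rfl
  simp only [hset]
  -- The four counts add up to the number of objects, so only the value `n = ∑ t, f t` of the
  -- Poisson variable contributes.
  rw [tsum_eq_single n]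
  · rw [← ENNReal.mul_left_inj (mul_ne_zero hp0 (h4 n)) (ENNReal.mul_ne_top hpt (h4t n))]
    have h1 := coins_counts_mul n f
    rw [if_pos rfl] at h1
    calc _ = (coins {Z | counts n Z = f} * p * 4 ^ n) * poissonMeasure m {n} := by ring
      _ = poissonMeasure m {n} * n.factorial := by rw [h1, mul_comm]
      _ = ENNReal.ofReal (Real.exp (-m)) * (m : ℝ≥0∞) ^ n := poissonMeasure_mul_factorial m n
      -- The powers of 4 turn the means `m / 4` back into `m`, and the four exponentials multiply to
      -- the original one.
      _ = ∏ t, (poissonMeasure (m / 4) {f t} * (f t).factorial * 4 ^ f t) := by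
        simp_rw [poissonMeasure_mul_factorial, mul_assoc, ← mul_pow]
        have h44 : ((m / 4 : ℝ≥0) : ℝ≥0∞) * 4 = m := by
          rw [show (4 : ℝ≥0∞) = ((4 : ℝ≥0) : ℝ≥0∞) by norm_num, ← ENNReal.coe_mul,
            div_mul_cancel₀ _ (by norm_num)]
        rw [h44, Finset.prod_mul_distrib, Finset.prod_pow_eq_pow_sum, Finset.prod_const,
          ← ENNReal.ofReal_pow (Real.exp_nonneg _), ← Real.exp_nat_mul]
        congr 3
        simp
        ring
      _ = _ := by
        rw [Finset.prod_mul_distrib, Finset.prod_mul_distrib, Finset.prod_pow_eq_pow_sum, hp,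
          Nat.cast_prod, mul_assoc]
  · intro k hk
    have h1 := coins_counts_mul k f
    rw [if_neg (Ne.symm hk), mul_assoc, mul_eq_zero] at h1
    rw [h1.resolve_right (mul_ne_zero hp0 (h4 k)), zero_mul]

end RootedMultigraph

namespace RootedMultigraph

variable {V : Type*}

/-! ### Multigraphs with independent Poisson edge numbers -/

/-- The multigraph with vertex set `V`, root `o` and prescribed edge numbers. -/
noncomputable def graphOf (o : V) (N : Sym2 V → ℕ) : RootedMultigraph V where
  verts := Set.univ
  root := o
  mult x y := open Classical in if x = y then 0 else N s(x, y)
  root_mem := Set.mem_univ _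
  mult_comm x y := by
    by_cases h : x = y
    · rw [h]
    · rw [if_neg h, if_neg (Ne.symm h), Sym2.eq_swap]
  mult_self x := if_pos rfl
  mem_of_mult_ne_zero _ _ _ := Set.mem_univ _

theorem graphOf_mult_of_ne (o : V) (N : Sym2 V → ℕ) {x y : V} (h : x ≠ y) :
    (graphOf o N).mult x y = N s(x, y) :=
  if_neg h

theorem graphOf_mult_le (o : V) (N : Sym2 V → ℕ) (x y : V) :
    (graphOf o N).mult x y ≤ N s(x, y) := by
  by_cases h : x = y
  · subst h
    rw [(graphOf o N).mult_self]
    exact Nat.zero_le _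
  · rw [graphOf_mult_of_ne o N h]

/-- Independent Poisson edge numbers with prescribed means. -/
noncomputable abbrev poissonLaw (m : Sym2 V → ℝ≥0) : Measure (Sym2 V → ℕ) :=
  Measure.infinitePi fun e => poissonMeasure (m e)

theorem measurable_graphOf_right [Countable V] (o : V) : Measurable (graphOf o) := by
  refine measurable_of_coordinates (fun v => MeasurableSet.const (o = v))
    (fun v => MeasurableSet.univ) fun x y => ?_
  by_cases h : x = y
  · simp only [h, mult_self]
    exact measurable_const
  · simp only [graphOf_mult_of_ne o _ h]
    exact measurable_pi_apply _

/-- Unordered pairs of distinct elements. -/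
abbrev Offdiag (V : Type*) : Type _ := {e : Sym2 V // ¬ e.IsDiag}

theorem Offdiag.exists_ends (e : Offdiag V) : ∃ p : V × V, s(p.1, p.2) = e.1 :=
  Sym2.ind (f := fun e => ∃ p : V × V, s(p.1, p.2) = e) (fun x y => ⟨(x, y), rfl⟩) e.1

/-- The elements of an unordered pair, in some order. -/
noncomputable def Offdiag.ends (e : Offdiag V) : V × V := e.exists_ends.choose

theorem Offdiag.mk_ends (e : Offdiag V) : s(e.ends.1, e.ends.2) = e.1 := e.exists_ends.choose_spec

theorem Offdiag.ends_ne (e : Offdiag V) : e.ends.1 ≠ e.ends.2 := fun h =>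
  e.2 (by rw [← e.mk_ends, h]; exact rfl)

/-- The pairs of vertices of a split graph that may be adjacent, parametrized by the pairs of
vertices of the original graph with a choice of the copies, and by the vertices. -/
noncomputable def splitPair : Offdiag V × (Bool × Bool) ⊕ V → Sym2 (V × Bool)
  | Sum.inl (e, t) => s((e.ends.1, t.1), (e.ends.2, t.2))
  | Sum.inr x => s((x, false), (x, true))

theorem splitPair_injective : Function.Injective (splitPair (V := V)) := by
  rintro (⟨e, t⟩ | x) (⟨e', t'⟩ | x') h
  · simp only [splitPair, Sym2.eq_iff, Prod.mk.injEq] at h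
    have key : e = e' := by
      refine Subtype.ext ?_
      rw [← e.mk_ends, ← e'.mk_ends, Sym2.eq_iff]
      tauto
    subst key
    rcases h with h | h
    · rw [Prod.ext h.1.2 h.2.2]
    · exact absurd h.1.1 e.ends_ne
  · simp only [splitPair, Sym2.eq_iff, Prod.mk.injEq] at h
    refine absurd ?_ e.ends_ne
    rcases h with h | h <;> rw [h.1.1, h.2.1]
  · simp only [splitPair, Sym2.eq_iff, Prod.mk.injEq] at h
    refine absurd ?_ e'.ends_ne
    rcases h with h | h <;> rw [← h.1.1, ← h.2.1]
  · simp only [splitPair, Sym2.eq_iff, Prod.mk.injEq] at h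
    have : x = x' := by tauto
    rw [this]

theorem exists_splitPair_eq {x y : V × Bool} (h : x ≠ y) : ∃ j, splitPair j = s(x, y) := by
  obtain ⟨u, a⟩ := x
  obtain ⟨v, b⟩ := y
  by_cases huv : u = v
  · subst huv
    have hab : a ≠ b := fun hab => h (by rw [hab])
    refine ⟨Sum.inr u, ?_⟩
    cases a <;> cases b <;> simp_all [splitPair, Sym2.eq_swap]
  · set e : Offdiag V := ⟨s(u, v), huv⟩ with he
    have h1 : s(e.ends.1, e.ends.2) = s(u, v) := e.mk_ends
    rw [Sym2.eq_iff] at h1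
    rcases h1 with h1 | h1
    · exact ⟨Sum.inl (e, (a, b)), by simp [splitPair, h1]⟩
    · refine ⟨Sum.inl (e, (b, a)), ?_⟩
      simp only [splitPair, h1]
      exact Sym2.eq_swap

/-- The coins at the two ends of the edges between the elements of a pair. -/
noncomputable def sideOf (s : V × V × ℕ → Bool) (e : Offdiag V) (p : ℕ × Bool) : Bool :=
  if p.2 then s (e.ends.2, e.ends.1, p.1) else s (e.ends.1, e.ends.2, p.1)

/-- The edge numbers of the split graph. -/
noncomputable def splitNumbers (N : Sym2 V → ℕ) (s : V × V × ℕ → Bool) (E : V → ℕ) :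
    Offdiag V × (Bool × Bool) ⊕ V → ℕ :=
  Sum.elim (fun p => counts (N p.1.1) (sideOf s p.1) p.2) E

/-- Pairs outside the range of `splitPair` are diagonal and invisible to `graphOf`, so the default
value 0 is immaterial. -/
theorem split_graphOf (o : V) (N : Sym2 V → ℕ) (s : V × V × ℕ → Bool) (E : V → ℕ) (a : Bool) :
    (graphOf o N).splitTuple (s, E, a) =
      graphOf (o, a) (Function.extend splitPair (splitNumbers N s E) 0) := by
  refine ext rfl rfl fun x y => ?_
  by_cases hxy : x = y
  · subst hxy
    rw [mult_self, mult_self]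
  rw [graphOf_mult_of_ne _ _ hxy]
  obtain ⟨j, hj⟩ := exists_splitPair_eq hxy
  rw [← hj, splitPair_injective.extend_apply]
  rcases j with ⟨e, t⟩ | v
  · simp only [splitPair, Sym2.eq_iff] at hj
    have hN : (graphOf o N).mult e.ends.1 e.ends.2 = N e.1 := by
      rw [graphOf_mult_of_ne o N e.ends_ne, e.mk_ends]
    have key : ((graphOf o N).splitTuple (s, E, a)).mult (e.ends.1, t.1) (e.ends.2, t.2) =
        splitNumbers N s E (Sum.inl (e, t)) := by
      rw [split_mult_of_ne _ e.ends_ne]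
      simp only [hN]
      rfl
    rcases hj with ⟨rfl, rfl⟩ | ⟨rfl, rfl⟩
    · exact key
    · rw [mult_comm]
      exact key
  · simp only [splitPair, Sym2.eq_iff] at hj
    rcases hj with ⟨rfl, rfl⟩ | ⟨rfl, rfl⟩ <;> simp [split, graphOf, splitNumbers]

theorem graphOf_extend_comp (o : V × Bool) (N : Sym2 (V × Bool) → ℕ) :
    graphOf o (Function.extend splitPair (fun j => N (splitPair j)) 0) = graphOf o N := by
  refine ext rfl rfl fun x y => ?_
  by_cases hxy : x = y
  · subst hxy
    rw [mult_self, mult_self]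
  · obtain ⟨j, hj⟩ := exists_splitPair_eq hxy
    rw [graphOf_mult_of_ne _ _ hxy, graphOf_mult_of_ne _ _ hxy, ← hj,
      splitPair_injective.extend_apply]

/-- Once an orientation of each pair is chosen, different edges and different ends use different
coins of the original family. -/
theorem measurePreserving_sideOf :
    MeasurePreserving (sideOf (V := V)) (Measure.infinitePi fun _ => fairCoin)
      (Measure.infinitePi fun _ => coins) := by
  have hinj : Function.Injective fun p : Offdiag V × (ℕ × Bool) =>
      if p.2.2 then (p.1.ends.2, p.1.ends.1, p.2.1) else (p.1.ends.1, p.1.ends.2, p.2.1) := by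
    rintro ⟨e, k, b⟩ ⟨e', k', b'⟩ h
    have key (h : s(e.ends.1, e.ends.2) = s(e'.ends.1, e'.ends.2)) : e = e' :=
      Subtype.ext (by rw [← e.mk_ends, ← e'.mk_ends, h])
    cases b <;> cases b' <;> simp at h ⊢
    · exact ⟨key (by rw [h.1, h.2.1]), h.2.2⟩
    · obtain rfl := key (by rw [h.1, h.2.1, Sym2.eq_swap])
      exact e.ends_ne h.1
    · obtain rfl := key (by rw [h.1, h.2.1, Sym2.eq_swap])
      exact e.ends_ne h.2.1
    · exact ⟨key (by rw [h.1, h.2.1]), h.2.2⟩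
  have h1 := Measure.map_infinitePi_infinitePi_of_inj (P := fun _ : V × V × ℕ => fairCoin) hinj
  have h2 := Measure.infinitePi_map_curry
    (fun (_ : Offdiag V) (_ : ℕ × Bool) => fairCoin)
  have hm : Measurable (sideOf (V := V)) := by
    refine measurable_pi_lambda _ fun e => measurable_pi_lambda _ fun p => ?_
    unfold sideOf
    split_ifs <;> exact measurable_pi_apply _
  refine ⟨hm, ?_⟩
  rw [← h2, ← h1, Measure.map_map (by fun_prop) (by fun_prop)]
  congr 1
  funext s e p
  simp only [sideOf, Function.comp_apply, MeasurableEquiv.curry, MeasurableEquiv.coe_mk,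
    Equiv.curry_apply, Function.curry]
  split_ifs <;> rfl

/-- A chain of measure-preserving maps: drop the diagonal pairs, attach to each remaining pair its
own coins, thin its edge number into four independent Poisson variables, flatten the indices, and
adjoin the new edges between twins. -/
theorem measurePreserving_splitNumbers (lam : ℝ≥0) (m : Sym2 V → ℝ≥0)
    (m' : Sym2 (V × Bool) → ℝ≥0)
    (h1 : ∀ x y, x ≠ y → ∀ a b, m' s((x, a), (y, b)) = m s(x, y) / 4)
    (h2 : ∀ x, m' s((x, false), (x, true)) = lam / 2) :
    MeasurePreserving (fun p : ((Sym2 V → ℕ) × (V × V × ℕ → Bool)) × (V → ℕ) =>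
        splitNumbers p.1.1 p.1.2 p.2)
      (((poissonLaw m).prod (Measure.infinitePi fun _ => fairCoin)).prod
        (Measure.infinitePi fun _ => poissonMeasure (lam / 2)))
      (Measure.infinitePi fun j => poissonMeasure (m' (splitPair j))) := by
  have e1 : MeasurePreserving (fun (N : Sym2 V → ℕ) (e : Offdiag V) => N e.1) (poissonLaw m)
      (Measure.infinitePi fun e : Offdiag V => poissonMeasure (m e.1)) :=
    ⟨by fun_prop, Measure.map_infinitePi_infinitePi_of_inj Subtype.val_injective⟩
  have e2 := e1.prod (measurePreserving_sideOf (V := V))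
  have e3 : MeasurePreserving (fun (p : (Offdiag V → ℕ) × (Offdiag V → ℕ × Bool → Bool)) i =>
      (p.1 i, p.2 i)) _ _ := ⟨by fun_prop, infinitePi_prod_map_zip
        (fun e : Offdiag V => poissonMeasure (m e.1)) (fun _ => coins)⟩
  have hc : Measurable fun p : ℕ × (ℕ × Bool → Bool) => counts p.1 p.2 :=
    measurable_from_prod_countable_right fun n => measurable_counts n
  have e4 : MeasurePreserving (fun (x : Offdiag V → ℕ × (ℕ × Bool → Bool)) i =>
      counts (x i).1 (x i).2) (Measure.infinitePi fun e => (poissonMeasure (m e.1)).prod coins)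
      (Measure.infinitePi fun e => Measure.infinitePi fun _ : Bool × Bool =>
        poissonMeasure (m e.1 / 4)) := by
    refine ⟨measurable_pi_lambda _ fun i => hc.comp (measurable_pi_apply i), ?_⟩
    rw [Measure.infinitePi_map_pi (fun e : Offdiag V => (poissonMeasure (m e.1)).prod coins)
      (f := fun _ p => counts p.1 p.2) fun _ => hc]
    congr 1
    funext e
    exact poisson_prod_coins_map_counts (m e.1)
  have e5 : MeasurePreserving (MeasurableEquiv.curry (Offdiag V) (Bool × Bool) ℕ).symm _ _ :=
    ⟨by fun_prop, Measure.infinitePi_map_curry_symm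
      (fun (e : Offdiag V) (_ : Bool × Bool) => poissonMeasure (m e.1 / 4))⟩
  have e6 := (e5.comp (e4.comp (e3.comp e2))).prod
    (MeasurePreserving.id (Measure.infinitePi fun _ : V => poissonMeasure (lam / 2)))
  have e7 : MeasurePreserving (fun p : (Offdiag V × (Bool × Bool) → ℕ) × (V → ℕ) =>
      (Sum.elim p.1 p.2 : Offdiag V × (Bool × Bool) ⊕ V → ℕ)) _ _ :=
    ⟨measurable_pi_lambda _ fun j => by cases j <;> simp <;> fun_prop,
      infinitePi_prod_map_sumElim
        (fun p : Offdiag V × (Bool × Bool) => poissonMeasure (m p.1.1 / 4))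
        (fun _ : V => poissonMeasure (lam / 2)) (fun j => poissonMeasure (m' (splitPair j)))
        (fun p => by rw [splitPair, h1 _ _ p.1.ends_ne, p.1.mk_ends])
        (fun x => by rw [splitPair, h2])⟩
  exact e7.comp e6

/-- The class of graphs with independent Poisson edge numbers is closed under splitting. Only
off-diagonal values of `m'` are prescribed, so this applies to `splitMean` as well as to the
pulled-back means of the percolation. -/
theorem lintegral_split_poisson [Countable V] (lam : ℝ≥0) (m : Sym2 V → ℝ≥0)
    (m' : Sym2 (V × Bool) → ℝ≥0)
    (h1 : ∀ x y, x ≠ y → ∀ a b, m' s((x, a), (y, b)) = m s(x, y) / 4)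
    (h2 : ∀ x, m' s((x, false), (x, true)) = lam / 2) (o : V)
    {F : RootedMultigraph (V × Bool) → ℝ≥0∞} (hF : Measurable F) :
    ∫⁻ N, ∫⁻ c, F ((graphOf o N).splitTuple c) ∂splitChoicesLaw lam V ∂poissonLaw m =
      ∫⁻ a, ∫⁻ N, F (graphOf (o, a) N) ∂poissonLaw m' ∂fairCoin := by
  set A := Measure.infinitePi fun _ : V × V × ℕ => fairCoin
  set B := Measure.infinitePi fun _ : V => poissonMeasure (lam / 2)
  have hext : Measurable fun R : Offdiag V × (Bool × Bool) ⊕ V → ℕ =>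
      (Function.extend splitPair R 0 : Sym2 (V × Bool) → ℕ) := by
    refine measurable_pi_lambda _ fun e => ?_
    by_cases he : ∃ j, splitPair j = e
    · obtain ⟨j, rfl⟩ := he
      simp only [splitPair_injective.extend_apply]
      exact measurable_pi_apply j
    · simp only [Function.extend_apply' _ _ _ he]
      exact measurable_const
  have hg : Measurable fun p : (Sym2 (V × Bool) → ℕ) × Bool => F (graphOf (o, p.2) p.1) :=
    hF.comp (measurable_from_prod_countable_left fun a => measurable_graphOf_right (o, a))
  have hG : Measurable fun p : (Offdiag V × (Bool × Bool) ⊕ V → ℕ) × Bool =>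
      F (graphOf (o, p.2) (Function.extend splitPair p.1 0)) :=
    hg.comp ((hext.comp measurable_fst).prodMk measurable_snd)
  have e1 := ((measurePreserving_splitNumbers lam m m' h1 h2).prod
    (MeasurePreserving.id fairCoin)).comp
      (((measurePreserving_prodAssoc ((poissonLaw m).prod A) B fairCoin).symm).comp
        ((measurePreserving_prodAssoc (poissonLaw m) A (B.prod fairCoin)).symm))
  have e2 : MeasurePreserving (fun (N : Sym2 (V × Bool) → ℕ) j => N (splitPair j)) (poissonLaw m')
      (Measure.infinitePi fun j => poissonMeasure (m' (splitPair j))) :=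
    ⟨by fun_prop, Measure.map_infinitePi_infinitePi_of_inj splitPair_injective⟩
  have h3 := e1.lintegral_comp hG
  have h4 := (e2.prod (MeasurePreserving.id fairCoin)).lintegral_comp hG
  simp only [Prod.map, id, graphOf_extend_comp] at h4
  have hS : Measurable fun p : (Sym2 V → ℕ) × (V × V × ℕ → Bool) × (V → ℕ) × Bool =>
      F ((graphOf o p.1).splitTuple p.2) :=
    hF.comp (measurable_splitTuple.comp
      (((measurable_graphOf_right o).comp measurable_fst).prodMk measurable_snd))
  have h5 : ∫⁻ p, F ((graphOf o p.1).splitTuple p.2) ∂(poissonLaw m).prod (A.prod (B.prod fairCoin))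
      = ∫⁻ p, F (graphOf (o, p.2) p.1) ∂(poissonLaw m').prod fairCoin := by
    rw [h4, ← h3]
    refine lintegral_congr fun p => ?_
    rw [show p.2 = (p.2.1, p.2.2.1, p.2.2.2) from rfl, split_graphOf]
    rfl
  rw [lintegral_prod _ hS.aemeasurable, lintegral_prod_symm' _ hg] at h5
  exact h5

end RootedMultigraph

namespace RootedMultigraph

variable {V : Type*}

/-- This follows from `(n + 1) P(n + 1) = r P(n)`. -/
theorem lintegral_poissonMeasure (r : ℝ≥0) : ∫⁻ n, (n : ℝ≥0∞) ∂poissonMeasure r = r := by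
  have h (n : ℕ) : ((n + 1 : ℕ) : ℝ≥0∞) * poissonMeasure r {n + 1} = r * poissonMeasure r {n} := by
    have h1 := poissonMeasure_mul_factorial r (n + 1)
    have h2 := poissonMeasure_mul_factorial r n
    have h0 : (n.factorial : ℝ≥0∞) ≠ 0 := by exact_mod_cast n.factorial_ne_zero
    rw [← ENNReal.mul_left_inj h0 (ENNReal.natCast_ne_top _)]
    calc _ = poissonMeasure r {n + 1} * ((n + 1).factorial : ℕ) := by
          rw [Nat.factorial_succ, Nat.cast_mul]; ring
      _ = r * (poissonMeasure r {n} * n.factorial) := by rw [h1, h2, pow_succ]; ring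
      _ = _ := by ring
  have h1 : ∑' n, poissonMeasure r {n} = 1 := by
    have := lintegral_countable' (μ := poissonMeasure r) fun _ => 1
    simpa using this.symm
  rw [lintegral_countable', tsum_eq_zero_add' ENNReal.summable]
  simp only [h]
  rw [ENNReal.tsum_mul_left, h1]
  simp

/-! ### Expected sizes of balls -/

/-- The expected degree of a vertex. -/
noncomputable def rowSum (m : Sym2 V → ℝ≥0) (x : V) : ℝ≥0∞ :=
  ∑' y, open Classical in if y = x then 0 else (m s(x, y) : ℝ≥0∞)

/-- `N`-walks of length at most `k` that stay outside of `S` after the start. -/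
def WalkAvoiding (N : Sym2 V → ℕ) (S : Set V) : ℕ → V → V → Prop
  | 0, x, z => z = x
  | k + 1, x, z => z = x ∨ ∃ y, y ≠ x ∧ y ∉ S ∧ N s(x, y) ≠ 0 ∧ WalkAvoiding N S k y z

theorem WalkAvoiding.succ {N : Sym2 V → ℕ} {S : Set V} {k : ℕ} {x z : V}
    (h : WalkAvoiding N S k x z) : WalkAvoiding N S (k + 1) x z := by
  induction k generalizing x with
  | zero => exact Or.inl h
  | succ k ih =>
    rcases h with h | ⟨y, h1, h2, h3, h4⟩
    · exact Or.inl h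
    · exact Or.inr ⟨y, h1, h2, h3, ih h4⟩

theorem WalkAvoiding.tail {N : Sym2 V → ℕ} {k : ℕ} {x y z : V}
    (h : WalkAvoiding N ∅ k x y) (hyz : z ≠ y) (hN : N s(y, z) ≠ 0) :
    WalkAvoiding N ∅ (k + 1) x z := by
  induction k generalizing x with
  | zero =>
    obtain rfl : y = x := h
    exact Or.inr ⟨z, hyz, Set.notMem_empty _, hN, rfl⟩
  | succ k ih =>
    rcases h with rfl | ⟨w, h1, h2, h3, h4⟩
    · exact Or.inr ⟨z, hyz, Set.notMem_empty _, hN, Or.inl rfl⟩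
    · exact Or.inr ⟨w, h1, h2, h3, ih h4⟩

theorem walkAvoiding_of_within {o : V} {N : Sym2 V → ℕ} {k : ℕ} {x : V}
    (h : (graphOf o N).Within k x) : WalkAvoiding N ∅ k o x := by
  induction k generalizing x with
  | zero => exact h
  | succ k ih =>
    rcases h with h | ⟨u, hu, hux⟩
    · exact (ih h).succ
    · have hne : u ≠ x := by
        rintro rfl
        exact hux (mult_self _ _)
      rw [graphOf_mult_of_ne _ _ hne] at hux
      exact (ih hu).tail hne.symm hux

/-- Cut the walk at its last visit to `x`: it ends there, or it never visits `x`, or it leaves `x`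
for good through `y`. In the last case at least one step has been used, whence `k - 1`. -/
theorem WalkAvoiding.insert_or {N : Sym2 V → ℕ} {S : Set V} {k : ℕ} (x : V) {w z : V}
    (h : WalkAvoiding N S k w z) : z = x ∨ (w ≠ x ∧ WalkAvoiding N (insert x S) k w z) ∨
      ∃ y ∉ insert x S, N s(x, y) ≠ 0 ∧ WalkAvoiding N (insert x S) (k - 1) y z := by
  induction k generalizing w with
  | zero =>
    obtain rfl : z = w := h
    by_cases hz : z = x
    · exact Or.inl hz
    · exact Or.inr (Or.inl ⟨hz, rfl⟩)
  | succ k ih =>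
    rcases h with rfl | ⟨y, h1, h2, h3, h4⟩
    · by_cases hz : z = x
      · exact Or.inl hz
      · exact Or.inr (Or.inl ⟨hz, Or.inl rfl⟩)
    · rcases ih h4 with h | ⟨hyx, h⟩ | ⟨u, hu, hN, h⟩
      · exact Or.inl h
      · have hy : y ∉ insert x S := by simp [hyx, h2]
        by_cases hw : w = x
        · subst hw
          exact Or.inr (Or.inr ⟨y, hy, h3, h⟩)
        · exact Or.inr (Or.inl ⟨hw, Or.inr ⟨y, h1, hy, h3, h⟩⟩)
      · refine Or.inr (Or.inr ⟨u, hu, hN, ?_⟩)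
        cases k with
        | zero => exact h
        | succ k => exact h.succ

theorem WalkAvoiding.exists_step {N : Sym2 V → ℕ} {S : Set V} {k : ℕ} {x z : V}
    (h : WalkAvoiding N S (k + 1) x z) : z = x ∨
      ∃ y ∉ insert x S, N s(x, y) ≠ 0 ∧ WalkAvoiding N (insert x S) k y z := by
  rcases h.insert_or x with h | ⟨h, -⟩ | h
  · exact Or.inl h
  · exact absurd rfl h
  · exact Or.inr h

open Classical in
/-- The number of self-avoiding paths of length at most `k` from `x` outside of `S`. -/
noncomputable def pathCount : ℕ → Set V → V → (Sym2 V → ℕ) → ℝ≥0∞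
  | 0, _, _, _ => 1
  | k + 1, S, x, N => 1 + ∑' y, if y ∈ insert x S then 0 else
      (N s(x, y) : ℝ≥0∞) * pathCount k (insert x S) y N

open Classical in
-- By `WalkAvoiding.exists_step`, the first vertex never has to be revisited, so every vertex that
-- is reached is the end of a counted self-avoiding path.
theorem tsum_walkAvoiding_le (N : Sym2 V → ℕ) (k : ℕ) (S : Set V) (x : V) :
    ∑' z, (if WalkAvoiding N S k x z then (1 : ℝ≥0∞) else 0) ≤ pathCount k S x N := by
  induction k generalizing S x with
  | zero =>
    rw [tsum_eq_single x fun z (hz : ¬ WalkAvoiding N S 0 x z) => if_neg hz]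
    simp [WalkAvoiding, pathCount]
  | succ k ih =>
    calc _ ≤ ∑' z, ((if z = x then (1 : ℝ≥0∞) else 0) + ∑' y, if y ∈ insert x S then 0 else
          (N s(x, y) : ℝ≥0∞) * if WalkAvoiding N (insert x S) k y z then 1 else 0) := by
          refine ENNReal.tsum_le_tsum fun z => ?_
          split_ifs with h hz hz
          · exact le_self_add
          · obtain ⟨y, hy, hN, hw⟩ := h.exists_step.resolve_left hz
            rw [zero_add]
            refine le_trans ?_ (ENNReal.le_tsum y)
            rw [if_neg hy, if_pos hw, mul_one]
            exact_mod_cast Nat.one_le_iff_ne_zero.2 hN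
          · exact zero_le
          · exact zero_le
      _ = 1 + ∑' y, if y ∈ insert x S then 0 else (N s(x, y) : ℝ≥0∞) *
          ∑' z, if WalkAvoiding N (insert x S) k y z then 1 else 0 := by
          rw [ENNReal.tsum_add, tsum_ite_eq, ENNReal.tsum_comm]
          congr 1
          refine tsum_congr fun y => ?_
          split_ifs
          · simp
          · rw [ENNReal.tsum_mul_left]
      _ ≤ _ := by
          rw [pathCount]
          gcongr with y
          split_ifs
          · exact le_rfl
          · gcongr
            exact ih _ _

theorem measurable_pathCount [Countable V] (k : ℕ) (S : Set V) (x : V) :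
    Measurable (pathCount k S x) := by
  induction k generalizing S x with
  | zero => exact measurable_const
  | succ k ih =>
    classical
    have h : pathCount (k + 1) S x = fun N : Sym2 V → ℕ => 1 + ∑' y, if y ∈ insert x S then 0 else
      (N s(x, y) : ℝ≥0∞) * pathCount k (insert x S) y N := by
      funext N
      rw [pathCount]
    rw [h]
    refine Measurable.const_add (Measurable.tsum fun y => ?_) 1
    split_ifs
    · exact measurable_const
    · exact ((measurable_of_countable (fun n : ℕ => (n : ℝ≥0∞))).comp
        (measurable_pi_apply s(x, y))).mul (ih _ y)

/-- Paths that start outside of `S` and avoid `S` use no edge at a vertex of `S`. This gives the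
independence for which self-avoidance was introduced. -/
theorem pathCount_update [DecidableEq (Sym2 V)] {S : Set V} {w z x : V} (hw : w ∈ S) (hx : x ∉ S)
    (k : ℕ) (N : Sym2 V → ℕ) (a : ℕ) :
    pathCount k S x (Function.update N s(w, z) a) = pathCount k S x N := by
  induction k generalizing S x with
  | zero => rfl
  | succ k ih =>
    simp only [pathCount]
    congr 1
    refine tsum_congr fun y => ?_
    split_ifs with hy
    · rfl
    · rw [ih (Set.mem_insert_of_mem x hw) hy, Function.update_of_ne]
      intro h
      rw [Sym2.eq_iff] at h
      rcases h with ⟨h, -⟩ | ⟨-, h⟩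
      · exact hx (h ▸ hw)
      · exact hy (Set.mem_insert_of_mem _ (h ▸ hw))

/-- The first edge number is independent of the count of continuations, so each additional step
multiplies the expectation by at most `L`. -/
theorem lintegral_pathCount_le [Countable V] {m : Sym2 V → ℝ≥0} {L : ℝ≥0∞}
    (hm : ∀ x, rowSum m x ≤ L) (k : ℕ) {S : Set V} {x : V} :
    ∫⁻ N, pathCount k S x N ∂poissonLaw m ≤ ∑ i ∈ Finset.range (k + 1), L ^ i := by
  classical
  induction k generalizing S x with
  | zero => simp [pathCount]
  | succ k ih =>
    have hmeas (y : V) : Measurable fun N : Sym2 V → ℕ => if y ∈ insert x S then 0 else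
        (N s(x, y) : ℝ≥0∞) * pathCount k (insert x S) y N := by
      split_ifs
      · exact measurable_const
      · exact ((measurable_of_countable (fun n : ℕ => (n : ℝ≥0∞))).comp
          (measurable_pi_apply s(x, y))).mul (measurable_pathCount k _ y)
    simp only [pathCount]
    rw [lintegral_add_left measurable_const, lintegral_const, measure_univ, mul_one,
      lintegral_tsum fun y => (hmeas y).aemeasurable, Finset.sum_range_succ', pow_zero, add_comm]
    gcongr
    calc _ ≤ ∑' y, (if y = x then 0 else (m s(x, y) : ℝ≥0∞)) *
          ∑ i ∈ Finset.range (k + 1), L ^ i := by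
          refine ENNReal.tsum_le_tsum fun y => ?_
          by_cases hy : y ∈ insert x S
          · simp [hy]
          · have hyx : y ≠ x := fun h => hy (by simp [h])
            simp only [if_neg hy, if_neg hyx]
            rw [lintegral_infinitePi_mul_of_update_eq (fun e => poissonMeasure (m e)) s(x, y)
              (measurable_of_countable (fun n : ℕ => (n : ℝ≥0∞))) (measurable_pathCount k _ y)
              fun N a => pathCount_update (Set.mem_insert x S) hy k N a,
              lintegral_poissonMeasure]
            gcongr
            exact ih
      _ ≤ _ := by
          rw [ENNReal.tsum_mul_right, ← rowSum]
          refine (mul_le_mul_left (hm x) _).trans_eq ?_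
          rw [Finset.mul_sum]
          exact Finset.sum_congr rfl fun i _ => by rw [pow_succ, mul_comm]

open Classical in
theorem lintegral_ball_le [Countable V] {m : Sym2 V → ℝ≥0} {L : ℝ≥0∞}
    (hm : ∀ x, rowSum m x ≤ L) (r : ℕ) (o : V) :
    ∫⁻ N, ∑' x, (if (graphOf o N).Within r x then (1 : ℝ≥0∞) else 0) ∂poissonLaw m ≤
      ∑ i ∈ Finset.range (r + 1), L ^ i := by
  refine le_trans (lintegral_mono fun N => ?_) (lintegral_pathCount_le hm r (S := ∅) (x := o))
  refine le_trans (ENNReal.tsum_le_tsum fun x => ?_) (tsum_walkAvoiding_le N r ∅ o)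
  split_ifs with h1 h2 h2
  · exact le_rfl
  · exact absurd (walkAvoiding_of_within h1) h2
  · exact zero_le
  · exact le_rfl

/-- The means of the edge numbers after a splitting step. -/
noncomputable def splitMean (lam : ℝ≥0) (m : Sym2 V → ℝ≥0) : Sym2 (V × Bool) → ℝ≥0 :=
  Sym2.lift ⟨fun x y => open Classical in if x.1 = y.1 then lam / 2 else m s(x.1, y.1) / 4, by
    intro x y
    dsimp only
    by_cases h : x.1 = y.1
    · rw [if_pos h, if_pos h.symm]
    · rw [if_neg h, if_neg (Ne.symm h), Sym2.eq_swap]⟩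

theorem splitMean_of_ne (lam : ℝ≥0) (m : Sym2 V → ℝ≥0) {x y : V} (h : x ≠ y) (a b : Bool) :
    splitMean lam m s((x, a), (y, b)) = m s(x, y) / 4 :=
  if_neg h

theorem splitMean_self (lam : ℝ≥0) (m : Sym2 V → ℝ≥0) (x : V) (a b : Bool) :
    splitMean lam m s((x, a), (x, b)) = lam / 2 :=
  if_pos rfl

/-- The twin contributes `lam / 2`, and each other vertex has two copies with a quarter of the mean.
Thus `lam` is the fixed point, and the bound `rowSum ≤ lam` survives splitting. -/
theorem rowSum_splitMean (lam : ℝ≥0) (m : Sym2 V → ℝ≥0) (x : V × Bool) :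
    rowSum (splitMean lam m) x = lam / 2 + rowSum m x.1 / 2 := by
  classical
  obtain ⟨x, a⟩ := x
  have h4 : ((4 : ℝ≥0) : ℝ≥0∞) = 2 * 2 := by norm_num
  have key (y : V) : ∑ b : Bool, (if (y, b) = (x, a) then 0 else
      (splitMean lam m s((x, a), (y, b)) : ℝ≥0∞)) =
        (if y = x then (lam / 2 : ℝ≥0∞) else 0) + (if y = x then 0 else (m s(x, y) : ℝ≥0∞)) / 2 := by
    by_cases h : y = x
    · subst h
      cases a <;> simp [splitMean_self]
    · simp only [Prod.mk.injEq, h, false_and, if_false, splitMean_of_ne lam m (Ne.symm h),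
        Fintype.univ_bool, Finset.sum_const, zero_add]
      rw [Finset.card_pair (by simp), nsmul_eq_mul, ENNReal.coe_div (by norm_num), h4,
        ENNReal.div_eq_inv_mul, ENNReal.mul_inv (by norm_num) (by norm_num), ← mul_assoc,
        ← mul_assoc, Nat.cast_ofNat, ENNReal.mul_inv_cancel (by norm_num) (by norm_num), one_mul,
        ENNReal.div_eq_inv_mul]
  unfold rowSum
  rw [ENNReal.tsum_prod']
  simp_rw [tsum_fintype]
  calc _ = ∑' y, ((if y = x then (lam / 2 : ℝ≥0∞) else 0) +
        (if y = x then 0 else (m s(x, y) : ℝ≥0∞)) / 2) := by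
        refine tsum_congr fun y => ?_
        rw [← key y]
        refine Finset.sum_congr rfl fun b _ => ?_
        congr
    _ = _ := by
        rw [ENNReal.tsum_add, tsum_ite_eq]
        simp_rw [div_eq_mul_inv]
        rw [ENNReal.tsum_mul_right]

/-- The total ball weight is the expected ball size after `n` splittings, hence that of a Poisson
graph with expected degrees still at most `lam`. The bound does not depend on `n`. -/
theorem lintegral_tsum_ballWeight_le (lam : ℝ≥0) (r n : ℕ) {V : Type} [Countable V]
    {m : Sym2 V → ℝ≥0} (hm : ∀ x, rowSum m x ≤ lam) (o : V) :
    ∫⁻ N, ∑' x, ballWeight lam r n V (graphOf o N) x ∂poissonLaw m ≤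
      ∑ i ∈ Finset.range (r + 1), (lam : ℝ≥0∞) ^ i := by
  induction n generalizing V with
  | zero =>
    simp only [ballWeight]
    exact lintegral_ball_le hm r o
  | succ n ih =>
    have hF : Measurable fun H : RootedMultigraph (V × Bool) =>
        ∑' x, ballWeight lam r n (V × Bool) H x :=
      Measurable.tsum fun x => measurable_ballWeight lam r n _ x
    have hmeas (N : Sym2 V → ℕ) (x : V × Bool) : Measurable fun c =>
        ballWeight lam r n (V × Bool) ((graphOf o N).splitTuple c) x :=
      (measurable_ballWeight lam r n _ x).comp (measurable_splitTuple_right _)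
    have h1 (N : Sym2 V → ℕ) : ∑' x, ballWeight lam r (n + 1) V (graphOf o N) x =
        ∫⁻ c, ∑' x, ballWeight lam r n (V × Bool) ((graphOf o N).splitTuple c) x
          ∂splitChoicesLaw lam V := by
      rw [lintegral_tsum fun x => (hmeas N x).aemeasurable, ENNReal.tsum_prod']
      refine tsum_congr fun x => ?_
      rw [tsum_fintype, ballWeight]
    simp_rw [h1]
    rw [lintegral_split_poisson lam m (splitMean lam m)
      (fun x y h a b => splitMean_of_ne lam m h a b) (fun x => splitMean_self lam m x _ _) o hF]
    have hrow (x : V × Bool) : rowSum (splitMean lam m) x ≤ lam := by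
      rw [rowSum_splitMean]
      calc _ ≤ (lam : ℝ≥0∞) / 2 + lam / 2 := by gcongr; exact hm x.1
        _ = lam := ENNReal.add_halves _
    refine (lintegral_mono fun a => ih hrow (o, a)).trans ?_
    rw [lintegral_const, measure_univ, mul_one]

end RootedMultigraph

namespace RootedMultigraph

variable {V W : Type*}

/-! ### Invariant laws agree on local events -/

/-- Isolated vertices are added for all labels that are not in use. -/
def full (G : RootedMultigraph V) : RootedMultigraph V where
  verts := Set.univ
  root := G.root
  mult := G.mult
  root_mem := trivial
  mult_comm := G.mult_comm
  mult_self := G.mult_self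
  mem_of_mult_ne_zero _ _ _ := trivial

theorem full_cluster (G : RootedMultigraph V) : G.full.cluster = G.cluster := rfl

theorem isIsoMap_graphOf (g : V ≃ W) (o : V) (N : Sym2 W → ℕ) :
    IsIsoMap (graphOf o fun e => N (e.map g)) (graphOf (g o) N) g := by
  refine ⟨?_, rfl, fun x _ y _ => ?_⟩
  · exact Set.bijOn_univ.2 g.bijective
  · by_cases h : x = y
    · rw [h, mult_self, mult_self]
    · rw [graphOf_mult_of_ne _ _ h, graphOf_mult_of_ne _ _ (g.injective.ne h), Sym2.map_mk]

theorem isoClass_edgeless_cluster [Countable V] (o o' : V) :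
    isoClass (graphOf o 0).cluster = isoClass (graphOf o' 0).cluster := by
  classical
  refine isoClass_eq_iff.2 (Iso.cluster ?_)
  have := (isIsoMap_graphOf (Equiv.swap o o') o 0).iso
  rwa [Equiv.swap_apply_left] at this

theorem isSub_edgeless (G : RootedMultigraph V) : IsSub (graphOf G.root 0) G.full where
  verts_eq := rfl
  root_eq := rfl
  mult_le _ _ := (graphOf_mult_le _ _ _ _).trans (Nat.zero_le _)

theorem edgeless_reachable {o x : V} (h : (graphOf o 0).Reachable x) : x = o := by
  induction h with
  | refl => rfl
  | tail _ h _ => exact absurd (Nat.le_zero.1 (graphOf_mult_le _ _ _ _)) h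

theorem poissonMeasure_zero : poissonMeasure 0 = Measure.dirac 0 := by
  refine Measure.ext_of_singleton fun n => ?_
  rw [poissonMeasure_singleton, Measure.dirac_apply' _ (measurableSet_singleton n)]
  cases n <;> simp

/-- The edgeless graph is the Poisson graph with all means zero, whose law is a Dirac measure. -/
theorem ballWeight_edgeless_le (lam : ℝ≥0) (r n : ℕ) {V : Type} [Countable V] (o x : V) :
    ballWeight lam r n V (graphOf o 0) x ≤ ∑ i ∈ Finset.range (r + 1), (lam : ℝ≥0∞) ^ i := by
  have h := lintegral_tsum_ballWeight_le lam r n (V := V) (m := 0) (fun x => by simp [rowSum]) o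
  have h0 : poissonLaw (0 : Sym2 V → ℝ≥0) = Measure.dirac 0 := by
    simp only [poissonLaw, Pi.zero_apply, poissonMeasure_zero]
    exact Measure.infinitePi_dirac _
  have hm : Measurable fun N : Sym2 V → ℕ => ∑' x, ballWeight lam r n V (graphOf o N) x :=
    Measurable.tsum fun x =>
      (measurable_ballWeight lam r n V x).comp (measurable_graphOf_right o)
  rw [h0, lintegral_dirac' _ hm] at h
  exact (ENNReal.le_tsum x).trans h

theorem excess_edgeless (G : RootedMultigraph V) :
    excess G.full (graphOf G.root 0) G.root = G.rootDegree := by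
  refine tsum_congr fun y => ?_
  rw [Nat.le_zero.1 (graphOf_mult_le G.root 0 G.root y)]
  rfl

/-- Only the root contributes: no other vertex is reachable in the edgeless graph, so none of its
descendants is in a ball. -/
theorem damage_edgeless_le (lam : ℝ≥0) (r n : ℕ) {V : Type} [Countable V] (G : RootedMultigraph V) :
    damage lam r n G.full (graphOf G.root 0) ≤
      (1 / 2) ^ n * ((∑ i ∈ Finset.range (r + 1), (lam : ℝ≥0∞) ^ i) * G.rootDegree) := by
  unfold damage
  gcongr
  rw [tsum_eq_single G.root, excess_edgeless]
  · gcongr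
    exact ballWeight_edgeless_le lam r n _ _
  · intro x hx
    rw [ballWeight_eq_zero lam r n _ fun h => hx (edgeless_reachable h), zero_mul]

theorem measurable_rootDegree [Countable V] :
    Measurable (rootDegree : RootedMultigraph V → ℝ≥0∞) := by
  refine Measurable.tsum fun v => ?_
  -- The root is random; decompose according to its value.
  have h : (fun G : RootedMultigraph V => (G.mult G.root v : ℝ≥0∞)) =
      fun G => ∑' u, {G : RootedMultigraph V | G.root = u}.indicator
        (fun G => (G.mult u v : ℝ≥0∞)) G := by
    funext G
    rw [tsum_eq_single G.root]
    · simp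
    · intro u hu
      have hn : G ∉ {G : RootedMultigraph V | G.root = u} :=
        fun h => hu (show G.root = u from h).symm
      exact Set.indicator_of_notMem hn _
  rw [h]
  exact Measurable.tsum fun u => ((measurable_of_countable (fun n : ℕ => (n : ℝ≥0∞))).comp
    (measurable_mult u v)).indicator (measurableSet_root_eq u)

/-- The probability of `A` after `n` splitting steps that start from a single vertex. -/
noncomputable def splitProb (lam : ℝ≥0) (A : Set IsoClass) (n : ℕ) : ℝ≥0∞ :=
  (splitOp lam)^[n] (A.indicator 1) (isoClass (graphOf (0 : ℕ) 0).cluster)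

theorem IsInvariantLaw.lintegral_splitOp_iterate {lam : ℝ≥0} {L : Measure IsoClass}
    (hL : IsInvariantLaw lam L) {F : IsoClass → ℝ≥0∞} (hF : Measurable F) (n : ℕ) :
    ∫⁻ q, (splitOp lam)^[n] F q ∂L = ∫⁻ q, F q ∂L := by
  obtain ⟨μ, hμ, -, -, h1, h2⟩ := hL
  induction n with
  | zero => rfl
  | succ n ih =>
    rw [← ih, Function.iterate_succ_apply']
    have := lintegral_isoLaw_splitLaw lam (measurable_splitOp_iterate lam hF n) μ
    rw [h1, h2] at this
    exact this.symm

/-- By invariance, `L A` is the mean of the `n`-step probability started from a random `G`. The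
coupling compares `G` (with the unused labels as isolated vertices) with its bare root, and the
error is integrable since the expected root degree is finite. -/
theorem IsInvariantLaw.exists_bound {lam : ℝ≥0} {L : Measure IsoClass}
    (hL : IsInvariantLaw lam L) {r : ℕ} {A : Set IsoClass} (hA : MeasurableSet A)
    (hloc : IsLocal r A) : ∃ K : ℝ≥0∞, K ≠ ∞ ∧ ∀ n,
      L A ≤ splitProb lam A n + (1 / 2) ^ n * K ∧ splitProb lam A n ≤ L A + (1 / 2) ^ n * K := by
  have hF : Measurable (A.indicator (1 : IsoClass → ℝ≥0∞)) := measurable_one.indicator hA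
  have hL' := hL
  obtain ⟨μ, hμ, hconn, hdeg, h1, h2⟩ := hL
  set C : ℝ≥0∞ := ∑ i ∈ Finset.range (r + 1), (lam : ℝ≥0∞) ^ i with hC
  have hCtop : C ≠ ∞ := by
    rw [hC]
    exact ENNReal.sum_ne_top.2 fun i _ => ENNReal.pow_ne_top ENNReal.coe_ne_top
  refine ⟨C * ∫⁻ G, G.rootDegree ∂μ, ENNReal.mul_ne_top hCtop hdeg.ne, fun n => ?_⟩
  have hLA : L A = ∫⁻ G, (splitOp lam)^[n] (A.indicator 1) (isoClass G) ∂μ := by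
    rw [← lintegral_isoLaw (measurable_splitOp_iterate lam hF n), h1,
      hL'.lintegral_splitOp_iterate hF, lintegral_indicator_one hA]
  have hint : ∫⁻ G : RootedMultigraph ℕ, (1 / 2) ^ n * (C * G.rootDegree) ∂μ =
      (1 / 2) ^ n * (C * ∫⁻ G, G.rootDegree ∂μ) := by
    rw [lintegral_const_mul _ (measurable_rootDegree.const_mul C),
      lintegral_const_mul _ measurable_rootDegree]
  have key (G : RootedMultigraph ℕ) (hG : G.Connected) :
      (splitOp lam)^[n] (A.indicator 1) (isoClass G) ≤
          splitProb lam A n + (1 / 2) ^ n * (C * G.rootDegree) ∧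
        splitProb lam A n ≤ (splitOp lam)^[n] (A.indicator 1) (isoClass G) +
          (1 / 2) ^ n * (C * G.rootDegree) := by
    have h := splitOp_iterate_indicator_le lam hA hloc n (isSub_edgeless G)
    rw [full_cluster, hG.cluster_eq, isoClass_edgeless_cluster G.root 0] at h
    have hd := damage_edgeless_le lam r n G
    exact ⟨h.1.trans (by unfold splitProb; gcongr), h.2.trans (by gcongr)⟩
  constructor
  · rw [hLA, ← hint]
    refine (lintegral_mono_ae (hconn.mono fun G hG => (key G hG).1)).trans ?_
    rw [lintegral_add_left measurable_const, lintegral_const, measure_univ, mul_one]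
  · calc splitProb lam A n = ∫⁻ _, splitProb lam A n ∂μ := by simp
      _ ≤ _ := lintegral_mono_ae (hconn.mono fun G hG => (key G hG).2)
      _ = _ := by
        have hm : Measurable fun G : RootedMultigraph ℕ =>
            (splitOp lam)^[n] (A.indicator 1) (isoClass G) :=
          (measurable_splitOp_iterate lam hF n).comp measurable_isoClass
        rw [lintegral_add_left hm, hint, hLA]

/-- Both probabilities are within a multiple of `(1 / 2) ^ n` of the same number `splitProb lam A
n`; let `n` tend to infinity. -/
theorem IsInvariantLaw.le_of_isLocal {lam : ℝ≥0} {L L' : Measure IsoClass}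
    (hL : IsInvariantLaw lam L) (hL' : IsInvariantLaw lam L') {r : ℕ} {A : Set IsoClass}
    (hA : MeasurableSet A) (hloc : IsLocal r A) : L A ≤ L' A := by
  obtain ⟨K, hK, h⟩ := hL.exists_bound hA hloc
  obtain ⟨K', hK', h'⟩ := hL'.exists_bound hA hloc
  have hlim : Filter.Tendsto (fun n : ℕ => L' A + (1 / 2 : ℝ≥0∞) ^ n * (K' + K)) Filter.atTop
      (nhds (L' A + 0 * (K' + K))) := by
    refine Filter.Tendsto.const_add _ (ENNReal.Tendsto.mul_const
      (ENNReal.tendsto_pow_atTop_nhds_zero_of_lt_one ?_) (Or.inr (ENNReal.add_ne_top.2 ⟨hK', hK⟩)))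
    rw [one_div]
    exact ENNReal.inv_lt_one.2 (by norm_num)
  rw [zero_mul, add_zero] at hlim
  refine ge_of_tendsto' hlim fun n => (h n).1.trans ?_
  rw [mul_add, ← add_assoc]
  gcongr
  exact (h' n).2

theorem IsInvariantLaw.eq_of_isLocal {lam : ℝ≥0} {L L' : Measure IsoClass}
    (hL : IsInvariantLaw lam L) (hL' : IsInvariantLaw lam L') {r : ℕ} {A : Set IsoClass}
    (hA : MeasurableSet A) (hloc : IsLocal r A) : L A = L' A :=
  le_antisymm (hL.le_of_isLocal hL' hA hloc) (hL'.le_of_isLocal hL hA hloc)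

end RootedMultigraph

namespace RootedMultigraph

variable {V W : Type*}

/-! ### Patterns of balls -/

/-- The ball of radius `r` is isomorphic to the multigraph on `Fin (n + 1)`, rooted at `0`, with edge
multiplicities `a`. -/
def HasPattern (G : RootedMultigraph V) (r n : ℕ) (a : Fin (n + 1) → Fin (n + 1) → ℕ) : Prop :=
  ∃ φ : Fin (n + 1) → V, Function.Injective φ ∧ φ 0 = G.root ∧
    (∀ v, G.Within r v ↔ ∃ i, φ i = v) ∧ ∀ i j, G.mult (φ i) (φ j) = a i j

theorem IsIsoMap.hasPattern {G : RootedMultigraph V} {H : RootedMultigraph W} {ψ : V → W}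
    (h : IsIsoMap G H ψ) {r n : ℕ} {a : Fin (n + 1) → Fin (n + 1) → ℕ}
    (hG : G.HasPattern r n a) : H.HasPattern r n a := by
  obtain ⟨φ, h1, h2, h3, h4⟩ := hG
  have hv (i : Fin (n + 1)) : φ i ∈ G.verts := ((h3 (φ i)).2 ⟨i, rfl⟩).mem_verts
  refine ⟨ψ ∘ φ, fun i j hij => h1 (h.1.injOn (hv i) (hv j) hij), ?_, fun w => ?_, fun i j => ?_⟩
  · rw [Function.comp_apply, h2, h.2.1]
  · constructor
    · intro hw
      obtain ⟨v, hv, rfl⟩ := h.exists_within hw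
      obtain ⟨i, rfl⟩ := (h3 v).1 hv
      exact ⟨i, rfl⟩
    · rintro ⟨i, rfl⟩
      exact h.within ((h3 (φ i)).2 ⟨i, rfl⟩)
  · rw [← h4 i j]
    exact h.2.2 _ (hv i) _ (hv j)

theorem Iso.hasPattern_iff {G : RootedMultigraph V} {H : RootedMultigraph W} (h : Iso G H) (r n : ℕ)
    (a : Fin (n + 1) → Fin (n + 1) → ℕ) : G.HasPattern r n a ↔ H.HasPattern r n a :=
  ⟨fun hG => h.exists_isIsoMap.choose_spec.hasPattern hG,
    fun hH => h.symm.exists_isIsoMap.choose_spec.hasPattern hH⟩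

theorem hasPattern_congr {G H : RootedMultigraph V} {r : ℕ} (hroot : G.root = H.root)
    (hw : ∀ v, G.Within r v ↔ H.Within r v)
    (hm : ∀ u v, H.Within r u → G.mult u v = H.mult u v) (n : ℕ)
    (a : Fin (n + 1) → Fin (n + 1) → ℕ) : G.HasPattern r n a ↔ H.HasPattern r n a := by
  unfold HasPattern
  simp only [hroot, hw]
  refine exists_congr fun φ => and_congr_right fun _ => and_congr_right fun _ =>
    and_congr_right fun h3 => forall_congr' fun i => forall_congr' fun j => ?_
  rw [hm _ _ ((h3 (φ i)).2 ⟨i, rfl⟩)]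

theorem cluster_hasPattern_iff (G : RootedMultigraph V) (r n : ℕ)
    (a : Fin (n + 1) → Fin (n + 1) → ℕ) : G.cluster.HasPattern r n a ↔ G.HasPattern r n a :=
  hasPattern_congr (G := G.cluster) (H := G) rfl (cluster_within G r)
    (fun _ v hu => cluster_mult_of_reachable hu.reachable v) n a

theorem within_congr {G H : RootedMultigraph V} {r : ℕ} (hroot : G.root = H.root)
    (hm : ∀ u v, H.Within r u → G.mult u v = H.mult u v) {s : ℕ} (hs : s ≤ r) (v : V) :
    G.Within s v ↔ H.Within s v := by
  induction s generalizing v with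
  | zero => simp only [Within, hroot]
  | succ s ih =>
    have ih' := ih (by omega)
    simp only [Within, ih']
    refine or_congr Iff.rfl (exists_congr fun u => and_congr_right fun hu => ?_)
    rw [hm u v (hu.mono (by omega))]

theorem IsSub.mult_eq_of_excess {G H : RootedMultigraph V} (h : IsSub H G) {x : V}
    (hx : excess G H x = 0) (y : V) : G.mult x y = H.mult x y := by
  have := ENNReal.tsum_eq_zero.1 hx y
  rw [Nat.cast_eq_zero] at this
  have := h.mult_le x y
  omega

/-- The event that the ball of radius `r` has a given pattern. -/
def patternEvent (r : ℕ) (p : Σ n : ℕ, (Fin (n + 1) → Fin (n + 1) → ℕ)) : Set IsoClass :=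
  {q | (Quotient.out (s := isoSetoid ℕ) q).HasPattern r p.1 p.2}

theorem isoClass_mem_patternEvent [Countable V] (G : RootedMultigraph V) (r : ℕ)
    (p : Σ n : ℕ, (Fin (n + 1) → Fin (n + 1) → ℕ)) :
    isoClass G ∈ patternEvent r p ↔ G.HasPattern r p.1 p.2 := by
  refine Iso.hasPattern_iff ?_ r p.1 p.2
  rw [← isoClass_eq_iff, isoClass_nat]
  exact Quotient.out_eq (s := isoSetoid ℕ) _

theorem measurableSet_hasPattern [Countable V] (r n : ℕ) (a : Fin (n + 1) → Fin (n + 1) → ℕ) :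
    MeasurableSet {G : RootedMultigraph V | G.HasPattern r n a} := by
  have h : {G : RootedMultigraph V | G.HasPattern r n a} =
      ⋃ φ : Fin (n + 1) → V, ⋃ _ : Function.Injective φ, {G | G.root = φ 0} ∩
        ((⋂ v, ({G | G.Within r v} ∩ {_G | ∃ i, φ i = v}) ∪
          ({G | G.Within r v}ᶜ ∩ {_G | ¬ ∃ i, φ i = v})) ∩
        ⋂ i, ⋂ j, {G | G.mult (φ i) (φ j) = a i j}) := by
    ext G
    simp only [HasPattern, Set.mem_ofPred_eq, Set.mem_iUnion, Set.mem_inter_iff, Set.mem_iInter,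
      Set.mem_union, Set.mem_compl_iff, exists_prop, ← iff_iff_and_or_not_and_not, eq_comm]
  rw [h]
  refine MeasurableSet.iUnion fun φ => MeasurableSet.iUnion fun _ =>
    (measurableSet_root_eq _).inter (MeasurableSet.inter (MeasurableSet.iInter fun v => ?_)
      (MeasurableSet.iInter fun i => MeasurableSet.iInter fun j =>
        measurableSet_eq_fun (measurable_mult _ _) measurable_const))
  exact ((measurableSet_within r v).inter (MeasurableSet.const _)).union
    ((measurableSet_within r v).compl.inter (MeasurableSet.const _))

theorem measurableSet_patternEvent (r : ℕ) (p : Σ n : ℕ, (Fin (n + 1) → Fin (n + 1) → ℕ)) :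
    MeasurableSet (patternEvent r p) := by
  change MeasurableSet (Quotient.mk (isoSetoid ℕ) ⁻¹' patternEvent r p)
  convert! measurableSet_hasPattern (V := ℕ) r p.1 p.2
  ext G
  rw [Set.mem_ofPred_eq, ← isoClass_mem_patternEvent, isoClass_nat]
  rfl

theorem isLocal_patternEvent (r : ℕ) (p : Σ n : ℕ, (Fin (n + 1) → Fin (n + 1) → ℕ)) :
    IsLocal r (patternEvent r p) := by
  intro V _ G H h hx
  have hm : ∀ u v, H.Within r u → G.mult u v = H.mult u v := fun u v hu =>
    h.mult_eq_of_excess (hx u hu) v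
  rw [isoClass_mem_patternEvent, isoClass_mem_patternEvent, cluster_hasPattern_iff,
    cluster_hasPattern_iff]
  exact hasPattern_congr h.root_eq.symm (within_congr h.root_eq.symm hm le_rfl) hm _ _

theorem IsLocal.mono {r s : ℕ} (hrs : r ≤ s) {A : Set IsoClass} (hA : IsLocal r A) : IsLocal s A :=
  fun V _ G H h hx => hA V G H h fun x hw => hx x (hw.mono hrs)

theorem IsLocal.inter {r : ℕ} {A B : Set IsoClass} (hA : IsLocal r A) (hB : IsLocal r B) :
    IsLocal r (A ∩ B) :=
  fun V _ G H h hx => and_congr (hA V G H h hx) (hB V G H h hx)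

theorem isLocal_iUnion {ι : Type*} {r : ℕ} {A : ι → Set IsoClass} (hA : ∀ i, IsLocal r (A i)) :
    IsLocal r (⋃ i, A i) := by
  intro V _ G H h hx
  simp only [Set.mem_iUnion]
  exact exists_congr fun i => hA i V G H h hx

theorem exists_hasPattern_of_finite {G : RootedMultigraph V} {r : ℕ}
    (h : {v | G.Within r v}.Finite) :
    ∃ p : Σ n : ℕ, (Fin (n + 1) → Fin (n + 1) → ℕ), G.HasPattern r p.1 p.2 := by
  classical
  have := h.fintype
  have hroot : G.Within r G.root := Within.mono (Nat.zero_le r) (show G.Within 0 G.root from rfl)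
  obtain ⟨n, hn⟩ : ∃ n, Fintype.card {v | G.Within r v} = n + 1 :=
    Nat.exists_eq_succ_of_ne_zero (Fintype.card_pos_iff.2 ⟨⟨G.root, hroot⟩⟩).ne'
  let e : Fin (n + 1) ≃ {v | G.Within r v} := (Fintype.equivFinOfCardEq hn).symm
  -- The swap moves the root to the index 0.
  let f : Fin (n + 1) ≃ {v | G.Within r v} := (Equiv.swap 0 (e.symm ⟨G.root, hroot⟩)).trans e
  refine ⟨⟨n, fun i j => G.mult (f i) (f j)⟩, fun i => f i, ?_, ?_, fun v => ?_, fun _ _ => rfl⟩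
  · exact Subtype.val_injective.comp f.injective
  · simp [f]
  · constructor
    · intro hv
      exact ⟨f.symm ⟨v, hv⟩, by simp⟩
    · rintro ⟨i, rfl⟩
      exact (f i).2

theorem HasPattern.finite {G : RootedMultigraph V} {r n : ℕ} {a : Fin (n + 1) → Fin (n + 1) → ℕ}
    (h : G.HasPattern r n a) : {v | G.Within r v}.Finite := by
  obtain ⟨φ, -, -, h3, -⟩ := h
  have : {v | G.Within r v} = Set.range φ := Set.ext fun v => h3 v
  rw [this]
  exact Set.finite_range φ

/-! ### Balls determine locally finite connected multigraphs -/

/-- The ball of radius `r` around the root. -/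
noncomputable def ball (G : RootedMultigraph V) (r : ℕ) : RootedMultigraph V where
  verts := {v | G.Within r v}
  root := G.root
  mult u v := open Classical in if G.Within r u ∧ G.Within r v then G.mult u v else 0
  root_mem := Within.mono (Nat.zero_le r) (show G.Within 0 G.root from rfl)
  mult_comm u v := by
    by_cases h : G.Within r u ∧ G.Within r v
    · rw [if_pos h, if_pos h.symm, G.mult_comm]
    · rw [if_neg h, if_neg fun h' => h h'.symm]
  mult_self v := by simp [G.mult_self v]
  mem_of_mult_ne_zero u v h := by
    by_contra hu
    exact h (if_neg fun h' => hu h'.1)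

theorem ball_mult {G : RootedMultigraph V} {r : ℕ} {u v : V} (hu : G.Within r u)
    (hv : G.Within r v) : (G.ball r).mult u v = G.mult u v :=
  if_pos ⟨hu, hv⟩

theorem ball_within {G : RootedMultigraph V} {r s : ℕ} (hs : s ≤ r) (v : V) :
    (G.ball r).Within s v ↔ G.Within s v := by
  induction s generalizing v with
  | zero => rfl
  | succ s ih =>
    have ih' := ih (by omega)
    simp only [Within, ih']
    refine or_congr Iff.rfl (exists_congr fun u => and_congr_right fun hu => ?_)
    constructor
    · intro h h0
      apply h
      simp [ball, h0]
    · intro h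
      have hv : G.Within (s + 1) v := Or.inr ⟨u, hu, h⟩
      rwa [ball_mult (hu.mono (by omega)) (hv.mono hs)]

theorem HasPattern.exists_isIsoMap_ball {G : RootedMultigraph V} {H : RootedMultigraph W} {r n : ℕ}
    {a : Fin (n + 1) → Fin (n + 1) → ℕ} (hG : G.HasPattern r n a) (hH : H.HasPattern r n a) :
    ∃ ψ, IsIsoMap (G.ball r) (H.ball r) ψ := by
  obtain ⟨φ, h1, h2, h3, h4⟩ := hG
  obtain ⟨φ', h1', h2', h3', h4'⟩ := hH
  have hinv (i : Fin (n + 1)) : Function.invFun φ (φ i) = i := Function.leftInverse_invFun h1 i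
  have hG (i : Fin (n + 1)) : G.Within r (φ i) := (h3 _).2 ⟨i, rfl⟩
  have hH (i : Fin (n + 1)) : H.Within r (φ' i) := (h3' _).2 ⟨i, rfl⟩
  refine ⟨fun v => φ' (Function.invFun φ v), ⟨?_, ?_, ?_⟩, ?_, ?_⟩
  · intro v hv
    exact hH _
  · intro u hu v hv huv
    obtain ⟨i, rfl⟩ := (h3 u).1 hu
    obtain ⟨j, rfl⟩ := (h3 v).1 hv
    have := h1' huv
    rw [hinv, hinv] at this
    rw [this]
  · intro w hw
    obtain ⟨i, rfl⟩ := (h3' w).1 hw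
    exact ⟨φ i, hG i, congrArg φ' (hinv i)⟩
  · change φ' (Function.invFun φ G.root) = H.root
    rw [← h2, hinv, h2']
  · intro u hu v hv
    obtain ⟨i, rfl⟩ := (h3 u).1 hu
    obtain ⟨j, rfl⟩ := (h3 v).1 hv
    simp only [hinv]
    rw [ball_mult (hG i) (hG j), ball_mult (hH i) (hH j), h4, h4']

theorem IsIsoMap.ball_within_iff {G : RootedMultigraph V} {H : RootedMultigraph W} {r : ℕ}
    {ψ : V → W} (h : IsIsoMap (G.ball r) (H.ball r) ψ) {s : ℕ} (hs : s ≤ r) {v : V}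
    (hv : G.Within r v) : H.Within s (ψ v) ↔ G.Within s v := by
  rw [← ball_within hs, ← ball_within hs (G := G), h.within_iff hv]

theorem IsIsoMap.ball_mono {G : RootedMultigraph V} {H : RootedMultigraph W} {r s : ℕ}
    {ψ : V → W} (h : IsIsoMap (G.ball r) (H.ball r) ψ) (hs : s ≤ r) :
    IsIsoMap (G.ball s) (H.ball s) ψ := by
  refine ⟨⟨?_, ?_, ?_⟩, h.2.1, ?_⟩
  · intro v (hv : G.Within s v)
    exact (h.ball_within_iff hs (hv.mono hs)).2 hv
  · intro u (hu : G.Within s u) v (hv : G.Within s v) huv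
    exact h.1.injOn (hu.mono hs) (hv.mono hs) huv
  · intro w (hw : H.Within s w)
    obtain ⟨v, hv, rfl⟩ := h.1.surjOn (show w ∈ (H.ball r).verts from hw.mono hs)
    exact ⟨v, (h.ball_within_iff hs hv).1 hw, rfl⟩
  · intro u (hu : G.Within s u) v (hv : G.Within s v)
    have h1 := h.2.2 u (hu.mono hs) v (hv.mono hs)
    rw [ball_mult (hu.mono hs) (hv.mono hs), ball_mult
      ((h.ball_within_iff hs (hu.mono hs)).2 hu |>.mono hs)
      ((h.ball_within_iff hs (hv.mono hs)).2 hv |>.mono hs)] at h1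
    rw [ball_mult hu hv, ball_mult ((h.ball_within_iff hs (hu.mono hs)).2 hu)
      ((h.ball_within_iff hs (hv.mono hs)).2 hv), h1]

theorem IsIsoMap.congr {G : RootedMultigraph V} {H : RootedMultigraph W} {ψ ψ' : V → W}
    (h : IsIsoMap G H ψ) (he : Set.EqOn ψ ψ' G.verts) : IsIsoMap G H ψ' :=
  ⟨h.1.congr he, (he G.root_mem).symm.trans h.2.1, fun u hu v hv => by
    rw [← he hu, ← he hv, h.2.2 u hu v hv]⟩

/-- In a product of discrete spaces, a condition on finitely many coordinates defines a closed set.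
-/
theorem isClosed_of_eqOn_finite [TopologicalSpace W] [DiscreteTopology W] {B : Set V}
    (hB : B.Finite) {P : (V → W) → Prop} (h : ∀ ψ ψ', Set.EqOn ψ ψ' B → P ψ → P ψ') :
    IsClosed {ψ | P ψ} := by
  rw [← isOpen_compl_iff, isOpen_iff_forall_mem_open]
  intro ψ hψ
  refine ⟨Set.pi B fun v => {ψ v}, fun ψ' hψ' hP => hψ (h ψ' ψ (fun v hv => hψ' v hv) hP),
    isOpen_set_pi hB fun v _ => isOpen_discrete _, fun v _ => rfl⟩

/-- Isomorphisms of balls of different radii need not be compatible. Compactness provides a single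
map that restricts to an isomorphism on every ball. -/
theorem iso_of_forall_ball {G : RootedMultigraph V} {H : RootedMultigraph W}
    (hG : G.Connected) (hH : H.Connected) (hGfin : ∀ r, {v | G.Within r v}.Finite)
    (hHfin : ∀ r, {v | H.Within r v}.Finite)
    (h : ∀ r, ∃ ψ, IsIsoMap (G.ball r) (H.ball r) ψ) : Iso G H := by
  classical
  let _ : TopologicalSpace W := ⊥
  have _ : DiscreteTopology W := ⟨rfl⟩
  -- The admissible images of `v`: finitely many, since `v` may not move farther from the root and
  -- unreachable labels must go to the root. Hence the product of the sets `K v` is compact.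
  let K : V → Set W := fun v => {w | (∀ s, G.Within s v → H.Within s w) ∧
    (G.Reachable v ∨ w = H.root)}
  have hKfin (v : V) : (K v).Finite := by
    by_cases hv : G.Reachable v
    · obtain ⟨s, hs⟩ := reachable_iff_exists_within.1 hv
      exact (hHfin s).subset fun w hw => hw.1 s hs
    · exact (Set.finite_singleton H.root).subset fun w hw => hw.2.resolve_left hv
  let T : ℕ → Set (V → W) := fun r => Set.pi Set.univ K ∩ {ψ | IsIsoMap (G.ball r) (H.ball r) ψ}
  have hTcl (r : ℕ) : IsClosed (T r) :=
    (isClosed_set_pi fun v _ => isClosed_discrete _).inter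
      (isClosed_of_eqOn_finite (hGfin r) fun ψ ψ' he hψ => hψ.congr he)
  have hne : (⋂ r, T r).Nonempty := by
    refine IsCompact.nonempty_iInter_of_sequence_nonempty_isCompact_isClosed T
      (fun r ψ hψ => ⟨hψ.1, IsIsoMap.ball_mono hψ.2 (Nat.le_succ r)⟩) (fun r => ?_) ?_ hTcl
    · obtain ⟨ψ, hψ⟩ := h r
      -- Outside the ball of radius `r` the map is sent to the root of `H`, which is admissible for
      -- every `v`.
      refine ⟨fun v => if G.Within r v then ψ v else H.root, fun v _ => ⟨fun s hs => ?_, ?_⟩,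
        hψ.congr fun v hv => (if_pos hv).symm⟩
      · by_cases hv : G.Within r v
        · simp only [if_pos hv]
          by_cases hsr : s ≤ r
          · exact (hψ.ball_within_iff hsr hv).2 hs
          · exact ((hψ.ball_within_iff le_rfl hv).2 hv).mono (by omega)
        · simp only [if_neg hv]
          exact Within.mono (Nat.zero_le s) (show H.Within 0 H.root from rfl)
      · by_cases hv : G.Within r v
        · exact Or.inl hv.reachable
        · exact Or.inr (if_neg hv)
    · exact (isCompact_univ_pi fun v => (hKfin v).isCompact).of_isClosed_subset (hTcl 0)
        Set.inter_subset_left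
  obtain ⟨ψ, hψ⟩ := hne
  have hψ' (r : ℕ) : IsIsoMap (G.ball r) (H.ball r) ψ := (Set.mem_iInter.1 hψ r).2
  have hex (v : V) (hv : v ∈ G.verts) : ∃ r, G.Within r v :=
    reachable_iff_exists_within.1 (hG v hv)
  have hpair (u v : V) (hu : u ∈ G.verts) (hv : v ∈ G.verts) :
      ∃ r, G.Within r u ∧ G.Within r v := by
    obtain ⟨r, hr⟩ := hex u hu
    obtain ⟨s, hs⟩ := hex v hv
    exact ⟨max r s, hr.mono (le_max_left _ _), hs.mono (le_max_right _ _)⟩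
  refine IsIsoMap.iso (φ := ψ) ⟨⟨?_, ?_, ?_⟩, (hψ' 0).2.1, ?_⟩
  · intro v hv
    obtain ⟨r, hr⟩ := hex v hv
    exact Within.mem_verts ((hψ' r).1.mapsTo hr)
  · intro u hu v hv huv
    obtain ⟨r, hru, hrv⟩ := hpair u v hu hv
    exact (hψ' r).1.injOn hru hrv huv
  · intro w hw
    obtain ⟨r, hr⟩ := reachable_iff_exists_within.1 (hH w hw)
    obtain ⟨v, hv, rfl⟩ := (hψ' r).1.surjOn hr
    exact ⟨v, Within.mem_verts hv, rfl⟩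
  · intro u hu v hv
    obtain ⟨r, hru, hrv⟩ := hpair u v hu hv
    have := (hψ' r).2.2 u hru v hrv
    rwa [ball_mult hru hrv, ball_mult ((hψ' r).1.mapsTo hru) ((hψ' r).1.mapsTo hrv)] at this

end RootedMultigraph

namespace RootedMultigraph

variable {V W : Type*}

/-! ### Laws are determined by their values on local events -/

/-- The isomorphism classes with the sigma-algebra that is generated by the patterns of balls. -/
def LocalClass : Type := IsoClass

/-- The sigma-algebra generated by the patterns of balls. -/
instance instMeasurableSpaceLocalClass : MeasurableSpace LocalClass :=
  MeasurableSpace.generateFrom {A : Set IsoClass | ∃ r p, patternEvent r p = A}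

theorem measurableSet_of_localClass {A : Set LocalClass} (hA : MeasurableSet A) :
    MeasurableSet (show Set IsoClass from A) := by
  have h : instMeasurableSpaceLocalClass ≤ instMeasurableSpaceIsoClass := by
    refine MeasurableSpace.generateFrom_le ?_
    rintro _ ⟨r, p, rfl⟩
    exact measurableSet_patternEvent r p
  exact h A hA

/-- A finite intersection of pattern events is local with respect to the largest radius involved. -/
theorem exists_isLocal_of_generatePiSystem {A : Set IsoClass}
    (hA : generatePiSystem {A : Set IsoClass | ∃ r p, patternEvent r p = A} A) :
    MeasurableSet A ∧ ∃ r, IsLocal r A := by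
  induction hA with
  | base h =>
    obtain ⟨r, p, rfl⟩ := h
    exact ⟨measurableSet_patternEvent r p, r, isLocal_patternEvent r p⟩
  | inter _ _ _ h1 h2 =>
    obtain ⟨m1, r1, l1⟩ := h1
    obtain ⟨m2, r2, l2⟩ := h2
    exact ⟨m1.inter m2, max r1 r2,
      (l1.mono (le_max_left _ _)).inter (l2.mono (le_max_right _ _))⟩

/-- Dynkin's lemma: the generating pi-system consists of local events. -/
theorem measure_localClass_eq {L L' : Measure IsoClass} [IsProbabilityMeasure L]
    [IsProbabilityMeasure L'] (h : ∀ r A, MeasurableSet A → IsLocal r A → L A = L' A)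
    {A : Set LocalClass} (hA : MeasurableSet A) :
    L (show Set IsoClass from A) = L' (show Set IsoClass from A) := by
  refine MeasurableSpace.induction_on_inter (m := instMeasurableSpaceLocalClass)
    (C := fun A _ => L (show Set IsoClass from A) = L' (show Set IsoClass from A))
    (generateFrom_generatePiSystem_eq
      (g := {A : Set IsoClass | ∃ r p, patternEvent r p = A})).symm
    (isPiSystem_generatePiSystem _) ?_ ?_ ?_ ?_ A hA
  · exact (measure_empty (μ := L)).trans (measure_empty (μ := L')).symm
  · intro t ht
    obtain ⟨hm, r, hr⟩ := exists_isLocal_of_generatePiSystem ht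
    exact h r t hm hr
  · intro t ht ih
    have hm := measurableSet_of_localClass ht
    exact (prob_compl_eq_one_sub (μ := L) hm).trans
      ((congrArg (1 - ·) ih).trans (prob_compl_eq_one_sub (μ := L') hm).symm)
  · intro f hd hf ih
    have h1 := measure_iUnion (μ := L) hd fun i => measurableSet_of_localClass (hf i)
    have h2 := measure_iUnion (μ := L') hd fun i => measurableSet_of_localClass (hf i)
    exact h1.trans ((tsum_congr ih).trans h2.symm)

/-- A labelled multigraph from arbitrary data. -/
def ofData (y : ℕ × (ℕ → Prop) × (ℕ → ℕ → ℕ)) : RootedMultigraph ℕ where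
  verts := {v | y.2.1 v ∨ v = y.1 ∨ ∃ w, v ≠ w ∧ y.2.2 (min v w) (max v w) ≠ 0}
  root := y.1
  mult u v := if u = v then 0 else y.2.2 (min u v) (max u v)
  root_mem := Or.inr (Or.inl rfl)
  mult_comm u v := by simp only [@eq_comm _ u v, min_comm, max_comm]
  mult_self v := if_pos rfl
  mem_of_mult_ne_zero u v h := by
    by_cases huv : u = v
    · exact absurd (if_pos huv) h
    · rw [if_neg huv] at h
      exact Or.inr (Or.inr ⟨v, huv, h⟩)

/-- A multigraph serves as its own data. Thus labelled multigraphs are parametrized by a standard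
Borel space, and no such structure on `RootedMultigraph ℕ` itself has to be established. -/
theorem ofData_surjective : Function.Surjective ofData := by
  intro G
  have hm (u v : ℕ) : G.mult (min u v) (max u v) = G.mult u v := by
    rcases le_total u v with h | h
    · rw [min_eq_left h, max_eq_right h]
    · rw [min_eq_right h, max_eq_left h, G.mult_comm]
  refine ⟨(G.root, (· ∈ G.verts), G.mult), ext ?_ rfl fun u v => ?_⟩
  · ext v
    constructor
    · rintro (h | rfl | ⟨w, -, h⟩)
      · exact h
      · exact G.root_mem
      · exact G.mem_of_mult_ne_zero v w ((hm v w) ▸ h)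
    · exact Or.inl
  · by_cases huv : u = v
    · rw [huv, mult_self, mult_self]
    · exact (if_neg huv).trans (hm u v)

theorem measurable_ofData : Measurable ofData := by
  have hm (u v : ℕ) : Measurable fun y : ℕ × (ℕ → Prop) × (ℕ → ℕ → ℕ) => y.2.2 u v := by fun_prop
  refine measurable_of_coordinates (fun v => ?_) (fun v => ?_) fun u v => ?_
  · exact measurable_fst (measurableSet_singleton v)
  · have h1 : MeasurableSet {y : ℕ × (ℕ → Prop) × (ℕ → ℕ → ℕ) | y.2.1 v} :=
      measurableSet_setOfPred.2 (by fun_prop)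
    have h2 : MeasurableSet {y : ℕ × (ℕ → Prop) × (ℕ → ℕ → ℕ) | v = y.1} :=
      measurableSet_eq_fun measurable_const measurable_fst
    have h3 : MeasurableSet {y : ℕ × (ℕ → Prop) × (ℕ → ℕ → ℕ) |
        ∃ w, v ≠ w ∧ y.2.2 (min v w) (max v w) ≠ 0} := by
      simp only [Set.ofPred_exists]
      exact MeasurableSet.iUnion fun w => (MeasurableSet.const _).inter
        (measurableSet_eq_fun (hm _ _) measurable_const).compl
    exact h1.union (h2.union h3)
  · exact Measurable.ite (MeasurableSet.const _) measurable_const (hm _ _)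

/-- The data of multigraphs in which all balls are finite. -/
def finiteBallData : Set (ℕ × (ℕ → Prop) × (ℕ → ℕ → ℕ)) :=
  {y | ∀ r, ∃ p : Σ n : ℕ, (Fin (n + 1) → Fin (n + 1) → ℕ), (ofData y).HasPattern r p.1 p.2}

theorem measurableSet_finiteBallData : MeasurableSet finiteBallData := by
  have : finiteBallData = ⋂ r, ⋃ p : Σ n : ℕ, (Fin (n + 1) → Fin (n + 1) → ℕ),
      ofData ⁻¹' {G | G.HasPattern r p.1 p.2} := by
    ext y
    simp [finiteBallData]
  rw [this]
  exact MeasurableSet.iInter fun r => MeasurableSet.iUnion fun p =>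
    measurable_ofData (measurableSet_hasPattern r p.1 p.2)

/-- The class of the cluster of the multigraph with given data. -/
noncomputable def classOfData (y : finiteBallData) : LocalClass := isoClass (ofData y).cluster

theorem measurable_classOfData' :
    Measurable fun y : finiteBallData => isoClass (ofData y).cluster :=
  measurable_isoClass.comp (measurable_cluster.comp (measurable_ofData.comp measurable_subtype_coe))

theorem measurable_classOfData : Measurable classOfData :=
  fun _ hA => measurable_classOfData' (measurableSet_of_localClass hA)

/-- There are only countably many patterns, and by `iso_of_forall_ball` they separate the classes of
clusters with finite balls. -/
instance instCountablySeparatedRange : MeasurableSpace.CountablySeparated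
    (Set.range classOfData) := by
  refine ⟨⟨{A | ∃ r p, A = Subtype.val ⁻¹' (patternEvent r p : Set LocalClass)}, ?_, ?_, ?_⟩⟩
  · have : {A : Set (Set.range classOfData) | ∃ r p, A = Subtype.val ⁻¹'
        (patternEvent r p : Set LocalClass)} = Set.range
          fun x : ℕ × Σ n : ℕ, (Fin (n + 1) → Fin (n + 1) → ℕ) =>
            Subtype.val ⁻¹' (patternEvent x.1 x.2 : Set LocalClass) := by
      ext A
      constructor
      · rintro ⟨r, p, rfl⟩
        exact ⟨(r, p), rfl⟩
      · rintro ⟨⟨r, p⟩, rfl⟩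
        exact ⟨r, p, rfl⟩
    rw [this]
    exact Set.countable_range _
  · rintro _ ⟨r, p, rfl⟩
    have h : @MeasurableSet LocalClass instMeasurableSpaceLocalClass (patternEvent r p) :=
      MeasurableSpace.measurableSet_generateFrom ⟨r, p, rfl⟩
    exact @measurable_subtype_coe LocalClass instMeasurableSpaceLocalClass _ _ h
  · rintro ⟨_, y, rfl⟩ - ⟨_, z, rfl⟩ - h
    refine Subtype.ext (isoClass_eq_iff.2 ?_)
    have hpat (r : ℕ) (p : Σ n : ℕ, (Fin (n + 1) → Fin (n + 1) → ℕ)) :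
        (ofData y).cluster.HasPattern r p.1 p.2 ↔ (ofData z).cluster.HasPattern r p.1 p.2 := by
      rw [← isoClass_mem_patternEvent, ← isoClass_mem_patternEvent]
      exact h _ ⟨r, p, rfl⟩
    have hy (r : ℕ) : ∃ p : Σ n : ℕ, (Fin (n + 1) → Fin (n + 1) → ℕ),
        (ofData y).cluster.HasPattern r p.1 p.2 := by
      obtain ⟨p, hp⟩ := y.2 r
      exact ⟨p, (cluster_hasPattern_iff _ _ _ _).2 hp⟩
    refine iso_of_forall_ball (cluster_connected _) (cluster_connected _) (fun r => ?_)
      (fun r => ?_) fun r => ?_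
    · obtain ⟨p, hp⟩ := hy r
      exact hp.finite
    · obtain ⟨p, hp⟩ := hy r
      exact ((hpat r p).1 hp).finite
    · obtain ⟨p, hp⟩ := hy r
      exact hp.exists_isIsoMap_ball ((hpat r p).1 hp)

/-- Up to clusters with infinite balls, every invariant event belongs to the sigma-algebra generated
by ball patterns. -/
theorem exists_localClass_eq {B : Set IsoClass} (hB : MeasurableSet B) :
    ∃ T : Set LocalClass, MeasurableSet T ∧
      ∀ y : finiteBallData, isoClass (ofData y).cluster ∈ B ↔ classOfData y ∈ T := by
  have : StandardBorelSpace finiteBallData := measurableSet_finiteBallData.standardBorel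
  -- Descriptive set theory enters here: for a measurable map from a standard Borel space onto a
  -- countably separated range, a subset of the range with measurable preimage is measurable.
  have h := (measurable_classOfData.measurableSet_preimage_iff_preimage_val
    (s := (B : Set LocalClass))).1 (measurable_classOfData' hB)
  obtain ⟨T, hT, hTB⟩ := h
  refine ⟨T, hT, fun y => ?_⟩
  have : (⟨classOfData y, y, rfl⟩ : Set.range classOfData) ∈ Subtype.val ⁻¹' T ↔
      (⟨classOfData y, y, rfl⟩ : Set.range classOfData) ∈ Subtype.val ⁻¹' (B : Set LocalClass) := by
    rw [hTB]
    exact Iff.rfl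
  exact this.symm

theorem isoLaw_eq_of_isLocal {μ μ' : Measure (RootedMultigraph ℕ)} [IsProbabilityMeasure μ]
    [IsProbabilityMeasure μ'] (hc : ∀ᵐ G ∂μ, G.Connected) (hc' : ∀ᵐ G ∂μ', G.Connected)
    (hf : ∀ r, isoLaw μ (⋃ p, patternEvent r p) = 1)
    (h : ∀ r A, MeasurableSet A → IsLocal r A → isoLaw μ A = isoLaw μ' A) :
    isoLaw μ = isoLaw μ' := by
  have hp : IsProbabilityMeasure (isoLaw μ) :=
    Measure.isProbabilityMeasure_map measurable_isoClass.aemeasurable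
  have hp' : IsProbabilityMeasure (isoLaw μ') :=
    Measure.isProbabilityMeasure_map measurable_isoClass.aemeasurable
  have hU (r : ℕ) : MeasurableSet (⋃ p, patternEvent r p) :=
    MeasurableSet.iUnion fun p => measurableSet_patternEvent r p
  -- Finiteness of the `r`-ball is itself a local event, so it passes from `μ` to `μ'`.
  have hf' (r : ℕ) : isoLaw μ' (⋃ p, patternEvent r p) = 1 := by
    rw [← h r _ (hU r) (isLocal_iUnion fun p => isLocal_patternEvent r p), hf r]
  ext B hB
  obtain ⟨T, hT, hTB⟩ := exists_localClass_eq hB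
  have key (ν : Measure (RootedMultigraph ℕ)) (hν : IsProbabilityMeasure ν)
      (hc : ∀ᵐ G ∂ν, G.Connected) (hf : ∀ r, isoLaw ν (⋃ p, patternEvent r p) = 1) :
      isoLaw ν B = isoLaw ν (show Set IsoClass from T) := by
    have hf' : ∀ᵐ G ∂ν, ∀ r, isoClass G ∈ ⋃ p, patternEvent r p := by
      refine ae_all_iff.2 fun r => ?_
      have := hf r
      rw [isoLaw, Measure.map_apply measurable_isoClass (hU r)] at this
      exact (prob_compl_eq_zero_iff (measurable_isoClass (hU r))).2 this
    rw [isoLaw, Measure.map_apply measurable_isoClass hB,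
      Measure.map_apply measurable_isoClass (measurableSet_of_localClass hT)]
    refine measure_congr ?_
    filter_upwards [hc, hf'] with G hG hGf
    obtain ⟨y, rfl⟩ := ofData_surjective G
    have hy : y ∈ finiteBallData := fun r => by
      obtain ⟨p, hp⟩ := Set.mem_iUnion.1 (hGf r)
      exact ⟨p, (isoClass_mem_patternEvent _ r p).1 hp⟩
    have := hTB ⟨y, hy⟩
    simp only [classOfData, hG.cluster_eq] at this
    exact propext this
  rw [key μ inferInstance hc hf, key μ' inferInstance hc' hf']
  exact measure_localClass_eq h hT

end RootedMultigraph

namespace RootedMultigraph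

variable {V W : Type*}

/-! ### The hierarchical distance -/

theorem lastDiff_le_iff {x y : Gam} {n : ℕ} : lastDiff x y ≤ n ↔ ∀ i, n ≤ i → x i = y i := by
  simp only [lastDiff, Finset.sup_le_iff, Finsupp.mem_support_iff, Finsupp.sub_apply, sub_ne_zero,
    Nat.succ_le_iff]
  exact forall_congr' fun i => by rw [← not_imp_not, not_not, not_lt]

theorem lastDiff_sub (x y c : Gam) : lastDiff (x - c) (y - c) = lastDiff x y := by
  simp only [lastDiff, sub_sub_sub_cancel_right]

/-- Shift the coordinates by one and prepend a bit. -/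
noncomputable def prepend (p : Gam × Bool) : Gam :=
  p.1.embDomain ⟨Nat.succ, Nat.succ_injective⟩ + Finsupp.single 0 (if p.2 then 1 else 0)

theorem prepend_zero (p : Gam × Bool) : prepend p 0 = if p.2 then 1 else 0 := by
  rw [prepend, Finsupp.add_apply, Finsupp.embDomain_of_notMem_range, Finsupp.single_eq_same, zero_add]
  rintro ⟨n, hn⟩
  exact Nat.succ_ne_zero n hn

theorem prepend_succ (p : Gam × Bool) (n : ℕ) : prepend p (n + 1) = p.1 n := by
  have h := Finsupp.embDomain_apply_self ⟨Nat.succ, Nat.succ_injective⟩ p.1 n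
  rw [prepend, Finsupp.add_apply, Finsupp.single_eq_of_ne (Nat.succ_ne_zero n), add_zero]
  exact h

theorem prepend_bijective : Function.Bijective prepend := by
  constructor
  · rintro ⟨x, a⟩ ⟨y, b⟩ h
    refine Prod.ext (Finsupp.ext fun n => ?_) ?_
    · rw [← prepend_succ (x, a), h, prepend_succ]
    · have h0 := prepend_zero (x, a)
      rw [h, prepend_zero] at h0
      cases a <;> cases b <;> simp_all
  · intro z
    refine ⟨(z.comapDomain Nat.succ Nat.succ_injective.injOn, decide (z 0 = 1)), ?_⟩
    ext n
    cases n with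
    | zero =>
      have h : ∀ w : ZMod 2, (if decide (w = 1) = true then (1 : ZMod 2) else 0) = w := by decide
      rw [prepend_zero]
      exact h (z 0)
    | succ n =>
      rw [prepend_succ]
      rfl

theorem lastDiff_prepend_le_iff (x y : Gam) (a b : Bool) (n : ℕ) :
    lastDiff (prepend (x, a)) (prepend (y, b)) ≤ n + 1 ↔ lastDiff x y ≤ n := by
  simp only [lastDiff_le_iff]
  constructor
  · intro h i hi
    have := h (i + 1) (Nat.succ_le_succ hi)
    rwa [prepend_succ, prepend_succ] at this
  · rintro h (_ | i) hi
    · exact absurd hi (Nat.not_succ_le_zero n)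
    · rw [prepend_succ, prepend_succ]
      exact h i (Nat.succ_le_succ_iff.1 hi)

theorem lastDiff_eq_zero_iff {x y : Gam} : lastDiff x y = 0 ↔ x = y := by
  rw [← Nat.le_zero, lastDiff_le_iff, Finsupp.ext_iff]
  exact forall_congr' fun i => by simp

/-- This covers twins too: for `x = y` and different bits the value is 1. Distinctness of the pairs
rules out the value 0, about which `lastDiff_prepend_le_iff` says nothing. -/
theorem lastDiff_prepend {x y : Gam} {a b : Bool} (h : (x, a) ≠ (y, b)) :
    lastDiff (prepend (x, a)) (prepend (y, b)) = lastDiff x y + 1 := by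
  have h0 : lastDiff (prepend (x, a)) (prepend (y, b)) ≠ 0 := fun h' =>
    h (prepend_bijective.1 (lastDiff_eq_zero_iff.1 h'))
  obtain ⟨n, hn⟩ := Nat.exists_eq_succ_of_ne_zero h0
  refine le_antisymm ((lastDiff_prepend_le_iff x y a b _).2 le_rfl) ?_
  rw [hn]
  exact Nat.succ_le_succ ((lastDiff_prepend_le_iff x y a b n).1 hn.le)

/-- Prepend a bit, then translate such that the image of a given vertex becomes the origin. -/
noncomputable def prependEquiv (o : Gam × Bool) : Gam × Bool ≃ Gam :=
  (Equiv.ofBijective prepend prepend_bijective).trans (Equiv.subRight (prepend o))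

theorem prependEquiv_self (o : Gam × Bool) : prependEquiv o o = 0 := sub_self (prepend o)

theorem lastDiff_prependEquiv (o : Gam × Bool) {p q : Gam × Bool} (h : p ≠ q) :
    lastDiff (prependEquiv o p) (prependEquiv o q) = lastDiff p.1 q.1 + 1 :=
  (lastDiff_sub _ _ _).trans (lastDiff_prepend h)

theorem edgeMean_mk (lam : ℝ≥0) (x y : Gam) : edgeMean lam s(x, y) = 2 * lam / 4 ^ lastDiff x y :=
  rfl

/-- At most `2 ^ n` elements are at distance `n` from `x`, each with mean `2 * lam / 4 ^ n`, so the
sum is dominated by a geometric series. The constant 4 is crude, but only finiteness matters. -/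
theorem rowSum_edgeMean_le (lam : ℝ≥0) (x : Gam) : rowSum (edgeMean lam) x ≤ 4 * lam := by
  -- Beyond the last difference `y` agrees with `x`, so the distance and the coordinates before it
  -- determine `y`.
  let f (y : Gam) : Σ n : ℕ, (Fin n → ZMod 2) := ⟨lastDiff x y, fun i => y i⟩
  have hf : Function.Injective f := by
    intro y z h
    ext i
    have h1 : lastDiff x y = lastDiff x z := congrArg Sigma.fst h
    rcases lt_or_ge i (lastDiff x y) with hi | hi
    · have h2 (p q : Σ n : ℕ, (Fin n → ZMod 2)) (hpq : p = q) (hp : i < p.1) (hq : i < q.1) :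
          p.2 ⟨i, hp⟩ = q.2 ⟨i, hq⟩ := by
        subst hpq
        rfl
      exact h2 (f y) (f z) h hi (hi.trans_eq h1)
    · have hy : x i = y i := lastDiff_le_iff.1 (le_refl (lastDiff x y)) i hi
      have hz : x i = z i := lastDiff_le_iff.1 h1.ge i hi
      rw [← hy, hz]
  calc rowSum (edgeMean lam) x
      ≤ ∑' y, ((2 * lam / 4 ^ (f y).1 : ℝ≥0) : ℝ≥0∞) := by
        refine ENNReal.tsum_le_tsum fun y => ?_
        split_ifs
        · exact zero_le
        · exact le_rfl
    _ ≤ ∑' p : Σ n : ℕ, (Fin n → ZMod 2), ((2 * lam / 4 ^ p.1 : ℝ≥0) : ℝ≥0∞) :=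
        ENNReal.tsum_comp_le_tsum_of_injective hf _
    _ = ∑' n : ℕ, 2 * (lam : ℝ≥0∞) * 2⁻¹ ^ n := by
        rw [ENNReal.tsum_sigma']
        refine tsum_congr fun n => ?_
        rw [tsum_fintype]
        dsimp only
        rw [Finset.sum_const, Finset.card_univ, Fintype.card_fun, ZMod.card,
          Fintype.card_fin, nsmul_eq_mul]
        have : ((2 ^ n : ℕ) : ℝ≥0) * (2 * lam / 4 ^ n) = 2 * lam * 2⁻¹ ^ n := by
          rw [show (4 : ℝ≥0) = 2 * 2 by norm_num, mul_pow, inv_pow]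
          push_cast
          field_simp
        have h2 := congrArg ((↑) : ℝ≥0 → ℝ≥0∞) this
        rw [ENNReal.coe_mul, ENNReal.coe_natCast] at h2
        rw [h2]
        push_cast
        rfl
    _ = 4 * lam := by
        rw [ENNReal.tsum_mul_left, ENNReal.tsum_geometric, ENNReal.one_sub_inv_two, inv_inv]
        ring

/-! ### Invariance of the percolation cluster -/

theorem percolationGraph_eq (N : Sym2 Gam → ℕ) : percolationGraph N = graphOf 0 N := by
  refine ext rfl rfl fun x y => ?_
  by_cases h : x = y
  · rw [h, mult_self, mult_self]
  · rw [graphOf_mult_of_ne _ _ h]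
    exact if_neg h

theorem lintegral_graphOf_equiv [Countable V] [Countable W] (g : V ≃ W) (m : Sym2 W → ℝ≥0) (o : V)
    {F : IsoClass → ℝ≥0∞} (hF : Measurable F) :
    ∫⁻ N, F (isoClass (graphOf o N).cluster) ∂poissonLaw (fun e => m (e.map g)) =
      ∫⁻ N, F (isoClass (graphOf (g o) N).cluster) ∂poissonLaw m := by
  have hm : Measurable fun N : Sym2 V → ℕ => F (isoClass (graphOf o N).cluster) :=
    hF.comp (measurable_isoClass.comp (measurable_cluster.comp (measurable_graphOf_right o)))
  have h := Measure.map_infinitePi_infinitePi_of_inj (P := fun e : Sym2 W => poissonMeasure (m e))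
    (Sym2.map.injective g.injective)
  rw [poissonLaw, ← h, lintegral_map hm (by fun_prop)]
  refine lintegral_congr fun N => congrArg F ?_
  exact isoClass_eq_iff.2 (isIsoMap_graphOf g o N).cluster.iso

/-- The group times `Bool` is identified with the group by `prependEquiv`, under which the split
means become `edgeMean` again. -/
theorem lintegral_splitOp_percolation (lam : ℝ≥0) {F : IsoClass → ℝ≥0∞} (hF : Measurable F) :
    ∫⁻ N, splitOp lam F (isoClass (graphOf 0 N).cluster) ∂poissonLaw (edgeMean lam) =
      ∫⁻ N, F (isoClass (graphOf 0 N).cluster) ∂poissonLaw (edgeMean lam) := by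
  have hF' : Measurable fun G : RootedMultigraph (Gam × Bool) => F (isoClass G.cluster) :=
    hF.comp (measurable_isoClass.comp measurable_cluster)
  have h1 (o : Gam × Bool) (x y : Gam) (hxy : x ≠ y) (a b : Bool) :
      edgeMean lam (Sym2.map (prependEquiv o) s((x, a), (y, b))) = edgeMean lam s(x, y) / 4 := by
    rw [Sym2.map_mk, edgeMean_mk, edgeMean_mk,
      lastDiff_prependEquiv o fun h => hxy (congrArg Prod.fst h), pow_succ, div_div]
  have h2 (o : Gam × Bool) (x : Gam) :
      edgeMean lam (Sym2.map (prependEquiv o) s((x, false), (x, true))) = lam / 2 := by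
    rw [Sym2.map_mk, edgeMean_mk, lastDiff_prependEquiv o (by simp), lastDiff_eq_zero_iff.2 rfl]
    rw [zero_add, pow_one, show (4 : ℝ≥0) = 2 * 2 by norm_num, mul_div_mul_left _ _ two_ne_zero]
  -- The identifications for the two possible new roots differ by a translation, so they pull
  -- `edgeMean` back to the same means; the one for `(0, a)` sends this root to the origin.
  have key (a : Bool) : ∫⁻ N, F (isoClass (graphOf ((0 : Gam), a) N).cluster)
        ∂poissonLaw (fun e => edgeMean lam (e.map (prependEquiv (0, false)))) =
      ∫⁻ N, F (isoClass (graphOf 0 N).cluster) ∂poissonLaw (edgeMean lam) := by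
    have h : (fun e : Sym2 (Gam × Bool) => edgeMean lam (e.map (prependEquiv (0, false)))) =
        fun e => edgeMean lam (e.map (prependEquiv (0, a))) :=
      funext <| Sym2.ind fun p q => by
        rw [Sym2.map_mk, Sym2.map_mk, edgeMean_mk, edgeMean_mk]
        exact congrArg _ (congrArg _ ((lastDiff_sub _ _ _).trans (lastDiff_sub _ _ _).symm))
    rw [h, lintegral_graphOf_equiv (prependEquiv (0, a)) (edgeMean lam) (0, a) hF,
      prependEquiv_self]
  simp only [splitOp_isoClass_cluster lam hF]
  rw [lintegral_split_poisson lam (edgeMean lam)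
    (fun e => edgeMean lam (e.map (prependEquiv (0, false)))) (h1 _) (h2 _) 0 hF']
  simp only [key, lintegral_const, measure_univ, mul_one]

end RootedMultigraph

namespace RootedMultigraph

variable {V W : Type*}

/-! ### The percolation cluster with labels in `ℕ`, and the conclusion -/

theorem Connected.relabel {G : RootedMultigraph V} (h : G.Connected) (f : V ↪ W) :
    (G.relabel f).Connected := by
  rintro _ ⟨v, hv, rfl⟩
  obtain ⟨k, hk⟩ := reachable_iff_exists_within.1 (h v hv)
  exact reachable_iff_exists_within.2 ⟨k, ((isIsoMap_relabel f G).within_iff hv).2 hk⟩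

theorem measurableSet_connected [Countable V] :
    MeasurableSet {G : RootedMultigraph V | G.Connected} := by
  have : {G : RootedMultigraph V | G.Connected} =
      ⋂ v, {G : RootedMultigraph V | v ∈ G.verts}ᶜ ∪ {G | G.Reachable v} := by
    ext G
    simp [Connected, imp_iff_not_or]
  rw [this]
  exact MeasurableSet.iInter fun v =>
    (measurableSet_mem_verts v).compl.union (measurableSet_reachable v)

theorem rootDegree_relabel (f : V ↪ W) (G : RootedMultigraph V) :
    (G.relabel f).rootDegree = G.rootDegree := by
  have h : Function.support (fun w => ((G.relabel f).mult (f G.root) w : ℝ≥0∞)) ⊆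
      Set.range f := by
    intro w hw
    by_contra hwf
    refine hw ?_
    dsimp only
    rw [relabel_mult_eq_zero, Nat.cast_zero]
    rintro ⟨u, v, -, rfl⟩
    exact hwf ⟨v, rfl⟩
  refine (f.injective.tsum_eq h).symm.trans (tsum_congr fun v => ?_)
  rw [relabel_mult_apply]

theorem rootDegree_cluster (G : RootedMultigraph V) : G.cluster.rootDegree = G.rootDegree :=
  tsum_congr fun v => by
    rw [show G.cluster.root = G.root from rfl,
      cluster_mult_of_reachable (Relation.ReflTransGen.refl : G.Reachable G.root)]

theorem lintegral_rootDegree_graphOf [Countable V] (m : Sym2 V → ℝ≥0) (o : V) :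
    ∫⁻ N, (graphOf o N).rootDegree ∂poissonLaw m = rowSum m o := by
  classical
  have hm (v : V) : Measurable fun N : Sym2 V → ℕ => ((graphOf o N).mult o v : ℝ≥0∞) :=
    (measurable_of_countable (fun n : ℕ => (n : ℝ≥0∞))).comp
      ((measurable_mult o v).comp (measurable_graphOf_right o))
  have h : ∫⁻ N, (graphOf o N).rootDegree ∂poissonLaw m =
      ∫⁻ N, ∑' v, ((graphOf o N).mult o v : ℝ≥0∞) ∂poissonLaw m := rfl
  rw [h, lintegral_tsum fun v => (hm v).aemeasurable]
  refine tsum_congr fun v => ?_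
  by_cases hv : v = o
  · simp [hv, mult_self]
  · simp only [graphOf_mult_of_ne o _ (Ne.symm hv), if_neg hv]
    have he := measurePreserving_eval_infinitePi (fun e : Sym2 V => poissonMeasure (m e)) s(o, v)
    rw [← lintegral_poissonMeasure]
    exact he.lintegral_comp (measurable_of_countable fun n : ℕ => (n : ℝ≥0∞))

/-- The cluster of the origin, with labels in `ℕ`. -/
noncomputable def labelledCluster (N : Sym2 Gam → ℕ) : RootedMultigraph ℕ :=
  (graphOf 0 N).cluster.relabel
    ⟨(exists_injective_nat Gam).choose, (exists_injective_nat Gam).choose_spec⟩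

theorem measurable_labelledCluster : Measurable labelledCluster :=
  (measurable_relabel _).comp (measurable_cluster.comp (measurable_graphOf_right 0))

theorem isoClass_labelledCluster (N : Sym2 Gam → ℕ) :
    isoClass (labelledCluster N) = isoClass (graphOf 0 N).cluster :=
  isoClass_relabel _ _

/-- The law of the cluster of the origin, with labels in `ℕ`. -/
noncomputable def labelledClusterLaw (lam : ℝ≥0) : Measure (RootedMultigraph ℕ) :=
  (poissonLaw (edgeMean lam)).map labelledCluster

instance instIsProbabilityMeasureLabelledClusterLaw (lam : ℝ≥0) :
    IsProbabilityMeasure (labelledClusterLaw lam) :=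
  Measure.isProbabilityMeasure_map measurable_labelledCluster.aemeasurable

theorem ae_connected_labelledClusterLaw (lam : ℝ≥0) :
    ∀ᵐ G ∂labelledClusterLaw lam, G.Connected :=
  (ae_map_iff measurable_labelledCluster.aemeasurable measurableSet_connected).2 <|
    Filter.Eventually.of_forall fun _ => (cluster_connected _).relabel _

theorem lintegral_rootDegree_labelledClusterLaw_lt_top (lam : ℝ≥0) :
    ∫⁻ G, G.rootDegree ∂labelledClusterLaw lam < ∞ := by
  rw [labelledClusterLaw, lintegral_map measurable_rootDegree measurable_labelledCluster]
  simp only [labelledCluster, rootDegree_relabel, rootDegree_cluster, lintegral_rootDegree_graphOf]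
  exact (rowSum_edgeMean_le lam 0).trans_lt (ENNReal.mul_lt_top (by simp) ENNReal.coe_lt_top)

theorem isoLaw_labelledClusterLaw (lam : ℝ≥0) :
    isoLaw (labelledClusterLaw lam) = percolationClusterLaw lam := by
  have h : Measurable fun N : Sym2 Gam → ℕ => (percolationGraph N).cluster := by
    simp only [percolationGraph_eq]
    exact measurable_cluster.comp (measurable_graphOf_right 0)
  rw [percolationClusterLaw, isoLaw, isoLaw, labelledClusterLaw,
    Measure.map_map measurable_isoClass measurable_labelledCluster,
    Measure.map_map measurable_isoClass h]
  congr 1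
  funext N
  rw [Function.comp_apply, Function.comp_apply, isoClass_labelledCluster, percolationGraph_eq]

theorem lintegral_isoLaw_labelledClusterLaw (lam : ℝ≥0) {F : IsoClass → ℝ≥0∞} (hF : Measurable F) :
    ∫⁻ q, F q ∂isoLaw (labelledClusterLaw lam) =
      ∫⁻ N, F (isoClass (graphOf 0 N).cluster) ∂poissonLaw (edgeMean lam) := by
  have h : Measurable fun G : RootedMultigraph ℕ => F (isoClass G) := hF.comp measurable_isoClass
  rw [lintegral_isoLaw hF, labelledClusterLaw, lintegral_map h measurable_labelledCluster]
  simp only [isoClass_labelledCluster]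

/-- The measures are compared by their integrals, where duality reduces the claim to
`lintegral_splitOp_percolation`. -/
theorem isoLaw_splitLaw_labelledClusterLaw (lam : ℝ≥0) :
    isoLaw (splitLaw lam (labelledClusterLaw lam)) = isoLaw (labelledClusterLaw lam) := by
  refine Measure.ext_of_lintegral _ fun F hF => ?_
  rw [lintegral_isoLaw_splitLaw lam hF, lintegral_isoLaw_labelledClusterLaw lam hF,
    lintegral_isoLaw_labelledClusterLaw lam (measurable_splitOp lam hF),
    lintegral_splitOp_percolation lam hF]

theorem isInvariantLaw_percolationClusterLaw (lam : ℝ≥0) :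
    IsInvariantLaw lam (percolationClusterLaw lam) :=
  ⟨labelledClusterLaw lam, inferInstance, ae_connected_labelledClusterLaw lam,
    lintegral_rootDegree_labelledClusterLaw_lt_top lam, isoLaw_labelledClusterLaw lam,
    (isoLaw_splitLaw_labelledClusterLaw lam).trans (isoLaw_labelledClusterLaw lam)⟩

/-- The expected size of a ball is finite, so almost surely the ball is finite and has a pattern. -/
theorem isoLaw_labelledClusterLaw_iUnion_patternEvent (lam : ℝ≥0) (r : ℕ) :
    isoLaw (labelledClusterLaw lam) (⋃ p, patternEvent r p) = 1 := by
  classical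
  have hU : MeasurableSet (⋃ p, patternEvent r p) :=
    MeasurableSet.iUnion fun p => measurableSet_patternEvent r p
  have hm : Measurable fun N : Sym2 Gam → ℕ =>
      ∑' x, (if (graphOf 0 N).Within r x then (1 : ℝ≥0∞) else 0) :=
    Measurable.tsum fun x => Measurable.ite
      (measurable_graphOf_right 0 (measurableSet_within r x)) measurable_const measurable_const
  have hfin : ∫⁻ N, ∑' x, (if (graphOf (0 : Gam) N).Within r x then (1 : ℝ≥0∞) else 0)
      ∂poissonLaw (edgeMean lam) ≠ ∞ := by
    refine ne_top_of_le_ne_top ?_ (lintegral_ball_le (rowSum_edgeMean_le lam) r 0)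
    refine ENNReal.sum_ne_top.2 fun i _ => ENNReal.pow_ne_top ?_
    exact ENNReal.mul_ne_top (by simp) ENNReal.coe_ne_top
  have hmc : Measurable (isoClass ∘ labelledCluster) :=
    measurable_isoClass.comp measurable_labelledCluster
  rw [isoLaw, labelledClusterLaw, Measure.map_map measurable_isoClass measurable_labelledCluster,
    Measure.map_apply hmc hU]
  refine (prob_compl_eq_zero_iff (hmc hU)).1 ?_
  change ∀ᵐ N ∂poissonLaw (edgeMean lam), isoClass (labelledCluster N) ∈ ⋃ p, patternEvent r p
  filter_upwards [ae_lt_top hm hfin] with N hN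
  have hball : {v | (graphOf 0 N).Within r v}.Finite := by
    refine (ENNReal.finite_const_le_of_tsum_ne_top hN.ne one_ne_zero).subset fun v hv => ?_
    change (1 : ℝ≥0∞) ≤ if (graphOf 0 N).Within r v then 1 else 0
    rw [if_pos (show (graphOf 0 N).Within r v from hv)]
  obtain ⟨p, hp⟩ := exists_hasPattern_of_finite hball
  refine Set.mem_iUnion.2 ⟨p, ?_⟩
  rw [isoClass_labelledCluster, isoClass_mem_patternEvent, cluster_hasPattern_iff]
  exact hp

/-- Finiteness of balls is known for the percolation cluster, so this law takes the first place in
`isoLaw_eq_of_isLocal`; nothing of the kind has to be known for `L` beforehand. -/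
theorem IsInvariantLaw.eq_percolationClusterLaw {lam : ℝ≥0} {L : Measure IsoClass}
    (hL : IsInvariantLaw lam L) : L = percolationClusterLaw lam := by
  obtain ⟨μ, hp, hc, -, hμ, -⟩ := id hL
  rw [← hμ, ← isoLaw_labelledClusterLaw]
  refine (isoLaw_eq_of_isLocal (ae_connected_labelledClusterLaw lam) hc
    (isoLaw_labelledClusterLaw_iUnion_patternEvent lam) fun r A hA hloc => ?_).symm
  rw [hμ, isoLaw_labelledClusterLaw]
  exact (isInvariantLaw_percolationClusterLaw lam).eq_of_isLocal hL hA hloc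

end RootedMultigraph

theorem proposition1 (lam : ℝ≥0) :
    (∃! L : Measure RootedMultigraph.IsoClass, RootedMultigraph.IsInvariantLaw lam L) ∧
      ∀ L : Measure RootedMultigraph.IsoClass,
        RootedMultigraph.IsInvariantLaw lam L → L = RootedMultigraph.percolationClusterLaw lam :=
  ⟨⟨_, RootedMultigraph.isInvariantLaw_percolationClusterLaw lam,
    fun _ h => h.eq_percolationClusterLaw⟩, fun _ h => h.eq_percolationClusterLaw⟩
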